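/- Let $k$ be a field, $Q$ a finite quiver, $K=k^{Q_0}$, and let $I\subseteq kQ$ be a two-sided ideal that is admissible and homogeneous for the length of paths, so that $A=kQ/I=\bigoplus_{i\ge 0}A_i$ is a finite dimensional algebra graded by path length with $A_0=K$. Let $n\ge 0$ be an integer. Suppose that 1. $A$ is $n$-homogeneous, i.e. every maximal bound path (a path with nonzero image in $A$ that becomes zero in $A$ when it is extended by any arrow at either end) has length $n$; in particular $A=K\oplus A_1\oplus\cdots\oplus A_n$; 2. $A$ is a Koszul algebra, i.e. the graded left $A$-module $A_0$ has a graded projective resolution $\cdots\to P_1\to P_0\to A_0\to 0$ with $P_i$ generated in degree $i$. Let $\nu$ be the graded automorphism of $A$ that fixes $K$ and sends every arrow $a\in Q_1$ to $(-1)^n a$, let $_\nu A$ be the $A$-bimodule $A$ with the structure $a\cdot b\cdot c=\nu(a)bc$, let $(-)^\vee=\mathrm{Hom}_k(-,k)$, and let $A\ltimes({}_\nu A)^\vee$ be the twisted trivial extension, with product $(a,f)(b,g)=(ab,\,ag+fb)$ and with the grading in which the component of degree $d$ is $A_d\oplus (A_{n+1-d})^\vee$. Suppose moreover that 3. $A\ltimes({}_\nu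 A)^\vee$ is quadratic, i.e. generated by its components of degree $0$ and $1$ with relations generated in degree $2$. For a graded algebra $\Lambda$ with $\Lambda_0=K$ write $\Lambda^!=T_K(\Lambda_1^\vee)/(R^\perp)$ for its quadratic dual, where $R$ is the kernel of the multiplication $\Lambda_1\otimes_K\Lambda_1\to\Lambda_2$. Put $B=A^!$, $B^e=B\otimes_k B^{\mathrm{op}}$, and let $$\Pi(A^!)=T_B\big(\mathrm{Ext}^n_{B^e}(B,B^e)\big)$$ be the higher preprojective algebra of $B$, i.e. the tensor algebra over $B$ of the $B$-bimodule $\mathrm{Ext}^n_{B^e}(B,B^e)$. Then there is an isomorphism of $k$-algebras $$\Pi(A^!)\;\cong\;\big(A\ltimes({}_\nu A)^\vee\big)^!$$ that is the identity on $K$. -/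

import Mathlib

open CategoryTheory TensorProduct

universe u v w

/-! ### Tensor algebras of bimodules -/

section TensorRing

variable (k : Type*) [Field k] (B : Type*) [Ring B] [Algebra k B]
  (M : Type*) [AddCommGroup M] [Module B M] [Module Bᵐᵒᵖ M]

/-- The defining relations of the tensor algebra `T_B(M) = B ⊕ M ⊕ (M ⊗_B M) ⊕ ⋯` of a
`B`-bimodule `M`, on the generators `b ∈ B` and `m ∈ M`: the map from `B` is a homomorphism of
`k`-algebras, and the map from `M` is a homomorphism of `B`-bimodules. -/
inductive TensorRing.Rel : FreeAlgebra k (B ⊕ M) → FreeAlgebra k (B ⊕ M) → Prop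
  | scalar (r : k) :
      Rel (FreeAlgebra.ι k (Sum.inl (algebraMap k B r))) (algebraMap k (FreeAlgebra k (B ⊕ M)) r)
  | coeff_add (b c : B) :
      Rel (FreeAlgebra.ι k (Sum.inl (b + c)))
        (FreeAlgebra.ι k (Sum.inl b) + FreeAlgebra.ι k (Sum.inl c))
  | coeff_mul (b c : B) :
      Rel (FreeAlgebra.ι k (Sum.inl (b * c)))
        (FreeAlgebra.ι k (Sum.inl b) * FreeAlgebra.ι k (Sum.inl c))
  | add (x y : M) :
      Rel (FreeAlgebra.ι k (Sum.inr (x + y)))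
        (FreeAlgebra.ι k (Sum.inr x) + FreeAlgebra.ι k (Sum.inr y))
  | left_smul (b : B) (x : M) :
      Rel (FreeAlgebra.ι k (Sum.inr (b • x)))
        (FreeAlgebra.ι k (Sum.inl b) * FreeAlgebra.ι k (Sum.inr x))
  | right_smul (b : B) (x : M) :
      Rel (FreeAlgebra.ι k (Sum.inr (MulOpposite.op b • x)))
        (FreeAlgebra.ι k (Sum.inr x) * FreeAlgebra.ι k (Sum.inl b))

/-- The tensor algebra `T_B(M)` of a `B`-bimodule `M`, as the universal `k`-algebra with a
homomorphism of `k`-algebras from `B` and a homomorphism of `B`-bimodules from `M`. -/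
def TensorRing : Type _ := RingQuot (TensorRing.Rel k B M)

noncomputable instance : Ring (TensorRing k B M) :=
  inferInstanceAs (Ring (RingQuot (TensorRing.Rel k B M)))

noncomputable instance : Algebra k (TensorRing k B M) :=
  inferInstanceAs (Algebra k (RingQuot (TensorRing.Rel k B M)))

namespace TensorRing

/-- The quotient map from the free algebra. -/
noncomputable def mk : FreeAlgebra k (B ⊕ M) →ₐ[k] TensorRing k B M :=
  RingQuot.mkAlgHom k (TensorRing.Rel k B M)

theorem mk_rel {x y : FreeAlgebra k (B ⊕ M)} (h : TensorRing.Rel k B M x y) :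
    mk k B M x = mk k B M y :=
  RingQuot.mkAlgHom_rel k h

/-- The canonical homomorphism `B → T_B(M)`. -/
noncomputable def coeff : B →ₐ[k] TensorRing k B M where
  toFun b := mk k B M (FreeAlgebra.ι k (Sum.inl b))
  map_one' := by
    rw [← map_one (algebraMap k B), mk_rel k B M (Rel.scalar 1), map_one, map_one]
  map_mul' b c := by rw [mk_rel k B M (Rel.coeff_mul b c), map_mul]
  map_zero' := by
    rw [← map_zero (algebraMap k B), mk_rel k B M (Rel.scalar 0), map_zero, map_zero]
  map_add' b c := by rw [mk_rel k B M (Rel.coeff_add b c), map_add]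
  commutes' r := by rw [mk_rel k B M (Rel.scalar r), AlgHom.commutes]

/-- The canonical map `M → T_B(M)`. -/
noncomputable def ι : M →+ TensorRing k B M :=
  AddMonoidHom.mk' (fun x => mk k B M (FreeAlgebra.ι k (Sum.inr x)))
    (fun x y => by rw [mk_rel k B M (Rel.add x y), map_add])

theorem ι_smul (b : B) (x : M) : ι k B M (b • x) = coeff k B M b * ι k B M x := by
  change mk k B M _ = mk k B M _ * mk k B M _
  rw [mk_rel k B M (Rel.left_smul b x), map_mul]

theorem ι_op_smul (b : B) (x : M) :
    ι k B M (MulOpposite.op b • x) = ι k B M x * coeff k B M b := by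
  change mk k B M _ = mk k B M _ * mk k B M _
  rw [mk_rel k B M (Rel.right_smul b x), map_mul]

variable {k B M}

/-- The universal property of the tensor algebra. -/
noncomputable def lift {C : Type*} [Ring C] [Algebra k C] (f : B →ₐ[k] C) (g : M →+ C)
    (hl : ∀ (b : B) (x : M), g (b • x) = f b * g x)
    (hr : ∀ (b : B) (x : M), g (MulOpposite.op b • x) = g x * f b) :
    TensorRing k B M →ₐ[k] C :=
  RingQuot.liftAlgHom k ⟨FreeAlgebra.lift k (Sum.elim f g), by
    rintro _ _ (_ | _ | _ | _ | _ | _) <;> simp [hl, hr]⟩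

variable (k B M) [Module k M] [IsScalarTower k B M]

/-- The canonical map `M → T_B(M)` as a `k`-linear map. -/
noncomputable def ιₗ : M →ₗ[k] TensorRing k B M where
  toFun := ι k B M
  map_add' := map_add _
  map_smul' r x := by
    rw [← algebraMap_smul B r x, ι_smul, AlgHom.commutes, Algebra.smul_def, RingHom.id_apply]

/-- The map `M ⊗_k M → T_B(M)`, `x ⊗ y ↦ xy`. -/
noncomputable def ι₂ : M ⊗[k] M →ₗ[k] TensorRing k B M :=
  TensorProduct.lift ((LinearMap.mul k (TensorRing k B M)).compl₁₂ (ιₗ k B M) (ιₗ k B M))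

end TensorRing

/-- The quadratic algebra `T_B(M) / (R)`, where `R` is a space of relations of degree two, given
through representatives in `M ⊗_k M` of elements of `M ⊗_B M`. -/
def QuadraticAlgebraOf [Module k M] [IsScalarTower k B M] (R : Submodule k (M ⊗[k] M)) : Type _ :=
  RingQuot (fun x y : TensorRing k B M => ∃ z ∈ R, x = TensorRing.ι₂ k B M z ∧ y = 0)

namespace QuadraticAlgebraOf

variable [Module k M] [IsScalarTower k B M] (R : Submodule k (M ⊗[k] M))

noncomputable instance : Ring (QuadraticAlgebraOf k B M R) :=
  inferInstanceAs (Ring (RingQuot _))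

noncomputable instance : Algebra k (QuadraticAlgebraOf k B M R) :=
  inferInstanceAs (Algebra k (RingQuot _))

/-- The quotient map `T_B(M) → T_B(M) / (R)`. -/
noncomputable def mk : TensorRing k B M →ₐ[k] QuadraticAlgebraOf k B M R :=
  RingQuot.mkAlgHom k _

/-- The canonical homomorphism `B → T_B(M) / (R)`. -/
noncomputable def coeff : B →ₐ[k] QuadraticAlgebraOf k B M R :=
  (mk k B M R).comp (TensorRing.coeff k B M)

variable {k B M R}

/-- The universal property of `T_B(M) / (R)`. -/
noncomputable def lift {C : Type*} [Ring C] [Algebra k C] (f : TensorRing k B M →ₐ[k] C)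
    (hf : ∀ z ∈ R, f (TensorRing.ι₂ k B M z) = 0) : QuadraticAlgebraOf k B M R →ₐ[k] C :=
  RingQuot.liftAlgHom k ⟨f, by
    rintro _ _ ⟨z, hz, rfl, rfl⟩
    rw [hf z hz, map_zero]⟩

end QuadraticAlgebraOf

end TensorRing

/-! ### Graded algebras: quadratic algebras, quadratic duals, Koszul algebras -/

/-- The left ideal generated by the homogeneous elements of positive degree, which is the
two-sided ideal `Λ_{>0}`. -/
def positiveIdeal {k : Type u} [Field k] {Λ : Type v} [Ring Λ] [Algebra k Λ]
    (𝒜 : ℕ → Submodule k Λ) : Ideal Λ :=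
  Ideal.span {a | ∃ d, 0 < d ∧ a ∈ 𝒜 d}

section Graded

variable {k : Type u} [Field k] {Λ : Type v} [Ring Λ] [Algebra k Λ]
  (𝒜 : ℕ → Submodule k Λ)

/-- The degree one component of a graded algebra, as a bimodule over the degree zero component. -/
def DegreeOne : Type v := 𝒜 1

namespace DegreeOne

instance : AddCommGroup (DegreeOne 𝒜) := inferInstanceAs (AddCommGroup (𝒜 1))

instance : Module k (DegreeOne 𝒜) := inferInstanceAs (Module k (𝒜 1))

/-- The inclusion of the degree one component. -/
def val : DegreeOne 𝒜 →ₗ[k] Λ := (𝒜 1).subtype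

variable {𝒜} in
theorem val_injective : Function.Injective (val 𝒜) := Subtype.val_injective

variable [SetLike.GradedMonoid 𝒜]

/-- Left multiplication `x ↦ ax` by an element `a` of degree zero. -/
def lmul (a : 𝒜 0) : DegreeOne 𝒜 →ₗ[k] DegreeOne 𝒜 :=
  ((LinearMap.mulLeft k (a : Λ)).comp (𝒜 1).subtype).codRestrict (𝒜 1) fun x => by
    simpa using SetLike.mul_mem_graded a.2 x.2

/-- Right multiplication `x ↦ xa` by an element `a` of degree zero. -/
def rmul (a : 𝒜 0) : DegreeOne 𝒜 →ₗ[k] DegreeOne 𝒜 :=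
  ((LinearMap.mulRight k (a : Λ)).comp (𝒜 1).subtype).codRestrict (𝒜 1) fun x => by
    simpa using SetLike.mul_mem_graded x.2 a.2

variable {𝒜}

instance : Module (𝒜 0) (DegreeOne 𝒜) where
  smul a x := lmul 𝒜 a x
  one_smul x := val_injective (one_mul (val 𝒜 x))
  mul_smul a b x := val_injective (mul_assoc (a : Λ) b (val 𝒜 x))
  smul_zero a := map_zero (lmul 𝒜 a)
  smul_add a := map_add (lmul 𝒜 a)
  add_smul a b x := val_injective (add_mul (a : Λ) b (val 𝒜 x))
  zero_smul x := val_injective (zero_mul (val 𝒜 x))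

instance : Module (𝒜 0)ᵐᵒᵖ (DegreeOne 𝒜) where
  smul a x := rmul 𝒜 a.unop x
  one_smul x := val_injective (mul_one (val 𝒜 x))
  mul_smul a b x := val_injective (mul_assoc (val 𝒜 x) (b.unop : Λ) a.unop).symm
  smul_zero a := map_zero (rmul 𝒜 a.unop)
  smul_add a := map_add (rmul 𝒜 a.unop)
  add_smul a b x := val_injective (mul_add (val 𝒜 x) (a.unop : Λ) b.unop)
  zero_smul x := val_injective (mul_zero (val 𝒜 x))

theorem val_smul (a : 𝒜 0) (x : DegreeOne 𝒜) : val 𝒜 (a • x) = a * val 𝒜 x := rfl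

theorem val_op_smul (a : 𝒜 0) (x : DegreeOne 𝒜) :
    val 𝒜 (MulOpposite.op a • x) = val 𝒜 x * a := rfl

instance : IsScalarTower k (𝒜 0) (DegreeOne 𝒜) where
  smul_assoc r a x := val_injective (smul_mul_assoc r (a : Λ) (val 𝒜 x))

end DegreeOne

/-- The `k`-dual of the degree one component, as a bimodule over the degree zero component by
`(a • f)(x) = f(xa)` and `(f • a)(x) = f(ax)`. -/
def DegreeOneDual : Type _ := Module.Dual k (DegreeOne 𝒜)

namespace DegreeOneDual

instance : AddCommGroup (DegreeOneDual 𝒜) :=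
  inferInstanceAs (AddCommGroup (Module.Dual k (DegreeOne 𝒜)))

instance : Module k (DegreeOneDual 𝒜) :=
  inferInstanceAs (Module k (Module.Dual k (DegreeOne 𝒜)))

/-- The underlying functional of an element of the dual. -/
def toDual : DegreeOneDual 𝒜 ≃ₗ[k] Module.Dual k (DegreeOne 𝒜) := LinearEquiv.refl k _

variable {𝒜} in
theorem ext {f g : DegreeOneDual 𝒜} (h : ∀ x, toDual 𝒜 f x = toDual 𝒜 g x) : f = g :=
  (toDual 𝒜).injective (LinearMap.ext h)

end DegreeOneDual

variable [SetLike.GradedMonoid 𝒜]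

/-- The multiplication `Λ₁ ⊗_k Λ₁ → Λ` of a graded algebra (with image in `Λ₂`). -/
noncomputable def degreeOneMul : DegreeOne 𝒜 ⊗[k] DegreeOne 𝒜 →ₗ[k] Λ :=
  TensorProduct.lift ((LinearMap.mul k Λ).compl₁₂ (DegreeOne.val 𝒜) (DegreeOne.val 𝒜))

/-- The canonical homomorphism `T_{Λ₀}(Λ₁) → Λ`. -/
noncomputable def tensorRingToGraded : TensorRing k (𝒜 0) (DegreeOne 𝒜) →ₐ[k] Λ :=
  TensorRing.lift (SetLike.GradeZero.subalgebra 𝒜).val (DegreeOne.val 𝒜).toAddMonoidHom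
    (fun _ _ => rfl) (fun _ _ => rfl)

theorem tensorRingToGraded_ι₂ (z : DegreeOne 𝒜 ⊗[k] DegreeOne 𝒜) :
    tensorRingToGraded 𝒜 (TensorRing.ι₂ k (𝒜 0) (DegreeOne 𝒜) z) = degreeOneMul 𝒜 z := by
  have key : ∀ x, tensorRingToGraded 𝒜 (TensorRing.ι k (𝒜 0) (DegreeOne 𝒜) x)
      = DegreeOne.val 𝒜 x := fun x => by
    change (RingQuot.liftAlgHom k _) (RingQuot.mkAlgHom k _ _) = _
    rw [RingQuot.liftAlgHom_mkAlgHom_apply, FreeAlgebra.lift_ι_apply]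
    rfl
  induction z with
  | zero => simp
  | add x y hx hy => rw [map_add, map_add, hx, hy, map_add]
  | tmul x y =>
    change tensorRingToGraded 𝒜 (TensorRing.ι k _ _ x * TensorRing.ι k _ _ y) = _
    rw [map_mul, key, key]
    rfl

/-- The canonical homomorphism `T_{Λ₀}(Λ₁) / (R) → Λ`, where `R` is the kernel of the
multiplication `Λ₁ ⊗_{Λ₀} Λ₁ → Λ₂`. -/
noncomputable def quadraticCover :
    QuadraticAlgebraOf k (𝒜 0) (DegreeOne 𝒜) (LinearMap.ker (degreeOneMul 𝒜)) →ₐ[k] Λ :=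
  QuadraticAlgebraOf.lift (tensorRingToGraded 𝒜) fun z hz => by
    rw [tensorRingToGraded_ι₂]
    exact hz

/-- A graded algebra is quadratic if it is generated by its components of degree zero and one,
with relations generated in degree two. -/
def IsQuadraticAlgebra : Prop := Function.Bijective (quadraticCover 𝒜)

namespace DegreeOneDual

variable {𝒜}

instance : Module (𝒜 0) (DegreeOneDual 𝒜) where
  smul a f := (toDual 𝒜).symm ((toDual 𝒜 f).comp (DegreeOne.rmul 𝒜 a))
  one_smul f := ext fun x => congrArg (toDual 𝒜 f) (one_smul (𝒜 0)ᵐᵒᵖ x)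
  mul_smul a b f := ext fun x =>
    congrArg (toDual 𝒜 f) (mul_smul (MulOpposite.op b) (MulOpposite.op a) x)
  smul_zero _ := rfl
  smul_add _ _ _ := rfl
  add_smul a b f := ext fun x =>
    (congrArg (toDual 𝒜 f) (add_smul (MulOpposite.op a) (MulOpposite.op b) x)).trans
      (map_add (toDual 𝒜 f) _ _)
  zero_smul f := ext fun x =>
    (congrArg (toDual 𝒜 f) (zero_smul (𝒜 0)ᵐᵒᵖ x)).trans (map_zero (toDual 𝒜 f))

instance : Module (𝒜 0)ᵐᵒᵖ (DegreeOneDual 𝒜) where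
  smul a f := (toDual 𝒜).symm ((toDual 𝒜 f).comp (DegreeOne.lmul 𝒜 a.unop))
  one_smul f := ext fun x => congrArg (toDual 𝒜 f) (one_smul (𝒜 0) x)
  mul_smul a b f := ext fun x => congrArg (toDual 𝒜 f) (mul_smul b.unop a.unop x)
  smul_zero _ := rfl
  smul_add _ _ _ := rfl
  add_smul a b f := ext fun x =>
    (congrArg (toDual 𝒜 f) (add_smul a.unop b.unop x)).trans (map_add (toDual 𝒜 f) _ _)
  zero_smul f := ext fun x =>
    (congrArg (toDual 𝒜 f) (zero_smul (𝒜 0) x)).trans (map_zero (toDual 𝒜 f))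

theorem toDual_smul (a : 𝒜 0) (f : DegreeOneDual 𝒜) (x : DegreeOne 𝒜) :
    toDual 𝒜 (a • f) x = toDual 𝒜 f (MulOpposite.op a • x) := rfl

theorem toDual_op_smul (a : 𝒜 0) (f : DegreeOneDual 𝒜) (x : DegreeOne 𝒜) :
    toDual 𝒜 (MulOpposite.op a • f) x = toDual 𝒜 f (a • x) := rfl

instance : IsScalarTower k (𝒜 0) (DegreeOneDual 𝒜) where
  smul_assoc r a f := ext fun x =>
    (congrArg (toDual 𝒜 f) (DegreeOne.val_injective
      (mul_smul_comm r (DegreeOne.val 𝒜 x) (a : Λ)) :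
        MulOpposite.op (r • a) • x = r • MulOpposite.op a • x)).trans
      (map_smul (toDual 𝒜 f) r _)

variable (𝒜)

/-- The pairing `(f ⊗ g, x ⊗ y) ↦ f(x) g(y)`. -/
noncomputable def pairing : DegreeOneDual 𝒜 ⊗[k] DegreeOneDual 𝒜 →ₗ[k]
    Module.Dual k (DegreeOne 𝒜 ⊗[k] DegreeOne 𝒜) :=
  (TensorProduct.dualDistrib k (DegreeOne 𝒜) (DegreeOne 𝒜)).comp
    (TensorProduct.map (toDual 𝒜).toLinearMap (toDual 𝒜).toLinearMap)

end DegreeOneDual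

/-- The orthogonal complement `R^⊥ ⊆ Λ₁^∨ ⊗ Λ₁^∨` of the kernel `R` of the multiplication
`Λ₁ ⊗ Λ₁ → Λ₂`. The pairing is `⟨f ⊗ g, x ⊗ y⟩ = f(y) g(x)`, the one that is compatible with the
structures of `Λ₀`-bimodules: for finite dimensional `Λ₁` and semisimple commutative split `Λ₀`, it
identifies `Λ₁^∨ ⊗_{Λ₀} Λ₁^∨` with `(Λ₁ ⊗_{Λ₀} Λ₁)^∨`. -/
noncomputable def dualRelations : Submodule k (DegreeOneDual 𝒜 ⊗[k] DegreeOneDual 𝒜) where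
  carrier := {z | ∀ y ∈ LinearMap.ker (degreeOneMul 𝒜),
    DegreeOneDual.pairing 𝒜 z (TensorProduct.comm k (DegreeOne 𝒜) (DegreeOne 𝒜) y) = 0}
  zero_mem' y _ := by rw [map_zero, LinearMap.zero_apply]
  add_mem' {a b} ha hb y hy := by
    rw [map_add, LinearMap.add_apply, ha y hy, hb y hy, add_zero]
  smul_mem' r a ha y hy := by
    rw [map_smul, LinearMap.smul_apply, ha y hy, smul_zero]

/-- The quadratic dual `Λ^! = T_{Λ₀}(Λ₁^∨) / (R^⊥)` of a graded algebra `Λ`. -/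
abbrev QuadraticDual : Type _ :=
  QuadraticAlgebraOf k (𝒜 0) (DegreeOneDual 𝒜) (dualRelations 𝒜)

/-- The canonical homomorphism `Λ₀ → Λ^!`. -/
noncomputable abbrev QuadraticDual.coeff : 𝒜 0 →ₐ[k] QuadraticDual 𝒜 :=
  QuadraticAlgebraOf.coeff k (𝒜 0) (DegreeOneDual 𝒜) (dualRelations 𝒜)

/-- A graded algebra `Λ` is Koszul if `Λ₀` is semisimple and the graded left `Λ`-module
`Λ₀ = Λ / Λ_{>0}` has a graded projective resolution `⋯ → P₁ → P₀ → Λ₀ → 0` such that every `Pᵢ`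
is generated by its component of degree `i`. Here `ℳ i j` is the component of degree `j`
of `Pᵢ`. -/
def IsKoszulAlgebra : Prop :=
  IsSemisimpleRing (𝒜 0) ∧
  ∃ (P : ℕ → ModuleCat.{v} Λ) (ℳ : ∀ i, ℕ → AddSubgroup (P i))
    (d : ∀ i, P (i + 1) →ₗ[Λ] P i) (ε : P 0 →ₗ[Λ] Λ ⧸ positiveIdeal 𝒜),
    (∀ i, Module.Projective Λ (P i)) ∧
    (∀ i, DirectSum.IsInternal (ℳ i)) ∧
    (∀ i j l, ∀ a ∈ 𝒜 j, ∀ x ∈ ℳ i l, a • x ∈ ℳ i (j + l)) ∧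
    (∀ i, Submodule.span Λ (ℳ i i : Set (P i)) = ⊤) ∧
    (∀ i j, ∀ x ∈ ℳ (i + 1) j, d i x ∈ ℳ i j) ∧
    (∀ j, 0 < j → ∀ x ∈ ℳ 0 j, ε x = 0) ∧
    Function.Surjective ε ∧
    Function.Exact (d 0) ε ∧
    ∀ i, Function.Exact (d (i + 1)) (d i)

end Graded

/-! ### Higher preprojective algebras -/

section Preprojective

variable (k : Type u) [Field k] (B : Type v) [Ring B] [Algebra k B]

/-- An algebra `B` as a left module over its enveloping algebra `B ⊗ Bᵐᵒᵖ`, by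
`(a ⊗ b) • x = axb`. -/
noncomputable abbrev envelopingSelf : ModuleCat.{v} (B ⊗[k] Bᵐᵒᵖ) :=
  letI := instModuleTensorProductMop k B
  ModuleCat.of (B ⊗[k] Bᵐᵒᵖ) B

/-- Right multiplication by `x` on the enveloping algebra, as a map of left modules. -/
noncomputable def envelopingRMul (x : B ⊗[k] Bᵐᵒᵖ) :
    ModuleCat.of (B ⊗[k] Bᵐᵒᵖ) (B ⊗[k] Bᵐᵒᵖ) ⟶ ModuleCat.of (B ⊗[k] Bᵐᵒᵖ) (B ⊗[k] Bᵐᵒᵖ) :=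
  ModuleCat.ofHom (LinearMap.toSpanSingleton (B ⊗[k] Bᵐᵒᵖ) (B ⊗[k] Bᵐᵒᵖ) x)

/-- The extension group `Ext^n_{B^e}(B, B^e)`, where `B^e = B ⊗ Bᵐᵒᵖ`. It is a `B`-bimodule through
the inner bimodule structure `b • (x ⊗ y) • c = xc ⊗ by` of `B^e`, that is, through the right
multiplications on `B^e`. -/
def EnvelopingExt (n : ℕ) : Type v :=
  Abelian.Ext.{v} (envelopingSelf k B) (ModuleCat.of (B ⊗[k] Bᵐᵒᵖ) (B ⊗[k] Bᵐᵒᵖ)) n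

namespace EnvelopingExt

variable {k B}

theorem envelopingRMul_one : envelopingRMul k B 1 = 𝟙 _ :=
  ModuleCat.hom_ext (LinearMap.ext fun z => mul_one z)

theorem envelopingRMul_mul (x y : B ⊗[k] Bᵐᵒᵖ) :
    envelopingRMul k B (x * y) = envelopingRMul k B x ≫ envelopingRMul k B y :=
  ModuleCat.hom_ext (LinearMap.ext fun z => (mul_assoc z x y).symm)

theorem envelopingRMul_add (x y : B ⊗[k] Bᵐᵒᵖ) :
    envelopingRMul k B (x + y) = envelopingRMul k B x + envelopingRMul k B y :=
  ModuleCat.hom_ext (LinearMap.ext fun z => mul_add z x y)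

variable {n : ℕ}

noncomputable instance : AddCommGroup (EnvelopingExt k B n) :=
  inferInstanceAs (AddCommGroup (Abelian.Ext.{v} _ _ n))

/-- The action on `Ext^n_{B^e}(B, B^e)` of right multiplication by an element of `B^e`. -/
noncomputable def act (x : B ⊗[k] Bᵐᵒᵖ) : EnvelopingExt k B n →+ EnvelopingExt k B n :=
  (Abelian.Ext.mk₀ (envelopingRMul k B x)).postcomp (envelopingSelf k B) (add_zero n)

theorem act_one (e : EnvelopingExt k B n) : act 1 e = e := by
  have h : ∀ e : Abelian.Ext.{v} (envelopingSelf k B)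
      (ModuleCat.of (B ⊗[k] Bᵐᵒᵖ) (B ⊗[k] Bᵐᵒᵖ)) n,
      e.comp (Abelian.Ext.mk₀ (envelopingRMul k B 1)) (add_zero n) = e := fun e => by
    rw [envelopingRMul_one, Abelian.Ext.comp_mk₀_id]
  exact h e

theorem act_mul (x y : B ⊗[k] Bᵐᵒᵖ) (e : EnvelopingExt k B n) :
    act (x * y) e = act y (act x e) := by
  have h : ∀ e : Abelian.Ext.{v} (envelopingSelf k B)
      (ModuleCat.of (B ⊗[k] Bᵐᵒᵖ) (B ⊗[k] Bᵐᵒᵖ)) n,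
      e.comp (Abelian.Ext.mk₀ (envelopingRMul k B (x * y))) (add_zero n) =
      (e.comp (Abelian.Ext.mk₀ (envelopingRMul k B x)) (add_zero n)).comp
        (Abelian.Ext.mk₀ (envelopingRMul k B y)) (add_zero n) := fun e => by
    rw [envelopingRMul_mul, ← Abelian.Ext.mk₀_comp_mk₀,
      Abelian.Ext.comp_assoc_of_third_deg_zero]
  exact h e

theorem act_add (x y : B ⊗[k] Bᵐᵒᵖ) (e : EnvelopingExt k B n) :
    act (x + y) e = act x e + act y e := by
  have h : ∀ e : Abelian.Ext.{v} (envelopingSelf k B)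
      (ModuleCat.of (B ⊗[k] Bᵐᵒᵖ) (B ⊗[k] Bᵐᵒᵖ)) n,
      e.comp (Abelian.Ext.mk₀ (envelopingRMul k B (x + y))) (add_zero n) =
      e.comp (Abelian.Ext.mk₀ (envelopingRMul k B x)) (add_zero n) +
      e.comp (Abelian.Ext.mk₀ (envelopingRMul k B y)) (add_zero n) := fun e => by
    rw [envelopingRMul_add, Abelian.Ext.mk₀_add, Abelian.Ext.comp_add]
  exact h e

theorem act_zero (e : EnvelopingExt k B n) : act 0 e = 0 := by
  simpa using act_add 0 0 e

noncomputable instance : Module B (EnvelopingExt k B n) where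
  smul b e := act (1 ⊗ₜ[k] MulOpposite.op b) e
  one_smul e := act_one e
  mul_smul a b e := by
    change act _ _ = act _ (act _ _)
    rw [← act_mul, Algebra.TensorProduct.tmul_mul_tmul, one_mul, ← MulOpposite.op_mul]
  smul_zero b := map_zero (act _)
  smul_add b := map_add (act _)
  add_smul a b e := by
    change act _ _ = act _ _ + act _ _
    rw [MulOpposite.op_add, TensorProduct.tmul_add, act_add]
  zero_smul e := by
    change act _ _ = _
    rw [MulOpposite.op_zero, TensorProduct.tmul_zero, act_zero]

noncomputable instance : Module Bᵐᵒᵖ (EnvelopingExt k B n) where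
  smul c e := act (c.unop ⊗ₜ[k] 1) e
  one_smul e := act_one e
  mul_smul a b e := by
    change act _ _ = act _ (act _ _)
    rw [← act_mul, Algebra.TensorProduct.tmul_mul_tmul, one_mul, ← MulOpposite.unop_mul]
  smul_zero b := map_zero (act _)
  smul_add b := map_add (act _)
  add_smul a b e := by
    change act _ _ = act _ _ + act _ _
    rw [MulOpposite.unop_add, TensorProduct.add_tmul, act_add]
  zero_smul e := by
    change act _ _ = _
    rw [MulOpposite.unop_zero, TensorProduct.zero_tmul, act_zero]

end EnvelopingExt

/-- The higher preprojective algebra `Π(B) = T_B(Ext^n_{B^e}(B, B^e))` of an algebra `B` of global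
dimension `n`. -/
abbrev HigherPreprojectiveAlgebra (n : ℕ) : Type _ := TensorRing k B (EnvelopingExt k B n)

end Preprojective

/-! ### Bound quiver algebras -/

section PathAlgebra

variable (k : Type u) [Field k] (V : Type v) [Fintype V] [Quiver.{w} V]

/-- The generators of the path algebra: the vertices `Sum.inl i` and the arrows
`Sum.inr ⟨i, j, a⟩`, for `a : i ⟶ j`. -/
abbrev PathGenerator : Type max v w := V ⊕ (Σ i j : V, i ⟶ j)

/-- The defining relations of the path algebra: the vertices are orthogonal idempotents with
sum `1`, and `e_i a = a = a e_j` for every arrow `a : i ⟶ j`. -/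
inductive PathAlgebra.Rel :
    FreeAlgebra k (PathGenerator V) → FreeAlgebra k (PathGenerator V) → Prop
  | idem (i : V) :
      Rel (FreeAlgebra.ι k (Sum.inl i) * FreeAlgebra.ι k (Sum.inl i))
        (FreeAlgebra.ι k (Sum.inl i))
  | orthogonal (i j : V) (h : i ≠ j) :
      Rel (FreeAlgebra.ι k (Sum.inl i) * FreeAlgebra.ι k (Sum.inl j)) 0
  | sum_one : Rel (∑ i : V, FreeAlgebra.ι k (Sum.inl i)) 1
  | source {i j : V} (a : i ⟶ j) :
      Rel (FreeAlgebra.ι k (Sum.inl i) * FreeAlgebra.ι k (Sum.inr ⟨i, j, a⟩))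
        (FreeAlgebra.ι k (Sum.inr ⟨i, j, a⟩))
  | target {i j : V} (a : i ⟶ j) :
      Rel (FreeAlgebra.ι k (Sum.inr ⟨i, j, a⟩) * FreeAlgebra.ι k (Sum.inl j))
        (FreeAlgebra.ι k (Sum.inr ⟨i, j, a⟩))

/-- The path algebra `kQ` of a quiver `Q` with finitely many vertices; paths are composed from
left to right. -/
def PathAlgebra : Type max u v w := RingQuot (PathAlgebra.Rel k V)

namespace PathAlgebra

noncomputable instance : Ring (PathAlgebra k V) :=
  inferInstanceAs (Ring (RingQuot (PathAlgebra.Rel k V)))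

noncomputable instance : Algebra k (PathAlgebra k V) :=
  inferInstanceAs (Algebra k (RingQuot (PathAlgebra.Rel k V)))

/-- The quotient map from the free algebra. -/
noncomputable def mk : FreeAlgebra k (PathGenerator V) →ₐ[k] PathAlgebra k V :=
  RingQuot.mkAlgHom k (PathAlgebra.Rel k V)

variable {V}

/-- The idempotent of a vertex. -/
noncomputable def vertex (i : V) : PathAlgebra k V := mk k V (FreeAlgebra.ι k (Sum.inl i))

/-- The element of an arrow. -/
noncomputable def arrow {i j : V} (a : i ⟶ j) : PathAlgebra k V :=
  mk k V (FreeAlgebra.ι k (Sum.inr ⟨i, j, a⟩))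

theorem vertex_mul_self (i : V) : vertex k i * vertex k i = vertex k i := by
  unfold vertex
  rw [← map_mul]
  exact RingQuot.mkAlgHom_rel k (Rel.idem i)

theorem vertex_mul_of_ne {i j : V} (h : i ≠ j) : vertex k i * vertex k j = 0 := by
  unfold vertex
  rw [← map_mul, ← map_zero (mk k V)]
  exact RingQuot.mkAlgHom_rel k (Rel.orthogonal i j h)

theorem sum_vertex : ∑ i : V, vertex k i = 1 := by
  unfold vertex
  rw [← map_sum, ← map_one (mk k V)]
  exact RingQuot.mkAlgHom_rel k Rel.sum_one

theorem vertex_mul_arrow {i j : V} (a : i ⟶ j) : vertex k i * arrow k a = arrow k a := by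
  unfold vertex arrow
  rw [← map_mul]
  exact RingQuot.mkAlgHom_rel k (Rel.source a)

theorem arrow_mul_vertex {i j : V} (a : i ⟶ j) : arrow k a * vertex k j = arrow k a := by
  unfold vertex arrow
  rw [← map_mul]
  exact RingQuot.mkAlgHom_rel k (Rel.target a)

/-- The element of the path algebra of a path. -/
noncomputable def ofPath {i : V} : ∀ {j : V}, Quiver.Path i j → PathAlgebra k V
  | _, .nil => vertex k i
  | _, .cons p a => ofPath p * arrow k a

theorem vertex_mul_ofPath {i j : V} (p : Quiver.Path i j) :
    vertex k i * ofPath k p = ofPath k p := by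
  induction p with
  | nil => exact vertex_mul_self k i
  | cons p a ih => rw [ofPath, ← mul_assoc, ih]

theorem ofPath_mul_vertex {i j : V} (p : Quiver.Path i j) :
    ofPath k p * vertex k j = ofPath k p := by
  cases p with
  | nil => exact vertex_mul_self k i
  | cons p a => rw [ofPath, mul_assoc, arrow_mul_vertex]

theorem ofPath_comp {i j l : V} (p : Quiver.Path i j) (q : Quiver.Path j l) :
    ofPath k (p.comp q) = ofPath k p * ofPath k q := by
  induction q with
  | nil => exact (ofPath_mul_vertex k p).symm
  | cons q a ih => rw [Quiver.Path.comp_cons, ofPath, ofPath, ih, mul_assoc]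

theorem ofPath_mul_of_ne {i j i' j' : V} (p : Quiver.Path i j) (q : Quiver.Path i' j')
    (h : j ≠ i') : ofPath k p * ofPath k q = 0 := by
  rw [← ofPath_mul_vertex k p, ← vertex_mul_ofPath k q, mul_assoc, ← mul_assoc (vertex k j),
    vertex_mul_of_ne k h, zero_mul, mul_zero]

variable (V)

/-- The span of the paths of length `d`. -/
noncomputable def grading (d : ℕ) : Submodule k (PathAlgebra k V) :=
  Submodule.span k {x | ∃ (i j : V) (p : Quiver.Path i j), p.length = d ∧ x = ofPath k p}

instance : SetLike.GradedMonoid (grading k V) where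
  one_mem := by
    rw [← sum_vertex k]
    exact Submodule.sum_mem _ fun i _ => Submodule.subset_span ⟨i, i, .nil, rfl, rfl⟩
  mul_mem := by
    intro a b x y hx hy
    induction hx using Submodule.span_induction with
    | zero => rw [zero_mul]; exact zero_mem _
    | add x x' _ _ h h' => rw [add_mul]; exact add_mem h h'
    | smul r x _ h => rw [smul_mul_assoc]; exact Submodule.smul_mem _ r h
    | mem x hx =>
      induction hy using Submodule.span_induction with
      | zero => rw [mul_zero]; exact zero_mem _
      | add y y' _ _ h h' => rw [mul_add]; exact add_mem h h'
      | smul r y _ h => rw [mul_smul_comm]; exact Submodule.smul_mem _ r h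
      | mem y hy =>
        obtain ⟨i, j, p, rfl, rfl⟩ := hx
        obtain ⟨i', j', q, rfl, rfl⟩ := hy
        by_cases h : j = i'
        · subst h
          exact Submodule.subset_span
            ⟨i, j', p.comp q, Quiver.Path.length_comp p q, (ofPath_comp k p q).symm⟩
        · rw [ofPath_mul_of_ne k p q h]
          exact zero_mem _

/-- The endomorphism of the path algebra that fixes the vertices and sends every arrow `a`
to `(-1)^n a`. -/
noncomputable def signHom (n : ℕ) : PathAlgebra k V →ₐ[k] PathAlgebra k V :=
  RingQuot.liftAlgHom k ⟨FreeAlgebra.lift k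
    (Sum.elim (fun i => vertex k i) (fun a => (-1 : k) ^ n • arrow k a.2.2)), by
      rintro _ _ (_ | ⟨_, _, h⟩ | _ | _ | _)
      · simp [vertex_mul_self]
      · simp [vertex_mul_of_ne k h]
      · simp [sum_vertex]
      · simp [vertex_mul_arrow]
      · simp [arrow_mul_vertex]⟩

variable {V}

theorem signHom_vertex (n : ℕ) (i : V) : signHom k V n (vertex k i) = vertex k i := by
  refine (RingQuot.liftAlgHom_mkAlgHom_apply _ _ _ _).trans ?_
  simp

theorem signHom_arrow (n : ℕ) {i j : V} (a : i ⟶ j) :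
    signHom k V n (arrow k a) = (-1 : k) ^ n • arrow k a := by
  refine (RingQuot.liftAlgHom_mkAlgHom_apply _ _ _ _).trans ?_
  simp

theorem signHom_ofPath (n : ℕ) {i j : V} (p : Quiver.Path i j) :
    signHom k V n (ofPath k p) = ((-1 : k) ^ n) ^ p.length • ofPath k p := by
  induction p with
  | nil => simp [ofPath, signHom_vertex]
  | cons p a ih =>
    simp [ofPath, ih, signHom_arrow, smul_smul, pow_succ, mul_comm]

theorem signHom_of_mem (n : ℕ) {d : ℕ} {x : PathAlgebra k V} (hx : x ∈ grading k V d) :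
    signHom k V n x = ((-1 : k) ^ n) ^ d • x := by
  induction hx using Submodule.span_induction with
  | zero => simp
  | add x y _ _ hx hy => rw [map_add, hx, hy, smul_add]
  | smul r x _ hx => rw [map_smul, hx, smul_comm]
  | mem x hx =>
    obtain ⟨i, j, p, rfl, rfl⟩ := hx
    exact signHom_ofPath k n p

variable (V) in
theorem signHom_signHom (n : ℕ) :
    (signHom k V n).comp (signHom k V n) = AlgHom.id k (PathAlgebra k V) := by
  apply RingQuot.ringQuot_ext'
  apply FreeAlgebra.hom_ext
  funext x
  rcases x with i | ⟨i, j, a⟩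
  · change signHom k V n (signHom k V n (vertex k i)) = vertex k i
    rw [signHom_vertex, signHom_vertex]
  · change signHom k V n (signHom k V n (arrow k a)) = arrow k a
    rw [signHom_arrow, map_smul, signHom_arrow, smul_smul, ← mul_pow]
    simp

end PathAlgebra

/-- A graded bound ideal of the path algebra: an ideal `I` that is homogeneous for the length of
paths and admissible, that is, its elements are combinations of paths of length at least two, and all
sufficiently long paths are in `I`. -/
structure IsBoundIdeal (I : Ideal (PathAlgebra k V)) : Prop where
  homogeneous : ∀ x ∈ I, x ∈ Submodule.span k {y | y ∈ I ∧ ∃ d, y ∈ PathAlgebra.grading k V d}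
  le : ∀ x ∈ I, x ∈ ⨆ d : ℕ, PathAlgebra.grading k V (d + 2)
  ge : ∃ N : ℕ, ∀ (i j : V) (p : Quiver.Path i j), N ≤ p.length → PathAlgebra.ofPath k p ∈ I

variable {k V} in
theorem IsBoundIdeal.le_comap_signHom {I : Ideal (PathAlgebra k V)} (hI : IsBoundIdeal k V I) (n : ℕ) :
    I ≤ I.comap (PathAlgebra.signHom k V n) := by
  intro x hx
  rw [Ideal.mem_comap]
  have hspan := hI.homogeneous x hx
  clear hx
  induction hspan using Submodule.span_induction with
  | zero => simp
  | add x y _ _ h h' => rw [map_add]; exact add_mem h h'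
  | smul r x _ h => rw [map_smul, Algebra.smul_def]; exact I.mul_mem_left _ h
  | mem x hx =>
    obtain ⟨hx, d, hd⟩ := hx
    rw [PathAlgebra.signHom_of_mem k n hd, Algebra.smul_def]
    exact I.mul_mem_left _ hx

end PathAlgebra

section BoundQuiverAlgebra

variable {k : Type u} [Field k] {V : Type v} [Fintype V] [Quiver.{w} V]
  (I : Ideal (PathAlgebra k V)) [I.IsTwoSided]

/-- The bound quiver algebra `A = kQ / I`. -/
abbrev BoundQuiverAlgebra : Type max u v w := PathAlgebra k V ⧸ I

namespace BoundQuiverAlgebra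

/-- The grading of `kQ / I` by the length of paths. -/
noncomputable def grading (d : ℕ) : Submodule k (BoundQuiverAlgebra I) :=
  (PathAlgebra.grading k V d).map (Ideal.Quotient.mkₐ k I).toLinearMap

instance : SetLike.GradedMonoid (grading I) where
  one_mem := ⟨1, SetLike.one_mem_graded (PathAlgebra.grading k V), map_one (Ideal.Quotient.mkₐ k I)⟩
  mul_mem := by
    rintro a b _ _ ⟨x, hx, rfl⟩ ⟨y, hy, rfl⟩
    exact ⟨x * y, SetLike.mul_mem_graded hx hy, map_mul (Ideal.Quotient.mkₐ k I) x y⟩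

/-- The image of a path in `kQ / I`. -/
noncomputable def ofPath {i j : V} (p : Quiver.Path i j) : BoundQuiverAlgebra I :=
  Ideal.Quotient.mkₐ k I (PathAlgebra.ofPath k p)

/-- A maximal bound path: a path with nonzero image in `kQ / I`, all of whose extensions by an
arrow at either end have image zero. -/
def IsMaximalBoundPath {i j : V} (p : Quiver.Path i j) : Prop :=
  ofPath I p ≠ 0 ∧ (∀ (l : V) (a : j ⟶ l), ofPath I (p.cons a) = 0) ∧
    ∀ (l : V) (a : l ⟶ i), ofPath I (a.toPath.comp p) = 0

/-- The algebra `kQ / I` is `n`-homogeneous if all maximal bound paths have length `n`. -/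
def IsHomogeneous (n : ℕ) : Prop :=
  ∀ (i j : V) (p : Quiver.Path i j), IsMaximalBoundPath I p → p.length = n

variable {I}

/-- The endomorphism of `kQ / I` that sends every arrow `a` to `(-1)^n a`. -/
noncomputable def signHom (hI : IsBoundIdeal k V I) (n : ℕ) :
    BoundQuiverAlgebra I →ₐ[k] BoundQuiverAlgebra I :=
  Ideal.quotientMapₐ I (PathAlgebra.signHom k V n) (hI.le_comap_signHom n)

theorem signHom_signHom (hI : IsBoundIdeal k V I) (n : ℕ) :
    (signHom hI n).comp (signHom hI n) = AlgHom.id k (BoundQuiverAlgebra I) := by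
  apply Ideal.Quotient.algHom_ext
  apply AlgHom.ext
  intro x
  exact congrArg (Ideal.Quotient.mkₐ k I)
    (AlgHom.congr_fun (PathAlgebra.signHom_signHom k V n) x)

/-- The graded automorphism `ν` of `kQ / I` that sends every arrow `a` to `(-1)^n a`. -/
noncomputable def signAut (hI : IsBoundIdeal k V I) (n : ℕ) :
    BoundQuiverAlgebra I ≃ₐ[k] BoundQuiverAlgebra I :=
  AlgEquiv.ofAlgHom (signHom hI n) (signHom hI n) (signHom_signHom hI n) (signHom_signHom hI n)

theorem signAut_mem (hI : IsBoundIdeal k V I) (n : ℕ) {d : ℕ} {x : BoundQuiverAlgebra I}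
    (hx : x ∈ grading I d) : signAut hI n x ∈ grading I d := by
  obtain ⟨y, hy, rfl⟩ := hx
  refine ⟨PathAlgebra.signHom k V n y, ?_, rfl⟩
  rw [PathAlgebra.signHom_of_mem k n hy]
  exact Submodule.smul_mem _ _ hy

end BoundQuiverAlgebra

end BoundQuiverAlgebra

/-! ### Twisted trivial extensions -/

section TwistedDual

variable {k : Type u} [Field k] {A : Type v} [Ring A] [Algebra k A] (ν : A ≃ₐ[k] A)

/-- The `A`-bimodule `(_νA)^∨`, the `k`-dual of the bimodule `_νA` with the structure
`a · b · c = ν(a)bc`: the bimodule structure of `(_νA)^∨` is `(a • f)(x) = f(xa)` and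
`(f • a)(x) = f(ν(a)x)`. -/
def TwistedDual (_ν : A ≃ₐ[k] A) : Type max u v := Module.Dual k A

namespace TwistedDual

instance : AddCommGroup (TwistedDual ν) := inferInstanceAs (AddCommGroup (Module.Dual k A))

instance : Module k (TwistedDual ν) := inferInstanceAs (Module k (Module.Dual k A))

/-- The underlying functional. -/
def toDual : TwistedDual ν ≃ₗ[k] Module.Dual k A := LinearEquiv.refl k _

variable {ν}

theorem ext {f g : TwistedDual ν} (h : ∀ x, toDual ν f x = toDual ν g x) : f = g :=
  (toDual ν).injective (LinearMap.ext h)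

instance : Module A (TwistedDual ν) where
  smul a f := (toDual ν).symm ((toDual ν f).comp (LinearMap.mulRight k a))
  one_smul f := ext fun x => congrArg (toDual ν f) (mul_one x)
  mul_smul a b f := ext fun x => congrArg (toDual ν f) (mul_assoc x a b).symm
  smul_zero _ := rfl
  smul_add _ _ _ := rfl
  add_smul a b f := ext fun x =>
    (congrArg (toDual ν f) (mul_add x a b)).trans (map_add (toDual ν f) _ _)
  zero_smul f := ext fun x =>
    (congrArg (toDual ν f) (mul_zero x)).trans (map_zero (toDual ν f))

instance : Module Aᵐᵒᵖ (TwistedDual ν) where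
  smul a f := (toDual ν).symm ((toDual ν f).comp (LinearMap.mulLeft k (ν a.unop)))
  one_smul f := ext fun x =>
    congrArg (toDual ν f) ((congrArg (· * x) (map_one ν)).trans (one_mul x))
  mul_smul a b f := ext fun x => congrArg (toDual ν f)
    ((congrArg (· * x) (map_mul ν b.unop a.unop)).trans (mul_assoc _ _ x))
  smul_zero _ := rfl
  smul_add _ _ _ := rfl
  add_smul a b f := ext fun x =>
    (congrArg (toDual ν f) ((congrArg (· * x) (map_add ν a.unop b.unop)).trans
      (add_mul _ _ x))).trans (map_add (toDual ν f) _ _)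
  zero_smul f := ext fun x =>
    (congrArg (toDual ν f) ((congrArg (· * x) (map_zero ν)).trans (zero_mul x))).trans
      (map_zero (toDual ν f))

theorem toDual_smul (a : A) (f : TwistedDual ν) (x : A) :
    toDual ν (a • f) x = toDual ν f (x * a) := rfl

theorem toDual_op_smul (a : A) (f : TwistedDual ν) (x : A) :
    toDual ν (MulOpposite.op a • f) x = toDual ν f (ν a * x) := rfl

instance : SMulCommClass A Aᵐᵒᵖ (TwistedDual ν) where
  smul_comm a b f := ext fun x => congrArg (toDual ν f) (mul_assoc (ν b.unop) x a).symm

instance : IsScalarTower k A (TwistedDual ν) where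
  smul_assoc r a f := ext fun x =>
    (congrArg (toDual ν f) (mul_smul_comm r x a)).trans (map_smul (toDual ν f) r _)

instance : IsScalarTower k Aᵐᵒᵖ (TwistedDual ν) where
  smul_assoc r a f := ext fun x =>
    (congrArg (toDual ν f) ((congrArg (· * x) (map_smul ν r a.unop)).trans
      (smul_mul_assoc r _ x))).trans (map_smul (toDual ν f) r _)

end TwistedDual

end TwistedDual

section TwistedTrivialExtension

variable {k : Type u} [Field k] {V : Type v} [Fintype V] [Quiver.{w} V]
  {I : Ideal (PathAlgebra k V)} [I.IsTwoSided]

/-- The twisted trivial extension `A ⋉ (_νA)^∨` of `A = kQ / I`, where `ν` is the automorphism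
of `A` with `ν(a) = (-1)^n a` for every arrow `a`. -/
abbrev TwistedTrivialExtension (hI : IsBoundIdeal k V I) (n : ℕ) : Type max u v w :=
  TrivSqZeroExt (BoundQuiverAlgebra I) (TwistedDual (BoundQuiverAlgebra.signAut hI n))

/-- The grading of `A ⋉ (_νA)^∨` with component of degree `d` equal to
`A_d ⊕ (A_{n+1-d})^∨`, where `(A_j)^∨` consists of the functionals on `A` that vanish on `A_i` for
all `i ≠ j`. -/
noncomputable def TwistedTrivialExtension.grading (hI : IsBoundIdeal k V I) (n : ℕ) (d : ℕ) :
    Submodule k (TwistedTrivialExtension hI n) where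
  carrier := {x | x.fst ∈ BoundQuiverAlgebra.grading I d ∧
    ∀ i, i + d ≠ n + 1 → ∀ a ∈ BoundQuiverAlgebra.grading I i, TwistedDual.toDual _ x.snd a = 0}
  zero_mem' := ⟨zero_mem _, fun _ _ _ _ => rfl⟩
  add_mem' {x y} hx hy := ⟨add_mem hx.1 hy.1, fun i hi a ha => by
    rw [TrivSqZeroExt.snd_add, map_add, LinearMap.add_apply, hx.2 i hi a ha, hy.2 i hi a ha,
      add_zero]⟩
  smul_mem' r x hx := ⟨Submodule.smul_mem _ r hx.1, fun i hi a ha => by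
    rw [TrivSqZeroExt.snd_smul, map_smul, LinearMap.smul_apply, hx.2 i hi a ha, smul_zero]⟩

instance (hI : IsBoundIdeal k V I) (n : ℕ) :
    SetLike.GradedMonoid (TwistedTrivialExtension.grading hI n) where
  one_mem := ⟨SetLike.one_mem_graded (BoundQuiverAlgebra.grading I), fun _ _ _ _ => rfl⟩
  mul_mem := by
    rintro a b x y ⟨hx, hx'⟩ ⟨hy, hy'⟩
    refine ⟨SetLike.mul_mem_graded hx hy, fun i hi c hc => ?_⟩
    rw [TrivSqZeroExt.snd_mul, map_add, LinearMap.add_apply, TwistedDual.toDual_smul,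
      TwistedDual.toDual_op_smul, hy' (i + a) (by omega) _ (SetLike.mul_mem_graded hc hx),
      hx' (b + i) (by omega) _
        (SetLike.mul_mem_graded (BoundQuiverAlgebra.signAut_mem hI n hy) hc), add_zero]

/-- The inclusion `A₀ → (A ⋉ (_νA)^∨)₀`. -/
noncomputable def TwistedTrivialExtension.inlZero (hI : IsBoundIdeal k V I) (n : ℕ)
    (c : BoundQuiverAlgebra.grading I 0) : TwistedTrivialExtension.grading hI n 0 :=
  ⟨TrivSqZeroExt.inl (c : BoundQuiverAlgebra I), c.2, fun _ _ _ _ => rfl⟩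

end TwistedTrivialExtension

/-!
Put `B = A^!`. The theorem compares presentations by generators and relations of the two algebras,
and the work is in computing the bimodule `Ext^n_{B^e}(B, B^e)`.

The Koszul bimodule complex of `B` has the terms `B ⊗_K (A_i)^∨ ⊗_K B`. They are realized here as
the modules `koszulTerm 𝒜 i` of maps `A → B ⊗ Bᵐᵒᵖ` that are supported in degree `i` and compatible
with the two actions of `K`; if `a_s` and `a_s^*` are dual bases of `A₁` and `A₁^∨`, the
differential is `(dφ)(x) = ∑ φ(x a_s) (a_s^* ⊗ 1) ± ∑ φ(a_s x) (1 ⊗ a_s^*)`. When `A` is Koszul,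
this complex is a projective resolution of `B`. To see this, let `X_j` be the generators of the
`j`-th term of a linear resolution of `K` over `A`. The functionals `a_s^*` act on the `X_j` by
contraction of the differential, this action satisfies the relations of `B`, and the resulting
pairing identifies the part of left degree `j` of `B ⊗ Bᵐᵒᵖ` with `Hom(X_j, Bᵐᵒᵖ)`
(`LinearResolution.envPair_bijective`). Under this identification, the left half of the Koszul
differential is dual to the maps `A_i ⊗ X_{j+1} → A_{i+1} ⊗ X_j` of the resolution, hence exact; a filtration by the left degree carries the exactness over to the full differential
(`LinearResolution.exists_reduction`, `LinearResolution.exact_koszulD`,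
`LinearResolution.exact_koszulε`).

As `A` is `n`-homogeneous, `A_{n+1} = 0` (`BoundQuiverAlgebra.IsHomogeneous.grading_succ`), so that
the resolution stops in degree `n` and `Ext^n_{B^e}(B, B^e)` is the cokernel of the last map of the
dual complex. This is a presentation of that bimodule: its generators are `η(x)` for `x ∈ A_n`, and
its relations are `∑ η(x a_s) a_s^* + (-1)^n ∑ a_s^* η(a_s x) = 0` for `x ∈ A_{n-1}`
(`IsExtPresentation`, `exists_isExtPresentation`).

On the other side, the component of degree one of `A ⋉ (_νA)^∨` is `A₁ ⊕ (A_n)^∨`, so that its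
quadratic dual is generated by `A₁^∨` and `A_n`. A functional on the component of degree two,
`A₂ ⊕ (A_{n-1})^∨`, is a functional on `A₂` together with an element `x ∈ A_{n-1}`. The functionals
on `A₂` give the relations of `B`, and the elements `x` give the relations of the presentation
above, in which the sign `(-1)^n` now comes from the automorphism `ν`
(`IsTrivialExtensionGrading.sum_dualFamily`). The universal properties of the tensor algebra, of the
presentation and of the quadratic dual therefore yield homomorphisms in both directions, which are
inverse to each other (`IsExtPresentation.exists_preprojective_algEquiv`).
-/

/-! ### Quadratic duals through dual families -/

namespace TensorRing

variable {k : Type*} [Field k] {B : Type*} [Ring B] [Algebra k B]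
  {M : Type*} [AddCommGroup M] [Module B M] [Module Bᵐᵒᵖ M]
  {C : Type*} [Ring C] [Algebra k C]

theorem lift_coeff (f : B →ₐ[k] C) (g : M →+ C)
    (hl : ∀ (b : B) (x : M), g (b • x) = f b * g x)
    (hr : ∀ (b : B) (x : M), g (MulOpposite.op b • x) = g x * f b) (b : B) :
    lift f g hl hr (coeff k B M b) = f b := by
  refine (RingQuot.liftAlgHom_mkAlgHom_apply _ _ _ _).trans ?_
  simp

theorem lift_ι (f : B →ₐ[k] C) (g : M →+ C)
    (hl : ∀ (b : B) (x : M), g (b • x) = f b * g x)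
    (hr : ∀ (b : B) (x : M), g (MulOpposite.op b • x) = g x * f b) (x : M) :
    lift f g hl hr (ι k B M x) = g x := by
  refine (RingQuot.liftAlgHom_mkAlgHom_apply _ _ _ _).trans ?_
  simp

theorem hom_ext {f g : TensorRing k B M →ₐ[k] C}
    (h : ∀ b, f (coeff k B M b) = g (coeff k B M b)) (h' : ∀ x, f (ι k B M x) = g (ι k B M x)) :
    f = g := by
  apply RingQuot.ringQuot_ext'
  apply FreeAlgebra.hom_ext
  funext x
  rcases x with b | x
  · exact h b
  · exact h' x

end TensorRing

namespace QuadraticDual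

variable {k : Type u} [Field k] {A : Type v} [Ring A] [Algebra k A]
  {𝒜 : ℕ → Submodule k A} [SetLike.GradedMonoid 𝒜]

/-- The canonical map from the dual of the degree one component to the quadratic dual. -/
noncomputable def gen : DegreeOneDual 𝒜 →ₗ[k] QuadraticDual 𝒜 :=
  (QuadraticAlgebraOf.mk k (𝒜 0) (DegreeOneDual 𝒜) (dualRelations 𝒜)).toLinearMap.comp
    (TensorRing.ιₗ k (𝒜 0) (DegreeOneDual 𝒜))

theorem gen_smul (c : 𝒜 0) (g : DegreeOneDual 𝒜) : gen (c • g) = coeff 𝒜 c * gen g := by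
  change QuadraticAlgebraOf.mk k _ _ _ (TensorRing.ι k _ _ _) = _
  rw [TensorRing.ι_smul, map_mul]
  rfl

theorem gen_op_smul (c : 𝒜 0) (g : DegreeOneDual 𝒜) :
    gen (MulOpposite.op c • g) = gen g * coeff 𝒜 c := by
  change QuadraticAlgebraOf.mk k _ _ _ (TensorRing.ι k _ _ _) = _
  rw [TensorRing.ι_op_smul, map_mul]
  rfl

theorem mk_ι₂_tmul (f g : DegreeOneDual 𝒜) :
    QuadraticAlgebraOf.mk k (𝒜 0) (DegreeOneDual 𝒜) (dualRelations 𝒜)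
        (TensorRing.ι₂ k (𝒜 0) (DegreeOneDual 𝒜) (f ⊗ₜ g)) =
      gen f * gen g := by
  exact map_mul (QuadraticAlgebraOf.mk k (𝒜 0) (DegreeOneDual 𝒜) (dualRelations 𝒜)) _ _

theorem mk_ι₂_eq_zero {z : DegreeOneDual 𝒜 ⊗[k] DegreeOneDual 𝒜} (hz : z ∈ dualRelations 𝒜) :
    QuadraticAlgebraOf.mk k (𝒜 0) (DegreeOneDual 𝒜) (dualRelations 𝒜)
      (TensorRing.ι₂ k (𝒜 0) (DegreeOneDual 𝒜) z) = 0 := by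
  exact (RingQuot.mkAlgHom_rel k ⟨z, hz, rfl, rfl⟩).trans (map_zero _)

theorem hom_ext {C : Type*} [Ring C] [Algebra k C] {f g : QuadraticDual 𝒜 →ₐ[k] C}
    (h : ∀ c, f (coeff 𝒜 c) = g (coeff 𝒜 c)) (h' : ∀ x, f (gen x) = g (gen x)) : f = g := by
  apply RingQuot.ringQuot_ext'
  exact TensorRing.hom_ext h h'

end QuadraticDual

/-- A finite family in the degree one component of a graded algebra together with a family of
functionals that realizes the identity as `∑ s, covec s ⊗ vec s`, for instance a basis and its dual
basis. -/
structure DualFamily {k : Type u} [Field k] {A : Type v} [Ring A] [Algebra k A]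
    (𝒜 : ℕ → Submodule k A) (ι : Type*) [Fintype ι] where
  /-- The vectors. -/
  vec : ι → DegreeOne 𝒜
  /-- The functionals. -/
  covec : ι → DegreeOneDual 𝒜
  complete : ∀ x, ∑ s, DegreeOneDual.toDual 𝒜 (covec s) x • vec s = x

namespace DualFamily

variable {k : Type u} [Field k] {A : Type v} [Ring A] [Algebra k A]
  {𝒜 : ℕ → Submodule k A} {ι : Type*} [Fintype ι] (D : DualFamily 𝒜 ι)

/-- The dual family of a finite basis. -/
noncomputable def ofBasis (b : Module.Basis ι k (DegreeOne 𝒜)) : DualFamily 𝒜 ι where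
  vec := b
  covec s := (DegreeOneDual.toDual 𝒜).symm (b.coord s)
  complete x := by
    simp only [LinearEquiv.apply_symm_apply, Module.Basis.coord_apply]
    exact b.sum_repr x

/-- The element of the algebra underlying a vector of the family. -/
def elt (s : ι) : A := DegreeOne.val 𝒜 (D.vec s)

theorem elt_mem (s : ι) : D.elt s ∈ 𝒜 1 := (D.vec s).2

theorem sum_covec (g : DegreeOneDual 𝒜) :
    ∑ s, DegreeOneDual.toDual 𝒜 g (D.vec s) • D.covec s = g := by
  apply DegreeOneDual.ext
  intro x
  conv_rhs => rw [← D.complete x]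
  simp only [map_sum, map_smul, LinearMap.sum_apply, LinearMap.smul_apply, smul_eq_mul]
  exact Finset.sum_congr rfl fun s _ => mul_comm _ _

/-- An endomorphism `T` moves from one leg of the canonical element to the other. -/
theorem transpose {C : Type*} [AddCommGroup C] [Module k C]
    (β : DegreeOne 𝒜 →ₗ[k] DegreeOneDual 𝒜 →ₗ[k] C) (T : DegreeOne 𝒜 →ₗ[k] DegreeOne 𝒜)
    (T' : DegreeOneDual 𝒜 → DegreeOneDual 𝒜)
    (h : ∀ g x, DegreeOneDual.toDual 𝒜 (T' g) x = DegreeOneDual.toDual 𝒜 g (T x)) :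
    ∑ s, β (T (D.vec s)) (D.covec s) = ∑ s, β (D.vec s) (T' (D.covec s)) := by
  have h1 : ∀ s, β (T (D.vec s)) (D.covec s) =
      ∑ r, DegreeOneDual.toDual 𝒜 (T' (D.covec r)) (D.vec s) • β (D.vec r) (D.covec s) := by
    intro s
    conv_lhs => rw [← D.complete (T (D.vec s))]
    simp only [map_sum, map_smul, LinearMap.sum_apply, LinearMap.smul_apply, h]
  have h2 : ∀ r, β (D.vec r) (T' (D.covec r)) =
      ∑ s, DegreeOneDual.toDual 𝒜 (T' (D.covec r)) (D.vec s) • β (D.vec r) (D.covec s) := by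
    intro r
    conv_lhs => rw [← D.sum_covec (T' (D.covec r))]
    simp only [map_sum, map_smul]
  simp only [h1, h2]
  exact Finset.sum_comm

theorem degreeOneMul_tmul (x y : DegreeOne 𝒜) :
    degreeOneMul 𝒜 (x ⊗ₜ y) = DegreeOne.val 𝒜 x * DegreeOne.val 𝒜 y := rfl

theorem pairing_tmul (f g : DegreeOneDual 𝒜) (x y : DegreeOne 𝒜) :
    DegreeOneDual.pairing 𝒜 (f ⊗ₜ g) (x ⊗ₜ y) =
      DegreeOneDual.toDual 𝒜 f x * DegreeOneDual.toDual 𝒜 g y := rfl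

/-- The relation of the quadratic dual that is the transpose of the multiplication
`A₁ ⊗ A₁ → A` applied to a functional. -/
theorem mem_dualRelations (F : A →ₗ[k] k) :
    ∑ s, ∑ t, F (D.elt s * D.elt t) • (D.covec t ⊗ₜ[k] D.covec s) ∈ dualRelations 𝒜 := by
  intro y hy
  have key : ∀ y, DegreeOneDual.pairing 𝒜
      (∑ s, ∑ t, F (D.elt s * D.elt t) • (D.covec t ⊗ₜ[k] D.covec s))
      (TensorProduct.comm k _ _ y) = F (degreeOneMul 𝒜 y) := by
    intro y
    induction y with
    | zero => simp
    | add x y hx hy => rw [map_add, map_add, hx, hy, map_add, map_add]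
    | tmul x y =>
      simp only [map_sum, map_smul, LinearMap.sum_apply, LinearMap.smul_apply,
        TensorProduct.comm_tmul, pairing_tmul]
      rw [degreeOneMul_tmul]
      conv_rhs => rw [← D.complete x, ← D.complete y]
      simp only [map_sum, map_smul, Finset.sum_mul_sum, smul_mul_smul_comm]
      simp only [elt, smul_eq_mul]
      refine Finset.sum_congr rfl fun s _ => Finset.sum_congr rfl fun t _ => ?_
      ring
  rw [key, LinearMap.mem_ker.mp hy, map_zero]

/-- Conversely, every relation of the quadratic dual is the transpose of the multiplication applied
to a functional: a functional on `A₁ ⊗ A₁` that vanishes on the kernel of the multiplication factors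
through it. -/
theorem exists_eq_of_mem_dualRelations {z : DegreeOneDual 𝒜 ⊗[k] DegreeOneDual 𝒜}
    (hz : z ∈ dualRelations 𝒜) :
    ∃ F : A →ₗ[k] k, z = ∑ s, ∑ t, F (D.elt s * D.elt t) • (D.covec t ⊗ₜ[k] D.covec s) := by
  have hexp : ∀ z : DegreeOneDual 𝒜 ⊗[k] DegreeOneDual 𝒜,
      z = ∑ s, ∑ t, DegreeOneDual.pairing 𝒜 z (D.vec t ⊗ₜ D.vec s) •
        (D.covec t ⊗ₜ[k] D.covec s) := by
    intro z
    induction z with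
    | zero => simp
    | add x y hx hy =>
      conv_lhs => rw [hx, hy]
      simp only [map_add, LinearMap.add_apply, add_smul, Finset.sum_add_distrib]
    | tmul f g =>
      conv_lhs => rw [← D.sum_covec f, ← D.sum_covec g]
      simp only [TensorProduct.sum_tmul, TensorProduct.tmul_sum, TensorProduct.smul_tmul_smul,
        pairing_tmul]
  obtain ⟨F, hF⟩ : ∃ F : A →ₗ[k] k, F.comp (degreeOneMul 𝒜) =
      (DegreeOneDual.pairing 𝒜 z).comp (TensorProduct.comm k _ _).toLinearMap := by
    have := LinearMap.range_dualMap_eq_dualAnnihilator_ker (degreeOneMul 𝒜)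
    have hmem : (DegreeOneDual.pairing 𝒜 z).comp (TensorProduct.comm k _ _).toLinearMap ∈
        LinearMap.range (degreeOneMul 𝒜).dualMap := by
      rw [this, Submodule.mem_dualAnnihilator]
      exact hz
    exact hmem
  refine ⟨F, ?_⟩
  conv_lhs => rw [hexp z]
  refine Finset.sum_congr rfl fun s _ => Finset.sum_congr rfl fun t _ => ?_
  have := LinearMap.congr_fun hF (D.vec s ⊗ₜ D.vec t)
  exact congrArg (· • _) this.symm

end DualFamily

namespace QuadraticDual

variable {k : Type u} [Field k] {A : Type v} [Ring A] [Algebra k A]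
  {𝒜 : ℕ → Submodule k A} [SetLike.GradedMonoid 𝒜] {ι : Type*} [Fintype ι]
  (D : DualFamily 𝒜 ι)

/-- The defining relations of the quadratic dual: they are indexed by the functionals on the
component of degree two, here extended to `A`. -/
theorem relation (F : A →ₗ[k] k) :
    ∑ s, ∑ t, F (D.elt s * D.elt t) • (gen (D.covec t) * gen (D.covec s)) = 0 := by
  have := mk_ι₂_eq_zero (D.mem_dualRelations F)
  simpa only [map_sum, map_smul, mk_ι₂_tmul] using this

/-- The relation of the quadratic dual with coefficients: for every linear map `G` from the
algebra, the element `∑ G(a_s a_t) ⊗ a_t^* a_s^*` vanishes under every bilinear map. -/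
theorem relation_apply [Module.Finite k A] {M N : Type*} [AddCommGroup M] [Module k M]
    [AddCommGroup N] [Module k N] (G : A →ₗ[k] M) (β : M →ₗ[k] QuadraticDual 𝒜 →ₗ[k] N) :
    ∑ s, ∑ t, β (G (D.elt s * D.elt t)) (gen (D.covec t) * gen (D.covec s)) = 0 := by
  let b := Module.finBasis k A
  have h : ∀ s t, β (G (D.elt s * D.elt t)) (gen (D.covec t) * gen (D.covec s)) =
      ∑ r, β (G (b r)) (b.coord r (D.elt s * D.elt t) •
        (gen (D.covec t) * gen (D.covec s))) := by
    intro s t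
    conv_lhs => rw [← b.sum_repr (D.elt s * D.elt t)]
    simp only [map_sum, map_smul, LinearMap.sum_apply, LinearMap.smul_apply]
    rfl
  simp only [h]
  rw [Finset.sum_congr rfl fun s _ => Finset.sum_comm, Finset.sum_comm]
  refine Finset.sum_eq_zero fun r _ => ?_
  simp only [← map_sum]
  rw [relation D, map_zero]

/-- The universal property of the quadratic dual, with the relations expressed through a dual
family of the degree one component. -/
noncomputable def lift {C : Type*} [Ring C] [Algebra k C] (f : 𝒜 0 →ₐ[k] C)
    (g : DegreeOneDual 𝒜 →ₗ[k] C) (hl : ∀ c x, g (c • x) = f c * g x)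
    (hr : ∀ c x, g (MulOpposite.op c • x) = g x * f c)
    (hrel : ∀ F : A →ₗ[k] k,
      ∑ s, ∑ t, F (D.elt s * D.elt t) • (g (D.covec t) * g (D.covec s)) = 0) :
    QuadraticDual 𝒜 →ₐ[k] C :=
  QuadraticAlgebraOf.lift (TensorRing.lift f g.toAddMonoidHom hl hr) fun z hz => by
    obtain ⟨F, rfl⟩ := D.exists_eq_of_mem_dualRelations hz
    have key : ∀ x y, TensorRing.lift f g.toAddMonoidHom hl hr
        (TensorRing.ι₂ k _ _ (x ⊗ₜ y)) = g x * g y := by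
      intro x y
      exact (map_mul _ (TensorRing.ι k (𝒜 0) (DegreeOneDual 𝒜) x)
        (TensorRing.ι k (𝒜 0) (DegreeOneDual 𝒜) y)).trans
          (congrArg₂ _ (TensorRing.lift_ι ..) (TensorRing.lift_ι ..))
    simpa only [map_sum, map_smul, key] using hrel F

section lift

variable {C : Type*} [Ring C] [Algebra k C] (f : 𝒜 0 →ₐ[k] C)
    (g : DegreeOneDual 𝒜 →ₗ[k] C) (hl : ∀ c x, g (c • x) = f c * g x)
    (hr : ∀ c x, g (MulOpposite.op c • x) = g x * f c)
    (hrel : ∀ F : A →ₗ[k] k,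
      ∑ s, ∑ t, F (D.elt s * D.elt t) • (g (D.covec t) * g (D.covec s)) = 0)

theorem lift_coeff (c : 𝒜 0) : lift D f g hl hr hrel (coeff 𝒜 c) = f c :=
  (RingQuot.liftAlgHom_mkAlgHom_apply _ _ _ _).trans (TensorRing.lift_coeff ..)

theorem lift_gen (x : DegreeOneDual 𝒜) : lift D f g hl hr hrel (gen x) = g x :=
  (RingQuot.liftAlgHom_mkAlgHom_apply _ _ _ _).trans (TensorRing.lift_ι ..)

end lift

theorem induction {p : QuadraticDual 𝒜 → Prop} (hc : ∀ c, p (coeff 𝒜 c))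
    (hg : ∀ g, p (gen g)) (hadd : ∀ x y, p x → p y → p (x + y))
    (hmul : ∀ x y, p x → p y → p (x * y)) (x) : p x := by
  obtain ⟨y, rfl⟩ : ∃ y, QuadraticAlgebraOf.mk k _ _ _ y = x :=
    RingQuot.mkAlgHom_surjective k _ x
  obtain ⟨z, rfl⟩ : ∃ z, TensorRing.mk k (𝒜 0) (DegreeOneDual 𝒜) z = y :=
    RingQuot.mkAlgHom_surjective k _ y
  induction z using FreeAlgebra.induction with
  | grade0 r => simpa using hc (algebraMap k (𝒜 0) r)
  | grade1 z =>
    rcases z with c | g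
    · exact hc c
    · exact hg g
  | mul a b ha hb => simpa using hmul _ _ ha hb
  | add a b ha hb => simpa using hadd _ _ ha hb

/-- The quadratic dual is spanned by the elements obtained from the coefficients by
right multiplications with generators. -/
theorem induction_right {p : QuadraticDual 𝒜 → Prop} (hc : ∀ c, p (coeff 𝒜 c))
    (hadd : ∀ x y, p x → p y → p (x + y)) (hmul : ∀ x g, p x → p (x * gen g)) (x) : p x := by
  -- `q` is the smallest predicate with the three closure properties.
  let q : QuadraticDual 𝒜 → Prop := fun x => ∀ p : QuadraticDual 𝒜 → Prop,
    (∀ c, p (coeff 𝒜 c)) → (∀ x y, p x → p y → p (x + y)) → (∀ x g, p x → p (x * gen g)) → p x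
  have qadd : ∀ x y, q x → q y → q (x + y) := fun x y hx hy p h1 h2 h3 =>
    h2 _ _ (hx p h1 h2 h3) (hy p h1 h2 h3)
  have qmul : ∀ x g, q x → q (x * gen g) := fun x g hx p h1 h2 h3 => h3 _ _ (hx p h1 h2 h3)
  have qcoeff : ∀ c, q (coeff 𝒜 c) := fun c p h1 h2 h3 => h1 c
  have qc : ∀ x c, q x → q (x * coeff 𝒜 c) := by
    intro x c hx
    refine (hx (fun x => q x ∧ q (x * coeff 𝒜 c)) (fun c' => ⟨qcoeff c', ?_⟩)
      (fun x y hx hy => ⟨qadd _ _ hx.1 hy.1, ?_⟩) (fun x g hx => ⟨qmul _ _ hx.1, ?_⟩)).2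
    · rw [← map_mul]; exact qcoeff _
    · rw [add_mul]; exact qadd _ _ hx.2 hy.2
    · rw [mul_assoc, ← gen_op_smul]; exact qmul _ _ hx.1
  have main : ∀ b x, q x → q (x * b) := fun b => by
    induction b using induction with
    | hc c => exact fun x hx => qc x c hx
    | hg g => exact fun x hx => qmul x g hx
    | hadd a b ha hb => exact fun x hx => by rw [mul_add]; exact qadd _ _ (ha x hx) (hb x hx)
    | hmul a b ha hb => exact fun x hx => by rw [← mul_assoc]; exact hb _ (ha x hx)
  have h1 := main x 1 (by rw [← map_one (coeff 𝒜)]; exact qcoeff 1)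
  rw [one_mul] at h1
  exact h1 p hc hadd hmul

end QuadraticDual

/-! ### Homogeneous components -/

section Homogeneous

variable {k : Type*} [Field k] {M : Type*} [AddCommGroup M] [Module k M]
  (ℳ : ℕ → Submodule k M) [DirectSum.Decomposition ℳ]

/-- The homogeneous component of degree `i`. -/
noncomputable def homPart (i : ℕ) : M →ₗ[k] M :=
  (ℳ i).subtype ∘ₗ DirectSum.component k ℕ (fun i => ℳ i) i ∘ₗ
    (DirectSum.decomposeLinearEquiv ℳ).toLinearMap

theorem homPart_mem (i : ℕ) (x : M) : homPart ℳ i x ∈ ℳ i := (DirectSum.decompose ℳ x i).2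

variable {ℳ}

theorem homPart_same {i : ℕ} {x : M} (hx : x ∈ ℳ i) : homPart ℳ i x = x :=
  DirectSum.decompose_of_mem_same ℳ hx

theorem homPart_ne {i j : ℕ} {x : M} (hx : x ∈ ℳ i) (h : i ≠ j) : homPart ℳ j x = 0 :=
  DirectSum.decompose_of_mem_ne ℳ hx h

variable (ℳ) in
theorem homogeneous_induction {p : M → Prop} (hadd : ∀ x y, p x → p y → p (x + y))
    (h : ∀ i, ∀ x ∈ ℳ i, p x) (x : M) : p x :=
  DirectSum.Decomposition.inductionOn ℳ (h 0 0 (zero_mem _)) (fun {i} m => h i m m.2) hadd x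

end Homogeneous

section SplitGrading

/-- A grading of a `k`-algebra whose degree zero component is a product of copies of `k`, given by
a complete family of orthogonal idempotents. The functional takes the sum of the coefficients of the
component of degree zero. -/
structure SplitGrading {k : Type u} [Field k] {A : Type v} [Ring A] [Algebra k A]
    (𝒜 : ℕ → Submodule k A) [SetLike.GradedMonoid 𝒜] (V : Type*) [Fintype V] where
  /-- The orthogonal idempotents. -/
  idem : V → 𝒜 0
  idem_mul_self : ∀ v, idem v * idem v = idem v
  idem_mul_ne : ∀ u v, u ≠ v → idem u * idem v = 0
  sum_idem : ∑ v, idem v = 1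
  exists_coeff : ∀ c : 𝒜 0, ∃ r : V → k, (c : A) = ∑ v, r v • (idem v : A)
  /-- The sum of the coefficients of the component of degree zero. -/
  aug : A →ₗ[k] k
  aug_idem : ∀ v, aug (idem v) = 1
  aug_pos : ∀ i, 0 < i → ∀ a ∈ 𝒜 i, aug a = 0

variable {k : Type u} [Field k] {A : Type v} [Ring A] [Algebra k A]
  {𝒜 : ℕ → Submodule k A} [SetLike.GradedMonoid 𝒜] {V : Type*} [Fintype V]
  (S : SplitGrading 𝒜 V)

namespace SplitGrading

theorem coe_idem_mul_self (v : V) : (S.idem v : A) * S.idem v = S.idem v :=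
  congrArg Subtype.val (S.idem_mul_self v)

theorem coe_idem_mul_ne {u v : V} (h : u ≠ v) : (S.idem u : A) * S.idem v = 0 :=
  congrArg Subtype.val (S.idem_mul_ne u v h)

theorem coe_sum_idem : ∑ v, (S.idem v : A) = 1 := by
  rw [← AddSubmonoidClass.coe_finsetSum, S.sum_idem]
  rfl

theorem exists_mul_idem (c : 𝒜 0) (v : V) :
    ∃ r : k, (c : A) * S.idem v = r • (S.idem v : A) ∧ S.idem v * (c : A) = r • (S.idem v : A) := by
  obtain ⟨r, hr⟩ := S.exists_coeff c
  rw [hr]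
  refine ⟨r v, ?_, ?_⟩
  · rw [Finset.sum_mul, Finset.sum_eq_single v, smul_mul_assoc, S.coe_idem_mul_self]
    · intro u _ h
      rw [smul_mul_assoc, S.coe_idem_mul_ne h, smul_zero]
    · simp
  · rw [Finset.mul_sum, Finset.sum_eq_single v, mul_smul_comm, S.coe_idem_mul_self]
    · intro u _ h
      rw [mul_smul_comm, S.coe_idem_mul_ne h.symm, smul_zero]
    · simp

end SplitGrading

end SplitGrading

section HomogeneousMul

variable {k : Type u} [Field k] {A : Type v} [Ring A] [Algebra k A]
  (𝒜 : ℕ → Submodule k A) [SetLike.GradedMonoid 𝒜] [DirectSum.Decomposition 𝒜]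

theorem homPart_mul_right {l : ℕ} {a : A} (ha : a ∈ 𝒜 l) (i : ℕ) (x : A) :
    homPart 𝒜 (i + l) (x * a) = homPart 𝒜 i x * a := by
  induction x using homogeneous_induction 𝒜 with
  | hadd x y hx hy => rw [add_mul, map_add, hx, hy, map_add, add_mul]
  | h j x hx =>
    by_cases h : j = i
    · subst h
      rw [homPart_same hx, homPart_same (SetLike.mul_mem_graded hx ha)]
    · rw [homPart_ne hx h, homPart_ne (SetLike.mul_mem_graded hx ha) (by omega), zero_mul]

theorem homPart_mul_right_of_lt {i l : ℕ} (h : i < l) {a : A} (ha : a ∈ 𝒜 l) (x : A) :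
    homPart 𝒜 i (x * a) = 0 := by
  induction x using homogeneous_induction 𝒜 with
  | hadd x y hx hy => rw [add_mul, map_add, hx, hy, add_zero]
  | h j x hx => exact homPart_ne (SetLike.mul_mem_graded hx ha) (by omega)

theorem homPart_mul_left {l : ℕ} {a : A} (ha : a ∈ 𝒜 l) (i : ℕ) (x : A) :
    homPart 𝒜 (i + l) (a * x) = a * homPart 𝒜 i x := by
  induction x using homogeneous_induction 𝒜 with
  | hadd x y hx hy => rw [mul_add, map_add, hx, hy, map_add, mul_add]
  | h j x hx =>
    by_cases h : j = i
    · subst h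
      rw [homPart_same hx, homPart_same (by rw [add_comm]; exact SetLike.mul_mem_graded ha hx)]
    · rw [homPart_ne hx h, homPart_ne (SetLike.mul_mem_graded ha hx) (by omega), mul_zero]

/-- The component of degree one, as an element of the bimodule of elements of degree one. -/
noncomputable def degreeOnePart : A →ₗ[k] DegreeOne 𝒜 :=
  DirectSum.component k ℕ (fun i => 𝒜 i) 1 ∘ₗ (DirectSum.decomposeLinearEquiv 𝒜).toLinearMap

omit [SetLike.GradedMonoid 𝒜] in
theorem val_degreeOnePart (x : A) : DegreeOne.val 𝒜 (degreeOnePart 𝒜 x) = homPart 𝒜 1 x := rfl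

theorem degreeOnePart_mul (x : A) (c : 𝒜 0) :
    degreeOnePart 𝒜 (x * c) = MulOpposite.op c • degreeOnePart 𝒜 x := by
  apply DegreeOne.val_injective
  rw [DegreeOne.val_op_smul, val_degreeOnePart, val_degreeOnePart]
  exact homPart_mul_right 𝒜 c.2 1 x

theorem degreeOnePart_coe_mul (x : A) (c : 𝒜 0) :
    degreeOnePart 𝒜 (c * x) = c • degreeOnePart 𝒜 x := by
  apply DegreeOne.val_injective
  rw [DegreeOne.val_smul, val_degreeOnePart, val_degreeOnePart]
  exact homPart_mul_left 𝒜 c.2 1 x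

end HomogeneousMul

/-! ### Linear resolutions -/

/-- A linear graded projective resolution of the degree zero component of a graded algebra, in
`k`-linear form. -/
structure LinearResolution {k : Type u} [Field k] {A : Type v} [Ring A] [Algebra k A]
    (𝒜 : ℕ → Submodule k A) [SetLike.GradedMonoid 𝒜] where
  /-- The terms of the resolution. -/
  P : ℕ → Type v
  [addCommGroup : ∀ i, AddCommGroup (P i)]
  [moduleA : ∀ i, Module A (P i)]
  [modulek : ∀ i, Module k (P i)]
  [isScalarTower : ∀ i, IsScalarTower k A (P i)]
  /-- The gradings of the terms. -/
  ℳ : ∀ i, ℕ → Submodule k (P i)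
  [decomposition : ∀ i, DirectSum.Decomposition (ℳ i)]
  /-- The differential. -/
  d : ∀ i, P (i + 1) →ₗ[A] P i
  /-- The augmentation. -/
  ε : P 0 →ₗ[A] A ⧸ positiveIdeal 𝒜
  projective : ∀ i, Module.Projective A (P i)
  smul_mem : ∀ i j l, ∀ a ∈ 𝒜 j, ∀ x ∈ ℳ i l, a • x ∈ ℳ i (j + l)
  span_eq_top : ∀ i, Submodule.span A (ℳ i i : Set (P i)) = ⊤
  d_mem : ∀ i j, ∀ x ∈ ℳ (i + 1) j, d i x ∈ ℳ i j
  ε_pos : ∀ j, 0 < j → ∀ x ∈ ℳ 0 j, ε x = 0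
  ε_surjective : Function.Surjective ε
  exact_ε : Function.Exact (d 0) ε
  exact_d : ∀ i, Function.Exact (d (i + 1)) (d i)

attribute [instance] LinearResolution.addCommGroup LinearResolution.moduleA
  LinearResolution.modulek LinearResolution.isScalarTower LinearResolution.decomposition
  LinearResolution.projective

theorem IsKoszulAlgebra.nonempty_linearResolution {k : Type u} [Field k] {A : Type v} [Ring A]
    [Algebra k A] {𝒜 : ℕ → Submodule k A} [SetLike.GradedMonoid 𝒜] (h : IsKoszulAlgebra 𝒜) :
    Nonempty (LinearResolution 𝒜) := by
  obtain ⟨-, P, ℳ, d, ε, hP, hint, hsm, hspan, hd, hε, hsurj, hex, hexd⟩ := h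
  let _ : ∀ i, Module k (P i) := fun i => Module.compHom (P i) (algebraMap k A)
  have tower : ∀ i, IsScalarTower k A (P i) := fun i =>
    ⟨fun r a x => by
      rw [Algebra.smul_def, mul_smul]
      rfl⟩
  let ℳ' : ∀ i, ℕ → Submodule k (P i) := fun i j =>
    { ℳ i j with
      smul_mem' := fun r x hx => by
        have := hsm i 0 j (algebraMap k A r) (SetLike.algebraMap_mem_graded 𝒜 r) x hx
        rw [zero_add] at this
        exact this }
  have hint' : ∀ i, DirectSum.IsInternal (ℳ' i) := fun i => hint i
  let _ : ∀ i, DirectSum.Decomposition (ℳ' i) := fun i => (hint' i).chooseDecomposition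
  exact ⟨{ P := fun i => P i, ℳ := ℳ', d := d, ε := ε, projective := hP, smul_mem := hsm
           span_eq_top := hspan, d_mem := hd, ε_pos := hε, ε_surjective := hsurj
           exact_ε := hex, exact_d := hexd }⟩

theorem LinearMap.exists_comp_eq_of_ker_le {k M N W : Type*} [Field k] [AddCommGroup M] [Module k M]
    [AddCommGroup N] [Module k N] [AddCommGroup W] [Module k W] (f : M →ₗ[k] N) (F : M →ₗ[k] W)
    (h : ∀ x, f x = 0 → F x = 0) : ∃ G : N →ₗ[k] W, ∀ x, G (f x) = F x := by
  obtain ⟨G, hG⟩ := LinearMap.exists_extend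
    (((LinearMap.ker f).liftQ F h).comp f.quotKerEquivRange.symm.toLinearMap)
  refine ⟨G, fun x => ?_⟩
  have h1 := LinearMap.congr_fun hG ⟨f x, x, rfl⟩
  have h2 : f.quotKerEquivRange.symm ⟨f x, x, rfl⟩ = (LinearMap.ker f).mkQ x :=
    f.quotKerEquivRange_symm_apply_image x ⟨x, rfl⟩
  rw [LinearMap.comp_apply, LinearMap.comp_apply] at h1
  refine h1.trans ?_
  rw [LinearEquiv.coe_coe, h2]
  rfl

namespace LinearResolution

variable {k : Type u} [Field k] {A : Type v} [Ring A] [Algebra k A]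
  {𝒜 : ℕ → Submodule k A} [SetLike.GradedMonoid 𝒜]
  (R : LinearResolution 𝒜)

/-- The generators of the `j`-th term. -/
abbrev X (j : ℕ) : Type v := R.ℳ j j

/-- The action of the degree zero component on the generators. -/
noncomputable def act (j : ℕ) (c : 𝒜 0) : R.X j →ₗ[k] R.X j :=
  ((Algebra.lsmul k k (R.P j) (c : A)).comp (R.ℳ j j).subtype).codRestrict (R.ℳ j j) fun x => by
    simpa using R.smul_mem j 0 j c c.2 x x.2

theorem coe_act (j : ℕ) (c : 𝒜 0) (x : R.X j) : (R.act j c x : R.P j) = (c : A) • (x : R.P j) := rfl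

theorem homPart_smul {i l : ℕ} {a : A} (ha : a ∈ 𝒜 l) (m : ℕ) (x : R.P i) :
    homPart (R.ℳ i) (l + m) (a • x) = a • homPart (R.ℳ i) m x := by
  induction x using homogeneous_induction (R.ℳ i) with
  | hadd x y hx hy => rw [smul_add, map_add, hx, hy, map_add, smul_add]
  | h j x hx =>
    by_cases h : j = m
    · subst h
      rw [homPart_same hx, homPart_same (R.smul_mem _ _ _ _ ha _ hx)]
    · rw [homPart_ne hx h, homPart_ne (R.smul_mem _ _ _ _ ha _ hx) (by omega), smul_zero]

/-- Induction over the terms of the resolution, which are spanned by the multiples of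
generators. -/
theorem smul_induction {j : ℕ} {p : R.P j → Prop} (h0 : p 0) (hadd : ∀ x y, p x → p y → p (x + y))
    (h : ∀ (a : A) (y : R.X j), p (a • (y : R.P j))) (x : R.P j) : p x := by
  have hx : x ∈ Submodule.span A (R.ℳ j j : Set (R.P j)) := by
    rw [R.span_eq_top]; exact Submodule.mem_top
  induction hx using Submodule.closure_induction with
  | zero => exact h0
  | add x y _ _ hx hy => exact hadd x y hx hy
  | smul_mem a y hy => exact h a ⟨y, hy⟩

variable [DirectSum.Decomposition 𝒜]

theorem homPart_smul_coe {j : ℕ} (a : A) (m : ℕ) (x : R.X j) :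
    homPart (R.ℳ j) (m + j) (a • (x : R.P j)) = homPart 𝒜 m a • (x : R.P j) := by
  induction a using homogeneous_induction 𝒜 with
  | hadd x y hx hy => rw [add_smul, map_add, hx, hy, map_add, add_smul]
  | h l a ha =>
    by_cases h : l = m
    · subst h
      rw [homPart_same ha, homPart_smul R ha, homPart_same x.2]
    · rw [homPart_ne ha h, homPart_ne (R.smul_mem _ _ _ _ ha _ x.2) (by omega), zero_smul]

/-- A graded projective module that is generated in one degree is induced from its
generators: a map on `A_i ⊗_{A₀} X_j`, given by `φ`, extends to `P_j`. -/
theorem exists_extension {W : Type*} [AddCommGroup W] [Module k W] (j i : ℕ)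
    (φ : A →ₗ[k] R.X j →ₗ[k] W) (hφ : ∀ l, l ≠ i → ∀ a ∈ 𝒜 l, φ a = 0)
    (hbal : ∀ (c : 𝒜 0) (a : A) (y : R.X j), φ (a * c) y = φ a (R.act j c y)) :
    ∃ F : R.P j →ₗ[k] W, ∀ (a : A) (y : R.X j), F (a • (y : R.P j)) = φ a y := by
  let π : (R.X j →₀ A) →ₗ[A] R.P j := Finsupp.linearCombination A (fun y : R.X j => (y : R.P j))
  have hπ : Function.Surjective π := by
    rw [← LinearMap.range_eq_top, Finsupp.range_linearCombination, ← R.span_eq_top j]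
    exact congrArg _ Subtype.range_coe
  -- A section of the cover by generators. It need not be graded, but only the coefficients of
  -- degree zero of `s y` contribute, because `φ` has support in degree `i`.
  obtain ⟨s, hs⟩ := Module.projective_lifting_property π LinearMap.id hπ
  let Λ : (R.X j →₀ A) →ₗ[k] W := Finsupp.lsum k fun z => φ.flip z
  refine ⟨Λ ∘ₗ s.restrictScalars k ∘ₗ homPart (R.ℳ j) (i + j), fun a y => ?_⟩
  have hφ' : ∀ {a}, a ∈ 𝒜 i → ∀ x z, φ (a * x) z = φ (a * homPart 𝒜 0 x) z := by
    intro a ha x z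
    induction x using homogeneous_induction 𝒜 with
    | hadd x y hx hy => rw [mul_add, map_add, LinearMap.add_apply, hx, hy, map_add, mul_add,
        map_add, LinearMap.add_apply]
    | h l x hx =>
      by_cases h : l = 0
      · subst h; rw [homPart_same hx]
      · rw [homPart_ne hx h, mul_zero, hφ (i + l) (by omega) _ (SetLike.mul_mem_graded ha hx),
          map_zero]
  induction a using homogeneous_induction 𝒜 with
  | hadd a b ha hb => rw [add_smul, map_add, ha, hb, map_add, LinearMap.add_apply]
  | h l a ha =>
    by_cases h : l = i
    · subst h
      have h1 : homPart (R.ℳ j) (l + j) (a • (y : R.P j)) = a • (y : R.P j) :=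
        homPart_same (R.smul_mem _ _ _ _ ha _ y.2)
      have h2 : ∑ z ∈ (s y).support, homPart 𝒜 0 (s y z) • (z : R.P j) = y := by
        have h3 : ∑ z ∈ (s y).support, s y z • (z : R.P j) = y := LinearMap.congr_fun hs (y : R.P j)
        have h4 := congrArg (homPart (R.ℳ j) (0 + j)) h3
        rw [map_sum] at h4
        simp only [homPart_smul_coe] at h4
        rw [h4, zero_add, homPart_same y.2]
      have h5 : ∑ z ∈ (s y).support, R.act j ⟨homPart 𝒜 0 (s y z), homPart_mem 𝒜 0 _⟩ z = y := by
        apply Subtype.ext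
        rw [AddSubmonoidClass.coe_finsetSum]
        exact h2
      simp only [LinearMap.comp_apply, h1, LinearMap.restrictScalars_apply, map_smul]
      change Λ (a • s y) = _
      have h6 : Λ (a • s y) = ∑ z ∈ (s y).support, φ (a * s y z) z := by
        change (a • s y).sum (fun z b => φ b z) = _
        rw [Finsupp.sum_smul_index (fun z => by simp)]
        rfl
      rw [h6]
      conv_rhs => rw [← h5, map_sum]
      refine Finset.sum_congr rfl fun z _ => ?_
      rw [← hbal, hφ' ha]
    · rw [LinearMap.comp_apply, LinearMap.comp_apply,
        homPart_ne (R.smul_mem _ _ _ _ ha _ y.2) (by omega), map_zero, map_zero, hφ l h a ha,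
        LinearMap.zero_apply]

variable {V : Type*} [Fintype V] (S : SplitGrading 𝒜 V)

/-- The contraction of the first leg of a tensor in `A ⊗_{A₀} X` that is of degree one against a
functional. -/
theorem exists_cut_single (j : ℕ) (g : DegreeOneDual 𝒜) :
    ∃ F : R.P j →ₗ[k] R.X j, ∀ (a : A) (y : R.X j), F (a • (y : R.P j)) =
      ∑ v, DegreeOneDual.toDual 𝒜 g (MulOpposite.op (S.idem v) • degreeOnePart 𝒜 a) •
        R.act j (S.idem v) y := by
  let φ : A →ₗ[k] R.X j →ₗ[k] R.X j :=
    ∑ v, LinearMap.toSpanSingleton k _ (R.act j (S.idem v)) ∘ₗ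
      (DegreeOneDual.toDual 𝒜 g ∘ₗ DegreeOne.rmul 𝒜 (S.idem v) ∘ₗ degreeOnePart 𝒜)
  have hφ : ∀ a y, φ a y =
      ∑ v, DegreeOneDual.toDual 𝒜 g (MulOpposite.op (S.idem v) • degreeOnePart 𝒜 a) •
        R.act j (S.idem v) y := by
    intro a y
    simp only [φ, LinearMap.sum_apply, LinearMap.comp_apply, LinearMap.toSpanSingleton_apply,
      LinearMap.smul_apply]
    rfl
  suffices h : (∀ l, l ≠ 1 → ∀ a ∈ 𝒜 l, φ a = 0) ∧
      ∀ (c : 𝒜 0) (a : A) (y : R.X j), φ (a * c) y = φ a (R.act j c y) by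
    obtain ⟨F, hF⟩ := R.exists_extension j 1 φ h.1 h.2
    exact ⟨F, fun a y => (hF a y).trans (hφ a y)⟩
  refine ⟨fun l hl a ha => ?_, fun c a y => ?_⟩
  · have : degreeOnePart 𝒜 a = 0 := DegreeOne.val_injective (homPart_ne ha hl)
    ext1 y
    rw [hφ, this]
    simp
  · rw [hφ, hφ]
    refine Finset.sum_congr rfl fun v _ => ?_
    obtain ⟨r, h1, h2⟩ := S.exists_mul_idem c v
    have h3 : MulOpposite.op (S.idem v) • degreeOnePart 𝒜 (a * c) =
        r • MulOpposite.op (S.idem v) • degreeOnePart 𝒜 a := by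
      apply DegreeOne.val_injective
      rw [degreeOnePart_mul, DegreeOne.val_op_smul, DegreeOne.val_op_smul, map_smul,
        DegreeOne.val_op_smul, mul_assoc, h1, mul_smul_comm]
    have h4 : R.act j (S.idem v) (R.act j c y) = r • R.act j (S.idem v) y := by
      apply Subtype.ext
      rw [coe_act, coe_act, ← mul_smul, h2, smul_assoc]
      rfl
    rw [h3, h4, map_smul, smul_eq_mul, smul_smul, mul_comm]

variable {ι : Type*} [Fintype ι] (D : DualFamily 𝒜 ι)

include D in
/-- The contractions of `exists_cut_single` can be chosen to depend linearly on the functional. -/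
theorem exists_cut (j : ℕ) :
    ∃ F : DegreeOneDual 𝒜 →ₗ[k] R.P j →ₗ[k] R.X j, ∀ g (a : A) (y : R.X j), F g (a • (y : R.P j)) =
      ∑ v, DegreeOneDual.toDual 𝒜 g (MulOpposite.op (S.idem v) • degreeOnePart 𝒜 a) •
        R.act j (S.idem v) y := by
  choose F hF using R.exists_cut_single S j
  refine ⟨∑ s, LinearMap.toSpanSingleton k _ (F (D.covec s)) ∘ₗ
    ((Module.Dual.eval k _ (D.vec s)) ∘ₗ (DegreeOneDual.toDual 𝒜).toLinearMap), fun g a y => ?_⟩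
  simp only [LinearMap.sum_apply, LinearMap.comp_apply, LinearMap.toSpanSingleton_apply,
      LinearMap.smul_apply, hF, LinearEquiv.coe_coe, Module.Dual.eval_apply]
  conv_rhs => rw [← D.sum_covec g]
  simp only [map_sum, map_smul, LinearMap.sum_apply, LinearMap.smul_apply, Finset.sum_smul,
    Finset.smul_sum, smul_assoc]
  exact Finset.sum_comm

end LinearResolution

namespace LinearResolution

variable {k : Type u} [Field k] {A : Type v} [Ring A] [Algebra k A]
  {𝒜 : ℕ → Submodule k A} [SetLike.GradedMonoid 𝒜] [DirectSum.Decomposition 𝒜]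
  (R : LinearResolution 𝒜) {V : Type*} [Fintype V] (S : SplitGrading 𝒜 V)
  {ι : Type*} [Fintype ι] (D : DualFamily 𝒜 ι)

/-- The contraction of the first leg of a tensor in `A ⊗_{A₀} X` against a functional on the
component of degree one. -/
noncomputable def cut (j : ℕ) : DegreeOneDual 𝒜 →ₗ[k] R.P j →ₗ[k] R.X j :=
  (R.exists_cut S D j).choose

theorem cut_smul (j : ℕ) (g : DegreeOneDual 𝒜) (a : A) (y : R.X j) :
    R.cut S D j g (a • (y : R.P j)) =
      ∑ v, DegreeOneDual.toDual 𝒜 g (MulOpposite.op (S.idem v) • degreeOnePart 𝒜 a) •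
        R.act j (S.idem v) y :=
  (R.exists_cut S D j).choose_spec g a y

/-- The contractions recover the component of a tensor whose first leg has degree one. -/
theorem sum_smul_cut (j : ℕ) (p : R.P j) :
    ∑ s, D.elt s • (R.cut S D j (D.covec s) p : R.P j) = homPart (R.ℳ j) (1 + j) p := by
  induction p using R.smul_induction with
  | h0 => simp
  | hadd x y hx hy =>
    simp only [map_add, ← hx, ← hy, Submodule.coe_add, smul_add, Finset.sum_add_distrib]
  | h a y =>
    have h1 : ∀ v s, D.elt s • (DegreeOneDual.toDual 𝒜 (D.covec s)
        (MulOpposite.op (S.idem v) • degreeOnePart 𝒜 a) • (S.idem v : A) • (y : R.P j)) =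
        DegreeOne.val 𝒜 (DegreeOneDual.toDual 𝒜 (D.covec s)
        (MulOpposite.op (S.idem v) • degreeOnePart 𝒜 a) • D.vec s) •
          (S.idem v : A) • (y : R.P j) := by
      intro v s
      rw [smul_algebra_smul_comm, (DegreeOne.val 𝒜).map_smul, smul_assoc]
      rfl
    have h2 : ∀ v, ∑ s, D.elt s • (DegreeOneDual.toDual 𝒜 (D.covec s)
        (MulOpposite.op (S.idem v) • degreeOnePart 𝒜 a) • (S.idem v : A) • (y : R.P j)) =
        homPart 𝒜 1 a • (S.idem v : A) • (y : R.P j) := by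
      intro v
      simp only [h1]
      rw [← Finset.sum_smul, ← map_sum, D.complete, DegreeOne.val_op_smul, val_degreeOnePart,
        ← mul_smul, ← mul_smul, mul_assoc, S.coe_idem_mul_self]
    simp only [cut_smul, AddSubmonoidClass.coe_finsetSum, Submodule.coe_smul, coe_act,
      Finset.smul_sum]
    rw [Finset.sum_comm]
    simp only [h2]
    rw [← Finset.smul_sum, ← Finset.sum_smul, S.coe_sum_idem, one_smul, homPart_smul_coe]

theorem cut_coe_smul (j : ℕ) (c : 𝒜 0) (g : DegreeOneDual 𝒜) (p : R.P j) :
    R.cut S D j (c • g) p = R.act j c (R.cut S D j g p) := by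
  induction p using R.smul_induction with
  | h0 => simp
  | hadd x y hx hy => rw [map_add, hx, hy, map_add, map_add]
  | h a y =>
    rw [cut_smul, cut_smul, map_sum]
    refine Finset.sum_congr rfl fun v _ => ?_
    obtain ⟨r, h1, h2⟩ := S.exists_mul_idem c v
    have h3 : MulOpposite.op c • MulOpposite.op (S.idem v) • degreeOnePart 𝒜 a =
        r • MulOpposite.op (S.idem v) • degreeOnePart 𝒜 a := by
      apply DegreeOne.val_injective
      rw [DegreeOne.val_op_smul, DegreeOne.val_op_smul, map_smul, DegreeOne.val_op_smul,
        mul_assoc, h2, mul_smul_comm]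
    have h4 : R.act j c (R.act j (S.idem v) y) = r • R.act j (S.idem v) y := by
      apply Subtype.ext
      rw [coe_act, coe_act, ← mul_smul, h1, smul_assoc]
      rfl
    rw [DegreeOneDual.toDual_smul, h3, LinearMap.map_smul, LinearMap.map_smul, h4, smul_eq_mul,
      smul_smul, mul_comm]

theorem cut_op_smul (j : ℕ) (c : 𝒜 0) (g : DegreeOneDual 𝒜) (p : R.P j) :
    R.cut S D j (MulOpposite.op c • g) p = R.cut S D j g ((c : A) • p) := by
  induction p using R.smul_induction with
  | h0 => simp
  | hadd x y hx hy => rw [map_add, hx, hy, smul_add, map_add]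
  | h a y =>
    rw [← mul_smul, cut_smul, cut_smul]
    refine Finset.sum_congr rfl fun v _ => ?_
    rw [DegreeOneDual.toDual_op_smul, degreeOnePart_coe_mul]
    congr 2
    apply DegreeOne.val_injective
    rw [DegreeOne.val_smul, DegreeOne.val_op_smul, DegreeOne.val_op_smul, DegreeOne.val_smul,
      mul_assoc]

/-- The comultiplication of the Koszul dual coalgebra, contracted against a functional. -/
noncomputable def contract (j : ℕ) : DegreeOneDual 𝒜 →ₗ[k] R.X (j + 1) →ₗ[k] R.X j :=
  (LinearMap.lcomp k _ ((R.d j).restrictScalars k ∘ₗ (R.ℳ (j + 1) (j + 1)).subtype)).comp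
    (R.cut S D j)

theorem contract_apply (j : ℕ) (g : DegreeOneDual 𝒜) (x : R.X (j + 1)) :
    R.contract S D j g x = R.cut S D j g (R.d j x) := rfl

/-- The differential of a linear resolution maps generators to tensors with first leg of degree one,
so that the contractions determine it. -/
theorem d_coe (j : ℕ) (x : R.X (j + 1)) :
    R.d j x = ∑ s, D.elt s • (R.contract S D j (D.covec s) x : R.P j) := by
  simp only [contract_apply, sum_smul_cut]
  rw [homPart_same]
  rw [add_comm]
  exact R.d_mem _ _ _ x.2

theorem contract_smul (j : ℕ) (c : 𝒜 0) (g : DegreeOneDual 𝒜) (x : R.X (j + 1)) :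
    R.contract S D j (c • g) x = R.act j c (R.contract S D j g x) := by
  rw [contract_apply, cut_coe_smul]
  rfl

theorem contract_op_smul (j : ℕ) (c : 𝒜 0) (g : DegreeOneDual 𝒜) (x : R.X (j + 1)) :
    R.contract S D j (MulOpposite.op c • g) x = R.contract S D j g (R.act (j + 1) c x) := by
  rw [contract_apply, cut_op_smul, contract_apply, coe_act, (R.d j).map_smul]

/-- The contractions satisfy the relations of the quadratic dual, because `d ∘ d = 0`. -/
theorem contract_relation (j : ℕ) (F : A →ₗ[k] k) (x : R.X (j + 2)) :
    ∑ s, ∑ t, F (D.elt s * D.elt t) •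
      R.contract S D j (D.covec t) (R.contract S D (j + 1) (D.covec s) x) = 0 := by
  have hbase : ∑ s, ∑ t, (D.elt s * D.elt t) •
      (R.contract S D j (D.covec t) (R.contract S D (j + 1) (D.covec s) x) : R.P j) = 0 := by
    have h1 : R.d j (R.d (j + 1) x) = 0 := (R.exact_d j).apply_apply_eq_zero _
    rw [R.d_coe S D, map_sum] at h1
    simpa only [map_smul, R.d_coe S D j, Finset.smul_sum, mul_smul] using h1
  let φ : A →ₗ[k] R.X j →ₗ[k] R.X j :=
    ∑ v, LinearMap.toSpanSingleton k _ (R.act j (S.idem v)) ∘ₗ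
      (F ∘ₗ LinearMap.mulRight k (S.idem v : A) ∘ₗ homPart 𝒜 2)
  have hφ : ∀ a y, φ a y =
      ∑ v, F (homPart 𝒜 2 a * S.idem v) • R.act j (S.idem v) y := by
    intro a y
    simp only [φ, LinearMap.sum_apply, LinearMap.comp_apply, LinearMap.toSpanSingleton_apply,
      LinearMap.smul_apply]
    rfl
  have hsupp : ∀ l, l ≠ 2 → ∀ a ∈ 𝒜 l, φ a = 0 := by
    intro l hl a ha
    ext1 y
    rw [hφ, homPart_ne ha hl]
    simp
  have hbal : ∀ (c : 𝒜 0) (a : A) (y : R.X j), φ (a * c) y = φ a (R.act j c y) := by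
    intro c a y
    rw [hφ, hφ]
    refine Finset.sum_congr rfl fun v _ => ?_
    obtain ⟨r, h1, h2⟩ := S.exists_mul_idem c v
    have h4 : R.act j (S.idem v) (R.act j c y) = r • R.act j (S.idem v) y := by
      apply Subtype.ext
      rw [coe_act, coe_act, ← mul_smul, h2, smul_assoc]
      rfl
    have h5 : homPart 𝒜 2 (a * c) = homPart 𝒜 2 a * c := homPart_mul_right 𝒜 c.2 2 a
    rw [h4, h5, mul_assoc, h1, mul_smul_comm, map_smul, smul_eq_mul, smul_smul, mul_comm]
  obtain ⟨G, hG⟩ := R.exists_extension j 2 φ hsupp hbal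
  have h1 := congrArg G hbase
  simp only [map_sum, hG, map_zero, hφ] at h1
  rw [← h1]
  refine Finset.sum_congr rfl fun s _ => ?_
  rw [Finset.sum_comm]
  set z := R.contract S D (j + 1) (D.covec s) x
  -- The idempotents move to the second leg of the canonical element and disappear.
  have h2 : ∀ v, ∑ t, F (homPart 𝒜 2 (D.elt s * D.elt t) * S.idem v) •
      R.act j (S.idem v) (R.contract S D j (D.covec t) z) =
      ∑ t, F (D.elt s * D.elt t) • R.act j (S.idem v) (R.contract S D j (D.covec t) z) := by
    intro v
    let β : DegreeOne 𝒜 →ₗ[k] DegreeOneDual 𝒜 →ₗ[k] R.X j :=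
      LinearMap.toSpanSingleton k _ (R.act j (S.idem v) ∘ₗ (R.contract S D j).flip z) ∘ₗ
        (F ∘ₗ LinearMap.mulLeft k (D.elt s) ∘ₗ DegreeOne.val 𝒜)
    have h3 := D.transpose β (DegreeOne.rmul 𝒜 (S.idem v)) (fun g => S.idem v • g)
      (fun g x => rfl)
    have hβ : ∀ a g, β a g = F (D.elt s * DegreeOne.val 𝒜 a) •
        R.act j (S.idem v) (R.contract S D j g z) := fun a g => rfl
    simp only [hβ, contract_smul] at h3
    refine Eq.trans (Finset.sum_congr rfl fun t _ => ?_)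
      (h3.trans (Finset.sum_congr rfl fun t _ => ?_))
    · rw [homPart_same (SetLike.mul_mem_graded (D.elt_mem s) (D.elt_mem t)), mul_assoc]
      rfl
    · congr 1
      apply Subtype.ext
      rw [coe_act, coe_act, ← mul_smul, S.coe_idem_mul_self]
  rw [Finset.sum_congr rfl fun v _ => h2 v, Finset.sum_comm]
  refine Finset.sum_congr rfl fun t _ => ?_
  rw [← Finset.smul_sum]
  congr 1
  apply Subtype.ext
  simp only [AddSubmonoidClass.coe_finsetSum, coe_act]
  rw [← Finset.sum_smul, S.coe_sum_idem, one_smul]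

section exactness

variable {W : Type*} [AddCommGroup W] [Module k W]

/-- The condition `hcyc` says that the extension `F` of `φ` to `P_j` vanishes on the image of the
differential. -/
theorem comp_d_eq_zero {j : ℕ} (φ : A →ₗ[k] R.X j →ₗ[k] W) (F : R.P j →ₗ[k] W)
    (hF : ∀ (a : A) (y : R.X j), F (a • (y : R.P j)) = φ a y)
    (hcyc : ∀ a (x : R.X (j + 1)), ∑ s, φ (a * D.elt s) (R.contract S D j (D.covec s) x) = 0)
    (p : R.P (j + 1)) : F (R.d j p) = 0 := by
  induction p using R.smul_induction with
  | h0 => simp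
  | hadd x y hx hy => rw [map_add, map_add, hx, hy, add_zero]
  | h a y =>
    rw [map_smul, R.d_coe S D, Finset.smul_sum, map_sum]
    simp only [← mul_smul, hF, hcyc]

/-- Exactness of the Koszul complex at its end `A_i ⊗ X_0`, in the form of functionals: for `i > 0`,
the map `A_{i-1} ⊗ X_1 → A_i ⊗ X_0` is surjective. -/
theorem cocycle_eq_zero {i : ℕ} (hi : 0 < i) (φ : A →ₗ[k] R.X 0 →ₗ[k] W)
    (hφ : ∀ l, l ≠ i → ∀ a ∈ 𝒜 l, φ a = 0)
    (hbal : ∀ (c : 𝒜 0) (a : A) (y : R.X 0), φ (a * c) y = φ a (R.act 0 c y))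
    (hcyc : ∀ a (x : R.X 1), ∑ s, φ (a * D.elt s) (R.contract S D 0 (D.covec s) x) = 0) :
    φ = 0 := by
  obtain ⟨F, hF⟩ := R.exists_extension 0 i φ hφ hbal
  have h1 := R.comp_d_eq_zero S D φ F hF hcyc
  ext a y
  induction a using homogeneous_induction 𝒜 with
  | hadd a b ha hb => rw [map_add, LinearMap.add_apply, ha, hb, map_add, LinearMap.add_apply]
  | h l a ha =>
    by_cases h : l = i
    · subst h
      have h2 : R.ε (a • (y : R.P 0)) = 0 := by
        obtain ⟨b, hb⟩ := Submodule.Quotient.mk_surjective _ (R.ε y)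
        rw [R.ε.map_smul, ← hb, ← Submodule.Quotient.mk_smul, Submodule.Quotient.mk_eq_zero]
        clear hb
        induction b using homogeneous_induction 𝒜 with
        | hadd b b' hb hb' => rw [smul_add]; exact add_mem hb hb'
        | h m b hb => exact Submodule.subset_span ⟨l + m, by omega, SetLike.mul_mem_graded ha hb⟩
      obtain ⟨q, hq⟩ := (R.exact_ε _).mp h2
      rw [← hF, ← hq, h1]
      rfl
    · rw [hφ l h a ha]
      rfl

/-- The linear map `a ↦ (y ↦ G(a_i y))` that is induced by a functional `G`, where `a_i` is the
component of degree `i` of `a`. -/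
noncomputable def ofFunctional (i j : ℕ) (G : R.P j →ₗ[k] W) : A →ₗ[k] R.X j →ₗ[k] W :=
  (LinearMap.compRight k G ∘ₗ LinearMap.lcomp k _ (R.ℳ j j).subtype ∘ₗ
      (Algebra.lsmul k k (R.P j)).toLinearMap) ∘ₗ homPart 𝒜 i

theorem ofFunctional_apply (i j : ℕ) (G : R.P j →ₗ[k] W) (a : A) (y : R.X j) :
    R.ofFunctional i j G a y = G (homPart 𝒜 i a • (y : R.P j)) := rfl

theorem ofFunctional_supportedAt (i j : ℕ) (G : R.P j →ₗ[k] W) :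
    ∀ l, l ≠ i → ∀ a ∈ 𝒜 l, R.ofFunctional i j G a = 0 := fun l hl a ha => by
  ext1 y
  rw [ofFunctional_apply, homPart_ne ha hl, zero_smul, map_zero]
  rfl

theorem ofFunctional_balanced (i j : ℕ) (G : R.P j →ₗ[k] W) (c : 𝒜 0) (a : A) (y : R.X j) :
    R.ofFunctional i j G (a * c) y = R.ofFunctional i j G a (R.act j c y) := by
  have h2 : homPart 𝒜 i (a * c) = homPart 𝒜 i a * c := homPart_mul_right 𝒜 c.2 _ a
  rw [ofFunctional_apply, ofFunctional_apply, h2, mul_smul]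
  rfl

/-- Exactness of the Koszul complex, in the form of functionals: a linear map on
`A_i ⊗ X_{j+1}` that vanishes on the image of `A_{i-1} ⊗ X_{j+2}` factors through
`A_{i+1} ⊗ X_j`. -/
theorem exists_coboundary {i j : ℕ} (φ : A →ₗ[k] R.X (j + 1) →ₗ[k] W)
    (hφ : ∀ l, l ≠ i → ∀ a ∈ 𝒜 l, φ a = 0)
    (hbal : ∀ (c : 𝒜 0) (a : A) (y : R.X (j + 1)), φ (a * c) y = φ a (R.act (j + 1) c y))
    (hcyc : ∀ a (x : R.X (j + 2)),
      ∑ s, φ (a * D.elt s) (R.contract S D (j + 1) (D.covec s) x) = 0) :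
    ∃ ψ : A →ₗ[k] R.X j →ₗ[k] W, (∀ l, l ≠ i + 1 → ∀ a ∈ 𝒜 l, ψ a = 0) ∧
      (∀ (c : 𝒜 0) (a : A) (y : R.X j), ψ (a * c) y = ψ a (R.act j c y)) ∧
      ∀ a x, ∑ s, ψ (a * D.elt s) (R.contract S D j (D.covec s) x) = φ a x := by
  obtain ⟨F, hF⟩ := R.exists_extension (j + 1) i φ hφ hbal
  have h1 := R.comp_d_eq_zero S D φ F hF hcyc
  obtain ⟨G, hG⟩ := LinearMap.exists_comp_eq_of_ker_le ((R.d j).restrictScalars k) F (by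
    intro x hx
    obtain ⟨q, rfl⟩ := (R.exact_d j x).mp hx
    exact h1 q)
  refine ⟨R.ofFunctional (i + 1) j G, R.ofFunctional_supportedAt (i + 1) j G,
    R.ofFunctional_balanced (i + 1) j G, fun a x => ?_⟩
  · have h3 : φ a x = φ (homPart 𝒜 i a) x := by
      induction a using homogeneous_induction 𝒜 with
      | hadd a b ha hb =>
        rw [map_add, LinearMap.add_apply, ha, hb, map_add, map_add, LinearMap.add_apply]
      | h l a ha =>
        by_cases h : l = i
        · subst h; rw [homPart_same ha]
        · rw [homPart_ne ha h, hφ l h a ha, map_zero]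
    simp only [ofFunctional_apply, homPart_mul_right 𝒜 (D.elt_mem _), mul_smul]
    rw [← map_sum, ← Finset.smul_sum, ← R.d_coe S D, h3, ← hF, ← hG,
      LinearMap.restrictScalars_apply, (R.d j).map_smul]

end exactness

omit [DirectSum.Decomposition 𝒜] in
theorem ε_homPart (p : R.P 0) : R.ε (homPart (R.ℳ 0) 0 p) = R.ε p := by
  induction p using homogeneous_induction (R.ℳ 0) with
  | hadd x y hx hy => rw [map_add, map_add, hx, hy, map_add]
  | h l x hx =>
    by_cases h : l = 0
    · subst h; rw [homPart_same hx]
    · rw [homPart_ne hx h, map_zero, R.ε_pos l (by omega) x hx]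

/-- The generators of the initial term of a linear resolution inject into the algebra modulo
its elements of positive degree. -/
theorem ε_injOn (x : R.X 0) (hx : R.ε x = 0) : x = 0 := by
  obtain ⟨q, hq⟩ := (R.exact_ε _).mp hx
  have h : ∀ q, homPart (R.ℳ 0) 0 (R.d 0 q) = 0 := by
    intro q
    induction q using R.smul_induction with
    | h0 => simp
    | hadd x y hx hy => rw [map_add, map_add, hx, hy, add_zero]
    | h a y =>
      rw [(R.d 0).map_smul]
      induction a using homogeneous_induction 𝒜 with
      | hadd a b ha hb => rw [add_smul, map_add, ha, hb, add_zero]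
      | h l a ha => exact homPart_ne (R.smul_mem _ _ _ _ ha _ (R.d_mem _ _ _ y.2)) (by omega)
  apply Subtype.ext
  rw [← homPart_same x.2, ← hq, h]
  rfl

omit [DirectSum.Decomposition 𝒜] in
/-- The idempotents lift to generators of the initial term of the resolution. -/
theorem exists_generator (v : V) :
    ∃ y : R.X 0, R.ε y = (positiveIdeal 𝒜).mkQ (S.idem v : A) := by
  obtain ⟨p, hp⟩ := R.ε_surjective ((positiveIdeal 𝒜).mkQ (S.idem v : A))
  exact ⟨⟨homPart (R.ℳ 0) 0 p, homPart_mem _ _ _⟩, (R.ε_homPart p).trans hp⟩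

theorem aug_positiveIdeal {a : A} (ha : a ∈ positiveIdeal 𝒜) : S.aug a = 0 := by
  induction ha using Submodule.closure_induction with
  | zero => simp
  | add x y _ _ hx hy => rw [map_add, hx, hy, add_zero]
  | smul_mem r y hy =>
    obtain ⟨d, hd, hy⟩ := hy
    induction r using homogeneous_induction 𝒜 with
    | hadd a b ha hb => rw [add_smul, map_add, ha, hb, add_zero]
    | h l a ha => exact S.aug_pos _ (by omega) _ (SetLike.mul_mem_graded ha hy)

/-- The functional on the generators of the initial term that is induced by the augmentation. -/
noncomputable def counit : R.X 0 →ₗ[k] k :=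
  ((positiveIdeal 𝒜).restrictScalars k).liftQ S.aug
    (fun _ ha => aug_positiveIdeal S ha) ∘ₗ R.ε.restrictScalars k ∘ₗ (R.ℳ 0 0).subtype

theorem counit_apply {x : R.X 0} {a : A} (h : R.ε x = (positiveIdeal 𝒜).mkQ a) :
    R.counit S x = S.aug a := by
  exact (congrArg (((positiveIdeal 𝒜).restrictScalars k).liftQ S.aug
    (fun _ ha => aug_positiveIdeal S ha)) h).trans rfl

/-- The generator of the initial term that corresponds to an idempotent. -/
noncomputable def generator (v : V) : R.X 0 := (R.exists_generator S v).choose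

omit [DirectSum.Decomposition 𝒜] in
theorem ε_generator (v : V) : R.ε (R.generator S v) = (positiveIdeal 𝒜).mkQ (S.idem v : A) :=
  (R.exists_generator S v).choose_spec

/-- The generators of the initial term are dual to the idempotents. -/
theorem counit_act_generator [DecidableEq V] (u v : V) :
    R.counit S (R.act 0 (S.idem u) (R.generator S v)) = if u = v then 1 else 0 := by
  have h : R.ε (R.act 0 (S.idem u) (R.generator S v)) =
      (positiveIdeal 𝒜).mkQ ((S.idem u : A) * S.idem v) := by
    rw [coe_act, R.ε.map_smul, ε_generator]
    rfl
  rw [R.counit_apply S h]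
  split_ifs with huv
  · rw [huv, S.coe_idem_mul_self, S.aug_idem]
  · rw [S.coe_idem_mul_ne huv, map_zero]

theorem exists_eq_sum_generator (x : R.X 0) : ∃ r : V → k, x = ∑ v, r v • R.generator S v := by
  obtain ⟨a, ha⟩ := (positiveIdeal 𝒜).mkQ_surjective (R.ε x)
  obtain ⟨c, hc⟩ : ∃ c : 𝒜 0, (positiveIdeal 𝒜).mkQ (c : A) = R.ε x := by
    rw [← ha]
    clear ha
    induction a using homogeneous_induction 𝒜 with
    | hadd a b ha hb =>
      obtain ⟨c, hc⟩ := ha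
      obtain ⟨c', hc'⟩ := hb
      exact ⟨c + c', by rw [map_add, ← hc, ← hc', ← map_add]; rfl⟩
    | h l a ha =>
      by_cases h : l = 0
      · subst h; exact ⟨⟨a, ha⟩, rfl⟩
      · refine ⟨0, ?_⟩
        rw [ZeroMemClass.coe_zero, map_zero]
        exact ((Submodule.Quotient.mk_eq_zero _).mpr
          (show a ∈ positiveIdeal 𝒜 from Submodule.subset_span ⟨l, by omega, ha⟩)).symm
  obtain ⟨r, hr⟩ := S.exists_coeff c
  refine ⟨r, ?_⟩
  rw [← sub_eq_zero]
  apply R.ε_injOn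
  have h : R.ε ((∑ v, r v • R.generator S v : R.X 0) : R.P 0) = R.ε x := by
    rw [← hc, hr, AddSubmonoidClass.coe_finsetSum, map_sum, map_sum]
    refine Finset.sum_congr rfl fun v _ => ?_
    rw [Submodule.coe_smul, LinearMap.map_smul_of_tower, LinearMap.map_smul_of_tower, ε_generator]
  rw [AddSubgroupClass.coe_sub, map_sub, h, sub_self]

end LinearResolution

/-! ### The action of the quadratic dual on the Koszul dual coalgebra -/

namespace SplitGrading

variable {k : Type u} [Field k] {A : Type v} [Ring A] [Algebra k A]
  {𝒜 : ℕ → Submodule k A} [SetLike.GradedMonoid 𝒜] {V : Type*} [Fintype V]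
  (S : SplitGrading 𝒜 V)

theorem exists_algebraMap_mul_idem (c : 𝒜 0) (v : V) : ∃ r : k,
    c * S.idem v = algebraMap k (𝒜 0) r * S.idem v ∧
    S.idem v * c = algebraMap k (𝒜 0) r * S.idem v := by
  obtain ⟨r, h1, h2⟩ := S.exists_mul_idem c v
  refine ⟨r, Subtype.ext (h1.trans ?_), Subtype.ext (h2.trans ?_)⟩
  · rw [Algebra.smul_def]; rfl
  · rw [Algebra.smul_def]; rfl

theorem eq_sum_idem (c : 𝒜 0) : ∃ r : V → k, c = ∑ v, algebraMap k (𝒜 0) (r v) * S.idem v := by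
  choose r h1 h2 using S.exists_algebraMap_mul_idem c
  refine ⟨r, ?_⟩
  rw [← Finset.sum_congr rfl fun v _ => h1 v, ← Finset.mul_sum, S.sum_idem, mul_one]

end SplitGrading

section Enveloping

variable (k : Type*) [Field k] (B : Type*) [Ring B] [Algebra k B]

/-- The inclusion of the left factor of the enveloping algebra. -/
noncomputable abbrev envL : B →ₐ[k] B ⊗[k] Bᵐᵒᵖ := Algebra.TensorProduct.includeLeft

/-- The inclusion of the right factor of the enveloping algebra. -/
noncomputable abbrev envR : Bᵐᵒᵖ →ₐ[k] B ⊗[k] Bᵐᵒᵖ := Algebra.TensorProduct.includeRight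

theorem envL_mul_envR (b : B) (c : Bᵐᵒᵖ) : envL k B b * envR k B c = b ⊗ₜ c := by
  simp

theorem envL_comm_envR (b : B) (c : Bᵐᵒᵖ) :
    envL k B b * envR k B c = envR k B c * envL k B b := by
  simp

theorem tmul_mul_envL (b b' : B) (c : Bᵐᵒᵖ) : (b ⊗ₜ[k] c) * envL k B b' = (b * b') ⊗ₜ c := by
  simp

end Enveloping

namespace LinearResolution

variable {k : Type u} [Field k] {A : Type v} [Ring A] [Algebra k A]
  {𝒜 : ℕ → Submodule k A} [SetLike.GradedMonoid 𝒜] [DirectSum.Decomposition 𝒜]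
  (R : LinearResolution 𝒜) {V : Type*} [Fintype V] (S : SplitGrading 𝒜 V)
  {ι : Type*} [Fintype ι] (D : DualFamily 𝒜 ι)

omit [DirectSum.Decomposition 𝒜] in
theorem act_mul (j : ℕ) (c c' : 𝒜 0) (x : R.X j) :
    R.act j (c * c') x = R.act j c (R.act j c' x) := by
  apply Subtype.ext
  rw [coe_act, coe_act, coe_act, ← mul_smul]
  rfl

omit [DirectSum.Decomposition 𝒜] in
theorem act_algebraMap (j : ℕ) (r : k) (x : R.X j) :
    R.act j (algebraMap k (𝒜 0) r) x = r • x := by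
  apply Subtype.ext
  rw [coe_act]
  exact algebraMap_smul A r (x : R.P j)

/-- The action of the degree zero component on families of generators. -/
noncomputable def actPi : 𝒜 0 →ₐ[k] Module.End k (∀ j, R.X j) where
  toFun c := LinearMap.pi fun j => R.act j c ∘ₗ LinearMap.proj j
  map_one' := by
    ext x j
    exact one_smul A _
  map_mul' c c' := by
    ext x j
    exact congrArg Subtype.val (R.act_mul j c c' (x j))
  map_zero' := by
    ext x j
    exact zero_smul A _
  map_add' c c' := by
    ext x j
    exact add_smul _ _ _
  commutes' r := by
    ext x j
    exact congrArg Subtype.val (R.act_algebraMap j r (x j))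

/-- The action of a functional on families of generators, by contraction. -/
noncomputable def contractPi : DegreeOneDual 𝒜 →ₗ[k] Module.End k (∀ j, R.X j) where
  toFun g := LinearMap.pi fun j => R.contract S D j g ∘ₗ LinearMap.proj (j + 1)
  map_add' g h := by
    ext x j
    simp
  map_smul' r g := by
    ext x j
    simp

/-- The left action of the quadratic dual on families of generators of the terms of the
resolution. -/
noncomputable def dualAction : QuadraticDual 𝒜 →ₐ[k] Module.End k (∀ j, R.X j) :=
  QuadraticDual.lift D R.actPi (R.contractPi S D)
    (fun c g => by
      ext x j
      exact congrArg Subtype.val (R.contract_smul S D j c g (x (j + 1))))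
    (fun c g => by
      ext x j
      exact congrArg Subtype.val (R.contract_op_smul S D j c g (x (j + 1))))
    (fun F => by
      ext x j
      have h := R.contract_relation S D j F (x (j + 2))
      refine Eq.trans ?_ (congrArg Subtype.val h)
      congr 1
      simp only [LinearMap.sum_apply, Finset.sum_apply, LinearMap.smul_apply, Pi.smul_apply]
      rfl)

/-- The pairing of the quadratic dual with the generators of degree `j`. -/
noncomputable def pair (j : ℕ) : QuadraticDual 𝒜 →ₗ[k] R.X j →ₗ[k] k :=
  (LinearMap.llcomp k _ _ _ (R.counit S ∘ₗ LinearMap.proj 0)) ∘ₗ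
    (LinearMap.lcomp k _ (LinearMap.single k R.X j)) ∘ₗ (R.dualAction S D).toLinearMap

theorem pair_apply (j : ℕ) (b : QuadraticDual 𝒜) (x : R.X j) :
    R.pair S D j b x = R.counit S (R.dualAction S D b (Pi.single j x) 0) := rfl

theorem pair_mul_coeff (j : ℕ) (b : QuadraticDual 𝒜) (c : 𝒜 0) (x : R.X j) :
    R.pair S D j (b * QuadraticDual.coeff 𝒜 c) x = R.pair S D j b (R.act j c x) := by
  have h : R.actPi c (Pi.single j x) = Pi.single j (R.act j c x) := by
    funext l
    change R.act l c (Pi.single (M := R.X) j x l) = _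
    by_cases hl : l = j
    · subst hl; simp
    · rw [Pi.single_eq_of_ne hl, Pi.single_eq_of_ne hl, map_zero]
  rw [pair_apply, map_mul, dualAction, QuadraticDual.lift_coeff, Module.End.mul_apply, h]
  rfl

theorem pair_mul_gen (j : ℕ) (b : QuadraticDual 𝒜) (g : DegreeOneDual 𝒜) (x : R.X (j + 1)) :
    R.pair S D (j + 1) (b * QuadraticDual.gen g) x = R.pair S D j b (R.contract S D j g x) := by
  have h : R.contractPi S D g (Pi.single (j + 1) x) = Pi.single j (R.contract S D j g x) := by
    funext l
    change R.contract S D l g (Pi.single (M := R.X) (j + 1) x (l + 1)) = _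
    by_cases hl : l = j
    · subst hl; simp
    · rw [Pi.single_eq_of_ne hl, Pi.single_eq_of_ne (by omega), map_zero]
  rw [pair_apply, map_mul, dualAction, QuadraticDual.lift_gen, Module.End.mul_apply, h]
  rfl

theorem pair_zero_mul_gen (b : QuadraticDual 𝒜) (g : DegreeOneDual 𝒜) :
    R.pair S D 0 (b * QuadraticDual.gen g) = 0 := by
  ext x
  have h : R.contractPi S D g (Pi.single 0 x) = 0 := by
    funext l
    change R.contract S D l g (Pi.single (M := R.X) 0 x (l + 1)) = _
    rw [Pi.single_eq_of_ne (by omega), map_zero]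
    rfl
  rw [pair_apply, map_mul, dualAction, QuadraticDual.lift_gen, Module.End.mul_apply, h, map_zero]
  exact map_zero _

theorem pair_zero_coeff (c : 𝒜 0) (x : R.X 0) :
    R.pair S D 0 (QuadraticDual.coeff 𝒜 c) x = R.counit S (R.act 0 c x) := by
  rw [pair_apply, dualAction, QuadraticDual.lift_coeff]
  rfl

theorem pair_succ_coeff (j : ℕ) (c : 𝒜 0) :
    R.pair S D (j + 1) (QuadraticDual.coeff 𝒜 c) = 0 := by
  ext x
  rw [pair_apply, dualAction, QuadraticDual.lift_coeff]
  change R.counit S (R.act 0 c (Pi.single (M := R.X) (j + 1) x 0)) = 0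
  rw [Pi.single_eq_of_ne (by omega), map_zero, map_zero]

/-- The map `b ⊗ c ↦ (x ↦ ⟨b, x⟩ c)` from the enveloping algebra of the quadratic dual. -/
noncomputable def envPair (j : ℕ) :
    QuadraticDual 𝒜 ⊗[k] (QuadraticDual 𝒜)ᵐᵒᵖ →ₗ[k] R.X j →ₗ[k] (QuadraticDual 𝒜)ᵐᵒᵖ :=
  dualTensorHom k (R.X j) (QuadraticDual 𝒜)ᵐᵒᵖ ∘ₗ
    TensorProduct.map (R.pair S D j) LinearMap.id

theorem envPair_tmul (j : ℕ) (b : QuadraticDual 𝒜) (c : (QuadraticDual 𝒜)ᵐᵒᵖ) (x : R.X j) :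
    R.envPair S D j (b ⊗ₜ c) x = R.pair S D j b x • c := rfl

theorem envPair_mul_coeff (j : ℕ) (t : QuadraticDual 𝒜 ⊗[k] (QuadraticDual 𝒜)ᵐᵒᵖ) (c : 𝒜 0)
    (x : R.X j) : R.envPair S D j (t * envL k _ (QuadraticDual.coeff 𝒜 c)) x =
      R.envPair S D j t (R.act j c x) := by
  induction t with
  | zero => simp
  | add s t hs ht =>
    rw [add_mul, map_add, map_add, LinearMap.add_apply, LinearMap.add_apply, hs, ht]
  | tmul b w => rw [tmul_mul_envL, envPair_tmul, envPair_tmul, pair_mul_coeff]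

theorem envPair_mul_gen (j : ℕ) (t : QuadraticDual 𝒜 ⊗[k] (QuadraticDual 𝒜)ᵐᵒᵖ)
    (g : DegreeOneDual 𝒜) (x : R.X (j + 1)) :
    R.envPair S D (j + 1) (t * envL k _ (QuadraticDual.gen g)) x =
      R.envPair S D j t (R.contract S D j g x) := by
  induction t with
  | zero => simp
  | add s t hs ht =>
    rw [add_mul, map_add, map_add, LinearMap.add_apply, LinearMap.add_apply, hs, ht]
  | tmul b w => rw [tmul_mul_envL, envPair_tmul, envPair_tmul, pair_mul_gen]

theorem envPair_zero_mul_gen (t : QuadraticDual 𝒜 ⊗[k] (QuadraticDual 𝒜)ᵐᵒᵖ)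
    (g : DegreeOneDual 𝒜) : R.envPair S D 0 (t * envL k _ (QuadraticDual.gen g)) = 0 := by
  induction t with
  | zero => simp
  | add s t hs ht => rw [add_mul, map_add, hs, ht, add_zero]
  | tmul b w =>
    ext1 x
    rw [tmul_mul_envL, envPair_tmul, pair_zero_mul_gen, LinearMap.zero_apply, zero_smul]
    rfl

end LinearResolution

/-! ### The left grading of the enveloping algebra of the quadratic dual -/

section LeftDegree

variable {k : Type u} [Field k] {A : Type v} [Ring A] [Algebra k A]
  {𝒜 : ℕ → Submodule k A} [SetLike.GradedMonoid 𝒜]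

/-- The enveloping algebra of the quadratic dual. -/
abbrev DualEnv (𝒜 : ℕ → Submodule k A) [SetLike.GradedMonoid 𝒜] : Type max u v :=
  QuadraticDual 𝒜 ⊗[k] (QuadraticDual 𝒜)ᵐᵒᵖ

/-- A functional on the component of degree one, in the left factor of the enveloping algebra. -/
noncomputable def lgen : DegreeOneDual 𝒜 →ₗ[k] DualEnv 𝒜 :=
  (envL k (QuadraticDual 𝒜)).toLinearMap ∘ₗ QuadraticDual.gen

/-- A functional on the component of degree one, in the right factor of the enveloping algebra. -/
noncomputable def rgen : DegreeOneDual 𝒜 →ₗ[k] DualEnv 𝒜 :=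
  (envR k (QuadraticDual 𝒜)).toLinearMap ∘ₗ (MulOpposite.opLinearEquiv k).toLinearMap ∘ₗ
    QuadraticDual.gen

/-- An element of degree zero, in the left factor of the enveloping algebra. -/
noncomputable def lcoeff (c : 𝒜 0) : DualEnv 𝒜 := envL k _ (QuadraticDual.coeff 𝒜 c)

/-- An element of degree zero, in the right factor of the enveloping algebra. -/
noncomputable def rcoeff (c : 𝒜 0) : DualEnv 𝒜 :=
  envR k _ (MulOpposite.op (QuadraticDual.coeff 𝒜 c))

theorem lcoeff_mul (c c' : 𝒜 0) : lcoeff (c * c') = lcoeff c * lcoeff c' := by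
  simp only [lcoeff, map_mul]

theorem rcoeff_mul (c c' : 𝒜 0) : rcoeff (c * c') = rcoeff c' * rcoeff c := by
  simp only [rcoeff, map_mul, MulOpposite.op_mul]

theorem lcoeff_one : lcoeff (1 : 𝒜 0) = 1 := by simp only [lcoeff, map_one]

theorem lcoeff_algebraMap_mul (r : k) (c : 𝒜 0) :
    lcoeff (algebraMap k (𝒜 0) r * c) = r • lcoeff c := by
  rw [lcoeff_mul, lcoeff, AlgHom.commutes, AlgHom.commutes]
  exact (Algebra.smul_def r (lcoeff c)).symm

theorem rcoeff_algebraMap_mul (r : k) (c : 𝒜 0) :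
    rcoeff (algebraMap k (𝒜 0) r * c) = r • rcoeff c := by
  rw [rcoeff_mul]
  have h : rcoeff (algebraMap k (𝒜 0) r) = algebraMap k (DualEnv 𝒜) r := by
    rw [rcoeff, AlgHom.commutes, ← MulOpposite.algebraMap_apply, AlgHom.commutes]
  rw [h, ← Algebra.commutes]
  exact (Algebra.smul_def r (rcoeff c)).symm

theorem lcoeff_comm_rcoeff (c c' : 𝒜 0) : lcoeff c * rcoeff c' = rcoeff c' * lcoeff c :=
  envL_comm_envR ..

theorem lgen_comm_rcoeff (g : DegreeOneDual 𝒜) (c : 𝒜 0) :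
    lgen g * rcoeff c = rcoeff c * lgen g :=
  envL_comm_envR ..

theorem lcoeff_comm_rgen (c : 𝒜 0) (g : DegreeOneDual 𝒜) :
    lcoeff c * rgen g = rgen g * lcoeff c :=
  envL_comm_envR ..

theorem lgen_comm_rgen (g h : DegreeOneDual 𝒜) : lgen g * rgen h = rgen h * lgen g :=
  envL_comm_envR ..

theorem lgen_smul (c : 𝒜 0) (g : DegreeOneDual 𝒜) : lgen (c • g) = lcoeff c * lgen g := by
  change envL k _ (QuadraticDual.gen _) = envL k _ _ * envL k _ _
  rw [QuadraticDual.gen_smul, map_mul]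

theorem lgen_op_smul (c : 𝒜 0) (g : DegreeOneDual 𝒜) :
    lgen (MulOpposite.op c • g) = lgen g * lcoeff c := by
  change envL k _ (QuadraticDual.gen _) = envL k _ _ * envL k _ _
  rw [QuadraticDual.gen_op_smul, map_mul]

theorem rgen_smul (c : 𝒜 0) (g : DegreeOneDual 𝒜) : rgen (c • g) = rgen g * rcoeff c := by
  change envR k _ (MulOpposite.op (QuadraticDual.gen _)) = envR k _ _ * envR k _ _
  rw [QuadraticDual.gen_smul, ← map_mul]
  rfl

variable (𝒜) in
/-- The elements of left degree `j` in the enveloping algebra of the quadratic dual. -/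
noncomputable def leftDegree : ℕ → Submodule k (DualEnv 𝒜)
  | 0 => Submodule.span k {t | ∃ (c : 𝒜 0) (w : (QuadraticDual 𝒜)ᵐᵒᵖ), t = lcoeff c * envR k _ w}
  | j + 1 => Submodule.span k {t | ∃ s ∈ leftDegree j, ∃ g, t = s * lgen g}

theorem mul_lgen_mem {j : ℕ} {t : DualEnv 𝒜} (ht : t ∈ leftDegree 𝒜 j) (g : DegreeOneDual 𝒜) :
    t * lgen g ∈ leftDegree 𝒜 (j + 1) :=
  Submodule.subset_span ⟨t, ht, g, rfl⟩

theorem mul_lcoeff_mem {j : ℕ} {t : DualEnv 𝒜} (ht : t ∈ leftDegree 𝒜 j) (c : 𝒜 0) :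
    t * lcoeff c ∈ leftDegree 𝒜 j := by
  cases j with
  | zero =>
    induction ht using Submodule.span_induction with
    | zero => rw [zero_mul]; exact zero_mem _
    | add s t _ _ hs ht => rw [add_mul]; exact add_mem hs ht
    | smul r t _ ht => rw [smul_mul_assoc]; exact Submodule.smul_mem _ r ht
    | mem t ht =>
      obtain ⟨c', w, rfl⟩ := ht
      refine Submodule.subset_span ⟨c' * c, w, ?_⟩
      rw [lcoeff_mul, mul_assoc, mul_assoc]
      congr 1
      exact (envL_comm_envR ..).symm
  | succ j =>
    induction ht using Submodule.span_induction with
    | zero => rw [zero_mul]; exact zero_mem _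
    | add s t _ _ hs ht => rw [add_mul]; exact add_mem hs ht
    | smul r t _ ht => rw [smul_mul_assoc]; exact Submodule.smul_mem _ r ht
    | mem t ht =>
      obtain ⟨s, hs, g, rfl⟩ := ht
      rw [mul_assoc, ← lgen_op_smul]
      exact mul_lgen_mem hs _

theorem mul_envR_mem {j : ℕ} {t : DualEnv 𝒜} (ht : t ∈ leftDegree 𝒜 j) (w : (QuadraticDual 𝒜)ᵐᵒᵖ) :
    t * envR k _ w ∈ leftDegree 𝒜 j := by
  induction j generalizing t with
  | zero =>
    induction ht using Submodule.span_induction with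
    | zero => rw [zero_mul]; exact zero_mem _
    | add s t _ _ hs ht => rw [add_mul]; exact add_mem hs ht
    | smul r t _ ht => rw [smul_mul_assoc]; exact Submodule.smul_mem _ r ht
    | mem t ht =>
      obtain ⟨c', w', rfl⟩ := ht
      exact Submodule.subset_span ⟨c', w' * w, by rw [map_mul, mul_assoc]⟩
  | succ j ih =>
    induction ht using Submodule.span_induction with
    | zero => rw [zero_mul]; exact zero_mem _
    | add s t _ _ hs ht => rw [add_mul]; exact add_mem hs ht
    | smul r t _ ht => rw [smul_mul_assoc]; exact Submodule.smul_mem _ r ht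
    | mem t ht =>
      obtain ⟨s, hs, g, rfl⟩ := ht
      have h : lgen g * envR k _ w = envR k _ w * lgen g := envL_comm_envR ..
      rw [mul_assoc, h, ← mul_assoc]
      exact mul_lgen_mem (ih hs) g

theorem mul_rgen_mem {j : ℕ} {t : DualEnv 𝒜} (ht : t ∈ leftDegree 𝒜 j) (g : DegreeOneDual 𝒜) :
    t * rgen g ∈ leftDegree 𝒜 j :=
  mul_envR_mem ht _

variable (𝒜) in
theorem iSup_leftDegree : ⨆ j, leftDegree 𝒜 j = ⊤ := by
  rw [Submodule.eq_top_iff']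
  intro t
  induction t using TensorProduct.induction_on with
  | zero => exact zero_mem _
  | add s t hs ht => exact add_mem hs ht
  | tmul b w =>
    rw [← envL_mul_envR]
    induction b using QuadraticDual.induction_right with
    | hc c => exact Submodule.mem_iSup_of_mem 0 (Submodule.subset_span ⟨c, w, rfl⟩)
    | hadd x y hx hy => rw [map_add, add_mul]; exact add_mem hx hy
    | hmul x g hx =>
      have h : envL k _ (x * QuadraticDual.gen g) * envR k _ w =
          envL k (QuadraticDual 𝒜) x * envR k _ w * lgen g := by
        rw [map_mul, mul_assoc, mul_assoc]
        congr 1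
        exact envL_comm_envR ..
      rw [h]
      generalize envL k (QuadraticDual 𝒜) x * envR k _ w = y at hx
      induction hx using Submodule.iSup_induction' with
      | mem j t ht => exact Submodule.mem_iSup_of_mem (j + 1) (mul_lgen_mem ht g)
      | zero => rw [zero_mul]; exact zero_mem _
      | add s t _ _ hs ht => rw [add_mul]; exact add_mem hs ht

/-- Elements of left degree `j + 1` are combinations `∑ τ_s (a_s^* ⊗ 1)` with `τ_s` of left degree
`j`. The coefficients are not unique. -/
theorem exists_eq_sum_lgen {ι : Type*} [Fintype ι] (D : DualFamily 𝒜 ι) {j : ℕ} {t : DualEnv 𝒜}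
    (ht : t ∈ leftDegree 𝒜 (j + 1)) :
    ∃ τ : ι → DualEnv 𝒜, (∀ s, τ s ∈ leftDegree 𝒜 j) ∧ t = ∑ s, τ s * lgen (D.covec s) := by
  induction ht using Submodule.span_induction with
  | zero => exact ⟨0, fun _ => zero_mem _, by simp⟩
  | add s t _ _ hs ht =>
    obtain ⟨τ, h1, h2⟩ := hs
    obtain ⟨τ', h1', h2'⟩ := ht
    exact ⟨τ + τ', fun s => add_mem (h1 s) (h1' s), by
      simp only [h2, h2', Pi.add_apply, add_mul, Finset.sum_add_distrib]⟩
  | smul r t _ ht =>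
    obtain ⟨τ, h1, h2⟩ := ht
    exact ⟨r • τ, fun s => Submodule.smul_mem _ r (h1 s), by
      simp only [h2, Pi.smul_apply, smul_mul_assoc, Finset.smul_sum]⟩
  | mem t ht =>
    obtain ⟨s, hs, g, rfl⟩ := ht
    refine ⟨fun r => DegreeOneDual.toDual 𝒜 g (D.vec r) • s,
      fun r => Submodule.smul_mem _ _ hs, ?_⟩
    conv_lhs => rw [← D.sum_covec g]
    simp only [map_sum, map_smul, Finset.mul_sum, mul_smul_comm, smul_mul_assoc]

theorem exists_eq_sum_idem {V : Type*} [Fintype V] (S : SplitGrading 𝒜 V) {t : DualEnv 𝒜}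
    (ht : t ∈ leftDegree 𝒜 0) : ∃ w : V → (QuadraticDual 𝒜)ᵐᵒᵖ,
      t = ∑ v, lcoeff (S.idem v) * envR k _ (w v) := by
  induction ht using Submodule.span_induction with
  | zero => exact ⟨0, by simp⟩
  | add s t _ _ hs ht =>
    obtain ⟨w, h⟩ := hs
    obtain ⟨w', h'⟩ := ht
    exact ⟨w + w', by simp only [h, h', Pi.add_apply, map_add, mul_add, Finset.sum_add_distrib]⟩
  | smul r t _ ht =>
    obtain ⟨w, h⟩ := ht
    exact ⟨r • w, by simp only [h, Pi.smul_apply, map_smul, mul_smul_comm, Finset.smul_sum]⟩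
  | mem t ht =>
    obtain ⟨c, w, rfl⟩ := ht
    obtain ⟨r, hr⟩ := S.eq_sum_idem c
    refine ⟨fun v => r v • w, ?_⟩
    conv_lhs => rw [hr]
    have h : lcoeff (∑ v, algebraMap k (𝒜 0) (r v) * S.idem v) =
        ∑ v, lcoeff (algebraMap k (𝒜 0) (r v) * S.idem v) := by
      simp only [lcoeff, map_sum]
    simp only [h, lcoeff_algebraMap_mul, Finset.sum_mul, map_smul, smul_mul_assoc, mul_smul_comm]

/-! ### Balanced maps to the enveloping algebra -/

/-- A linear map on a graded algebra that vanishes on all homogeneous elements of degree different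
from `i`. -/
def SupportedAt (𝒜 : ℕ → Submodule k A) (i : ℕ) {W : Type*} [AddCommGroup W] [Module k W]
    (φ : A →ₗ[k] W) : Prop :=
  ∀ l, l ≠ i → ∀ a ∈ 𝒜 l, φ a = 0

/-- Compatibility of a map to the enveloping algebra with right multiplication by elements of
degree zero. -/
def RightBalanced (φ : A →ₗ[k] DualEnv 𝒜) : Prop :=
  ∀ (c : 𝒜 0) (a : A), φ (a * c) = φ a * lcoeff c

/-- Compatibility of a map to the enveloping algebra with left multiplication by elements of
degree zero. -/
def LeftBalanced (φ : A →ₗ[k] DualEnv 𝒜) : Prop :=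
  ∀ (c : 𝒜 0) (a : A), φ (c * a) = φ a * rcoeff c

/-- The left part `φ ↦ (x ↦ ∑ φ(x a_s) (a_s^* ⊗ 1))` of the Koszul differential. -/
noncomputable def leftDiff {ι : Type*} [Fintype ι] (D : DualFamily 𝒜 ι) :
    (A →ₗ[k] DualEnv 𝒜) →ₗ[DualEnv 𝒜] (A →ₗ[k] DualEnv 𝒜) where
  toFun φ := ∑ s, LinearMap.mulRight k (lgen (D.covec s)) ∘ₗ φ ∘ₗ LinearMap.mulRight k (D.elt s)
  map_add' φ ψ := by
    simp only [LinearMap.add_comp, LinearMap.comp_add, Finset.sum_add_distrib]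
  map_smul' t φ := by
    ext a
    simp [Finset.mul_sum, mul_assoc]

theorem leftDiff_apply {ι : Type*} [Fintype ι] (D : DualFamily 𝒜 ι) (φ : A →ₗ[k] DualEnv 𝒜)
    (a : A) : leftDiff D φ a = ∑ s, φ (a * D.elt s) * lgen (D.covec s) := by
  simp [leftDiff]

/-- The left part of the Koszul differential has square zero, by the relations of the quadratic
dual. -/
theorem leftDiff_leftDiff [Module.Finite k A] {ι : Type*} [Fintype ι] (D : DualFamily 𝒜 ι)
    (φ : A →ₗ[k] DualEnv 𝒜) : leftDiff D (leftDiff D φ) = 0 := by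
  ext1 a
  simp only [leftDiff_apply, Finset.sum_mul]
  let β : DualEnv 𝒜 →ₗ[k] QuadraticDual 𝒜 →ₗ[k] DualEnv 𝒜 :=
    (LinearMap.mul k (DualEnv 𝒜)).compl₂ (envL k (QuadraticDual 𝒜)).toLinearMap
  have h := QuadraticDual.relation_apply D (φ ∘ₗ LinearMap.mulLeft k a) β
  have hβ : ∀ t b, β t b = t * envL k _ b := fun t b => rfl
  simp only [hβ, map_mul] at h
  refine Eq.trans ?_ h
  refine Finset.sum_congr rfl fun s _ => Finset.sum_congr rfl fun t _ => ?_
  rw [LinearMap.comp_apply, LinearMap.mulLeft_apply, mul_assoc, ← mul_assoc a]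
  rfl

end LeftDegree

/-! ### Left degrees and generators of the linear resolution -/

namespace LinearResolution

variable {k : Type u} [Field k] {A : Type v} [Ring A] [Algebra k A]
  {𝒜 : ℕ → Submodule k A} [SetLike.GradedMonoid 𝒜] [DirectSum.Decomposition 𝒜]
  (R : LinearResolution 𝒜) {V : Type*} [Fintype V] (S : SplitGrading 𝒜 V)
  {ι : Type*} [Fintype ι] (D : DualFamily 𝒜 ι)

theorem envPair_mul_lcoeff (j : ℕ) (t : DualEnv 𝒜) (c : 𝒜 0) (x : R.X j) :
    R.envPair S D j (t * lcoeff c) x = R.envPair S D j t (R.act j c x) :=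
  R.envPair_mul_coeff S D j t c x

theorem envPair_mul_lgen (j : ℕ) (t : DualEnv 𝒜) (g : DegreeOneDual 𝒜) (x : R.X (j + 1)) :
    R.envPair S D (j + 1) (t * lgen g) x = R.envPair S D j t (R.contract S D j g x) :=
  R.envPair_mul_gen S D j t g x

theorem envPair_zero_mul_lgen (t : DualEnv 𝒜) (g : DegreeOneDual 𝒜) :
    R.envPair S D 0 (t * lgen g) = 0 :=
  R.envPair_zero_mul_gen S D t g

theorem envPair_lcoeff_mul (j : ℕ) (c : 𝒜 0) (w : (QuadraticDual 𝒜)ᵐᵒᵖ) (x : R.X j) :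
    R.envPair S D j (lcoeff c * envR k _ w) x =
      R.pair S D j (QuadraticDual.coeff 𝒜 c) x • w := by
  rw [lcoeff, envL_mul_envR, envPair_tmul]

theorem envPair_eq_zero {j l : ℕ} (h : l ≠ j) {t : DualEnv 𝒜} (ht : t ∈ leftDegree 𝒜 j) :
    R.envPair S D l t = 0 := by
  induction j generalizing l t with
  | zero =>
    induction ht using Submodule.span_induction with
    | zero => rw [map_zero]
    | add s t _ _ hs ht => rw [map_add, hs, ht, add_zero]
    | smul r t _ ht => rw [map_smul, ht, smul_zero]
    | mem t ht =>
      obtain ⟨c, w, rfl⟩ := ht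
      obtain ⟨l, rfl⟩ := Nat.exists_eq_succ_of_ne_zero h
      ext1 x
      rw [envPair_lcoeff_mul, pair_succ_coeff]
      exact zero_smul _ _
  | succ j ih =>
    induction ht using Submodule.span_induction with
    | zero => rw [map_zero]
    | add s t _ _ hs ht => rw [map_add, hs, ht, add_zero]
    | smul r t _ ht => rw [map_smul, ht, smul_zero]
    | mem t ht =>
      obtain ⟨s, hs, g, rfl⟩ := ht
      cases l with
      | zero => exact R.envPair_zero_mul_lgen S D s g
      | succ l =>
        ext1 x
        rw [envPair_mul_lgen, ih (by omega) hs]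
        rfl

/-- Right balanced maps become maps on `A ⊗_{A₀} X_j`. -/
theorem envPair_comp_balanced (j : ℕ) {φ : A →ₗ[k] DualEnv 𝒜} (hφ : RightBalanced φ) (c : 𝒜 0)
    (a : A) (x : R.X j) :
    (R.envPair S D j ∘ₗ φ) (a * c) x = (R.envPair S D j ∘ₗ φ) a (R.act j c x) := by
  rw [LinearMap.comp_apply, hφ, envPair_mul_lcoeff]
  rfl

/-- The pairing carries the left part of the Koszul differential to the transpose of the
differential of the resolution. -/
theorem envPair_leftDiff (j : ℕ) (φ : A →ₗ[k] DualEnv 𝒜) (a : A) (x : R.X (j + 1)) :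
    R.envPair S D (j + 1) (leftDiff D φ a) x =
      ∑ s, (R.envPair S D j ∘ₗ φ) (a * D.elt s) (R.contract S D j (D.covec s) x) := by
  rw [leftDiff_apply, map_sum, LinearMap.sum_apply]
  simp only [envPair_mul_lgen]
  rfl

/-- Lifting of balanced maps along the pairing, provided that it is bijective in degree `j`. -/
theorem exists_lift {i j : ℕ} (hinj : ∀ t ∈ leftDegree 𝒜 j, R.envPair S D j t = 0 → t = 0)
    (hsurj : ∀ f, ∃ t ∈ leftDegree 𝒜 j, R.envPair S D j t = f)
    (ψ : A →ₗ[k] R.X j →ₗ[k] (QuadraticDual 𝒜)ᵐᵒᵖ) (hψ : SupportedAt 𝒜 i ψ)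
    (hbal : ∀ (c : 𝒜 0) (a : A) (y : R.X j), ψ (a * c) y = ψ a (R.act j c y)) :
    ∃ φ : A →ₗ[k] DualEnv 𝒜, (∀ a, φ a ∈ leftDegree 𝒜 j) ∧ SupportedAt 𝒜 i φ ∧
      RightBalanced φ ∧ R.envPair S D j ∘ₗ φ = ψ := by
  let e : leftDegree 𝒜 j ≃ₗ[k] (R.X j →ₗ[k] (QuadraticDual 𝒜)ᵐᵒᵖ) :=
    LinearEquiv.ofBijective (R.envPair S D j ∘ₗ (leftDegree 𝒜 j).subtype) (by
      constructor
      · rw [injective_iff_map_eq_zero]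
        exact fun t ht => Subtype.ext (hinj t t.2 ht)
      · intro f
        obtain ⟨t, ht, rfl⟩ := hsurj f
        exact ⟨⟨t, ht⟩, rfl⟩)
  have he : ∀ f, R.envPair S D j (e.symm f : DualEnv 𝒜) = f := fun f => e.apply_symm_apply f
  refine ⟨(leftDegree 𝒜 j).subtype ∘ₗ e.symm.toLinearMap ∘ₗ ψ, fun a => (e.symm (ψ a)).2,
    fun l hl a ha => ?_, fun c a => ?_, ?_⟩
  · simp [hψ l hl a ha]
  · change (e.symm (ψ (a * c)) : DualEnv 𝒜) = (e.symm (ψ a) : DualEnv 𝒜) * lcoeff c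
    rw [← sub_eq_zero]
    apply hinj _ (sub_mem (e.symm _).2 (mul_lcoeff_mem (e.symm _).2 c))
    ext1 x
    rw [map_sub, LinearMap.sub_apply, envPair_mul_lcoeff, he, he, hbal, sub_self]
    rfl
  · ext1 a
    exact he _

theorem eq_zero_of_leftDegree_zero {t : DualEnv 𝒜} (ht : t ∈ leftDegree 𝒜 0)
    (h : R.envPair S D 0 t = 0) : t = 0 := by
  classical
  obtain ⟨w, rfl⟩ := exists_eq_sum_idem S ht
  refine Finset.sum_eq_zero fun v _ => ?_
  have h1 := LinearMap.congr_fun h (R.generator S v)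
  rw [map_sum, LinearMap.sum_apply, LinearMap.zero_apply] at h1
  simp only [envPair_lcoeff_mul, pair_zero_coeff, counit_act_generator, ite_smul, one_smul,
    zero_smul, Finset.sum_ite_eq', Finset.mem_univ, if_true] at h1
  rw [h1, map_zero, mul_zero]

theorem exists_leftDegree_zero (f : R.X 0 →ₗ[k] (QuadraticDual 𝒜)ᵐᵒᵖ) :
    ∃ t ∈ leftDegree 𝒜 0, R.envPair S D 0 t = f := by
  classical
  refine ⟨∑ v, lcoeff (S.idem v) * envR k _ (f (R.generator S v)),
    Submodule.sum_mem _ fun v _ => Submodule.subset_span ⟨_, _, rfl⟩, ?_⟩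
  have h : ∀ u, R.envPair S D 0 (∑ v, lcoeff (S.idem v) * envR k _ (f (R.generator S v)))
      (R.generator S u) = f (R.generator S u) := by
    intro u
    rw [map_sum, LinearMap.sum_apply]
    simp only [envPair_lcoeff_mul, pair_zero_coeff, counit_act_generator, ite_smul, one_smul,
      zero_smul, Finset.sum_ite_eq', Finset.mem_univ, if_true]
  ext1 x
  obtain ⟨r, rfl⟩ := R.exists_eq_sum_generator S x
  simp only [map_sum, map_smul] at h ⊢
  simp only [h]

include S in
/-- A balanced representative of an element of left degree `j + 1`: it is of the form
`∑ φ(a_s) (a_s^* ⊗ 1)`. An arbitrary family of coefficients is made balanced with the help of the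
idempotents. -/
theorem exists_balanced {j : ℕ} {t : DualEnv 𝒜} (ht : t ∈ leftDegree 𝒜 (j + 1)) :
    ∃ φ : A →ₗ[k] DualEnv 𝒜, (∀ a, φ a ∈ leftDegree 𝒜 j) ∧ SupportedAt 𝒜 1 φ ∧
      RightBalanced φ ∧ ∑ s, φ (D.elt s) * lgen (D.covec s) = t := by
  obtain ⟨τ, hτ, rfl⟩ := exists_eq_sum_lgen D ht
  let φ : A →ₗ[k] DualEnv 𝒜 := ∑ v, ∑ s, LinearMap.toSpanSingleton k _ (τ s * lcoeff (S.idem v)) ∘ₗ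
      (DegreeOneDual.toDual 𝒜 (D.covec s) ∘ₗ DegreeOne.rmul 𝒜 (S.idem v) ∘ₗ degreeOnePart 𝒜)
  have hφ : ∀ a, φ a = ∑ v, ∑ s, DegreeOneDual.toDual 𝒜 (D.covec s)
      (MulOpposite.op (S.idem v) • degreeOnePart 𝒜 a) • (τ s * lcoeff (S.idem v)) := by
    intro a
    simp only [φ, LinearMap.sum_apply, LinearMap.comp_apply, LinearMap.toSpanSingleton_apply]
    rfl
  refine ⟨φ, fun a => ?_, fun l hl a ha => ?_, fun c a => ?_, ?_⟩
  · rw [hφ]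
    exact Submodule.sum_mem _ fun v _ => Submodule.sum_mem _ fun s _ =>
      Submodule.smul_mem _ _ (mul_lcoeff_mem (hτ s) _)
  · have : degreeOnePart 𝒜 a = 0 := DegreeOne.val_injective (homPart_ne ha hl)
    rw [hφ, this]
    simp
  · rw [hφ, hφ, Finset.sum_mul]
    refine Finset.sum_congr rfl fun v _ => ?_
    rw [Finset.sum_mul]
    refine Finset.sum_congr rfl fun s _ => ?_
    obtain ⟨r, h1, h2⟩ := S.exists_algebraMap_mul_idem c v
    have h3 : MulOpposite.op (S.idem v) • degreeOnePart 𝒜 (a * c) =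
        r • MulOpposite.op (S.idem v) • degreeOnePart 𝒜 a := by
      apply DegreeOne.val_injective
      rw [degreeOnePart_mul, DegreeOne.val_op_smul, DegreeOne.val_op_smul, map_smul,
        DegreeOne.val_op_smul, mul_assoc]
      have h4 : (c : A) * S.idem v = algebraMap k A r * S.idem v := congrArg Subtype.val h1
      rw [h4, Algebra.smul_def, ← mul_assoc, ← mul_assoc, Algebra.commutes]
    rw [h3, map_smul, smul_mul_assoc, mul_assoc, ← lcoeff_mul, h2, lcoeff_algebraMap_mul,
      mul_smul_comm, smul_smul, smul_eq_mul, mul_comm]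
  · have h1 : ∀ v r, ∑ s, (DegreeOneDual.toDual 𝒜 (D.covec r)
        (MulOpposite.op (S.idem v) • degreeOnePart 𝒜 (D.elt s)) • (τ r * lcoeff (S.idem v))) *
          lgen (D.covec s) = τ r * lcoeff (S.idem v) * lgen (D.covec r) := by
      intro v r
      have h2 : ∀ s, degreeOnePart 𝒜 (D.elt s) = D.vec s := fun s =>
        DegreeOne.val_injective (homPart_same (D.elt_mem s))
      have h3 := congrArg (τ r * lcoeff (S.idem v) * lgen ·) (D.sum_covec (S.idem v • D.covec r))
      simp only [map_sum, map_smul, Finset.mul_sum, mul_smul_comm,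
        DegreeOneDual.toDual_smul] at h3
      simp only [h2, smul_mul_assoc, h3]
      rw [lgen_smul, mul_assoc, ← mul_assoc (lcoeff _), ← lcoeff_mul, S.idem_mul_self, mul_assoc]
    simp only [hφ, Finset.sum_mul]
    rw [Finset.sum_comm, Finset.sum_congr rfl fun v _ => Finset.sum_comm]
    simp only [h1]
    rw [Finset.sum_comm]
    refine Finset.sum_congr rfl fun s _ => ?_
    rw [← Finset.sum_mul, ← Finset.mul_sum]
    have h4 : ∑ v, lcoeff (S.idem v) = 1 := by
      rw [← lcoeff_one, ← S.sum_idem]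
      simp only [lcoeff, map_sum]
    rw [h4, mul_one]

omit [DirectSum.Decomposition 𝒜] in
theorem leftDiff_coe (φ : A →ₗ[k] DualEnv 𝒜) (c : 𝒜 0) :
    leftDiff D φ c = (∑ s, φ (D.elt s) * lgen (D.covec s)) * lcoeff c := by
  let β : DegreeOne 𝒜 →ₗ[k] DegreeOneDual 𝒜 →ₗ[k] DualEnv 𝒜 :=
    ((LinearMap.mul k (DualEnv 𝒜)).compl₂ lgen) ∘ₗ φ ∘ₗ DegreeOne.val 𝒜
  have h := D.transpose β (DegreeOne.lmul 𝒜 c) (fun g => MulOpposite.op c • g) (fun g x => rfl)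
  have hβ : ∀ a g, β a g = φ (DegreeOne.val 𝒜 a) * lgen g := fun a g => rfl
  simp only [hβ, lgen_op_smul, ← mul_assoc] at h
  rw [leftDiff_apply, Finset.sum_mul]
  exact h

/-- The pairing identifies the part of left degree `j` of the enveloping algebra of the quadratic
dual with the linear maps on the generators of the `j`-th term of the resolution. This is shown by
induction on `j`: the elements of left degree `j + 1` are classes of balanced maps from `A₁` to left
degree `j`, modulo the coboundaries of maps from `A₂` to left degree `j - 1`, and the exactness of
the Koszul complex describes these in terms of the resolution. -/
theorem envPair_bijective [Module.Finite k A] (j : ℕ) :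
    (∀ t ∈ leftDegree 𝒜 j, R.envPair S D j t = 0 → t = 0) ∧
      ∀ f, ∃ t ∈ leftDegree 𝒜 j, R.envPair S D j t = f := by
  induction j using Nat.strong_induction_on with
  | _ j ih =>
  cases j with
  | zero => exact ⟨fun t => R.eq_zero_of_leftDegree_zero S D, R.exists_leftDegree_zero S D⟩
  | succ j =>
  obtain ⟨hinj, hsurj⟩ := ih j (Nat.lt_succ_self j)
  constructor
  · intro t ht h0
    obtain ⟨φ, hmem, hsupp, hbal, rfl⟩ := exists_balanced S D ht
    have hcyc : ∀ a x, ∑ s, (R.envPair S D j ∘ₗ φ) (a * D.elt s)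
        (R.contract S D j (D.covec s) x) = 0 := by
      intro a x
      rw [← envPair_leftDiff]
      induction a using homogeneous_induction 𝒜 with
      | hadd a b ha hb => rw [map_add, map_add, LinearMap.add_apply, ha, hb, add_zero]
      | h l a ha =>
        by_cases hl : l = 0
        · subst hl
          have := leftDiff_coe D φ ⟨a, ha⟩
          rw [this, envPair_mul_lcoeff, h0]
          rfl
        · have : leftDiff D φ a = 0 := by
            rw [leftDiff_apply]
            refine Finset.sum_eq_zero fun s _ => ?_
            rw [hsupp (l + 1) (by omega) _ (SetLike.mul_mem_graded ha (D.elt_mem s)), zero_mul]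
          rw [this, map_zero]
          rfl
    have hsupp' : ∀ l, l ≠ 1 → ∀ a ∈ 𝒜 l, (R.envPair S D j ∘ₗ φ) a = 0 := fun l hl a ha => by
      rw [LinearMap.comp_apply, hsupp l hl a ha, map_zero]
    -- In terms of the resolution, `φ` is a cocycle and hence a coboundary; the relations of the
    -- quadratic dual turn coboundaries into zero.
    cases j with
    | zero =>
      have h1 := R.cocycle_eq_zero S D Nat.one_pos (R.envPair S D 0 ∘ₗ φ) hsupp'
        (R.envPair_comp_balanced S D 0 hbal) hcyc
      refine Finset.sum_eq_zero fun s _ => ?_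
      rw [hinj (φ (D.elt s)) (hmem _) (LinearMap.congr_fun h1 _), zero_mul]
    | succ j =>
      obtain ⟨ψ, hψ1, hψ2, hψ3⟩ := R.exists_coboundary S D (R.envPair S D (j + 1) ∘ₗ φ) hsupp'
        (R.envPair_comp_balanced S D (j + 1) hbal) hcyc
      obtain ⟨hinj', hsurj'⟩ := ih j (by omega)
      obtain ⟨χ, hχ1, hχ2, hχ3, rfl⟩ := R.exists_lift S D hinj' hsurj' ψ hψ1 hψ2
      have h2 : φ = leftDiff D χ := by
        ext1 a
        rw [← sub_eq_zero]
        refine hinj _ (sub_mem (hmem a) ?_) ?_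
        · rw [leftDiff_apply]
          exact Submodule.sum_mem _ fun s _ => mul_lgen_mem (hχ1 _) _
        · ext1 x
          rw [map_sub, LinearMap.sub_apply, envPair_leftDiff, hψ3]
          exact sub_self _
      have h3 := LinearMap.congr_fun (leftDiff_leftDiff D χ) 1
      rw [leftDiff_apply, ← h2] at h3
      simp only [one_mul] at h3
      exact h3
  -- A functional on `A₀ ⊗ X_{j+1}` is a coboundary, as there is nothing below degree zero in `A`.
  · intro f
    obtain ⟨F, hF⟩ := LinearMap.exists_extend f
    obtain ⟨ψ, -, -, hψ⟩ := R.exists_coboundary S D (i := 0) (R.ofFunctional 0 (j + 1) F)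
      (R.ofFunctional_supportedAt 0 _ F) (R.ofFunctional_balanced 0 _ F) (fun a x =>
        Finset.sum_eq_zero fun s _ => by
          rw [ofFunctional_apply, homPart_mul_right_of_lt 𝒜 Nat.one_pos (D.elt_mem s), zero_smul,
            map_zero])
    choose τ hτ1 hτ2 using hsurj
    refine ⟨∑ s, τ (ψ (D.elt s)) * lgen (D.covec s),
      Submodule.sum_mem _ fun s _ => mul_lgen_mem (hτ1 _) _, ?_⟩
    ext1 x
    have h := hψ 1 x
    rw [ofFunctional_apply, homPart_same (SetLike.one_mem_graded 𝒜), one_smul] at h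
    simp only [one_mul] at h
    rw [map_sum, LinearMap.sum_apply]
    simp only [envPair_mul_lgen, hτ2]
    rw [h, ← hF]
    rfl

end LinearResolution

/-! ### The Koszul bimodule complex -/

section Terms

variable {k : Type u} [Field k] {A : Type v} [Ring A] [Algebra k A]
  {𝒜 : ℕ → Submodule k A} [SetLike.GradedMonoid 𝒜] {V : Type*} [Fintype V] (S : SplitGrading 𝒜 V)
  {ι : Type*} [Fintype ι] (D : DualFamily 𝒜 ι)

/-- The right part `φ ↦ (x ↦ ∑ φ(a_s x) (1 ⊗ a_s^*))` of the Koszul differential. -/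
noncomputable def rightDiff :
    (A →ₗ[k] DualEnv 𝒜) →ₗ[DualEnv 𝒜] (A →ₗ[k] DualEnv 𝒜) where
  toFun φ := ∑ s, LinearMap.mulRight k (rgen (D.covec s)) ∘ₗ φ ∘ₗ LinearMap.mulLeft k (D.elt s)
  map_add' φ ψ := by
    simp only [LinearMap.add_comp, LinearMap.comp_add, Finset.sum_add_distrib]
  map_smul' t φ := by
    ext a
    simp [Finset.mul_sum, mul_assoc]

theorem rightDiff_apply (φ : A →ₗ[k] DualEnv 𝒜) (a : A) :
    rightDiff D φ a = ∑ s, φ (D.elt s * a) * rgen (D.covec s) := by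
  simp [rightDiff]

theorem rightDiff_rightDiff [Module.Finite k A] (φ : A →ₗ[k] DualEnv 𝒜) :
    rightDiff D (rightDiff D φ) = 0 := by
  ext1 a
  simp only [rightDiff_apply, Finset.sum_mul]
  let β : DualEnv 𝒜 →ₗ[k] QuadraticDual 𝒜 →ₗ[k] DualEnv 𝒜 :=
    (LinearMap.mul k (DualEnv 𝒜)).compl₂ ((envR k (QuadraticDual 𝒜)).toLinearMap ∘ₗ
      (MulOpposite.opLinearEquiv k).toLinearMap)
  have h := QuadraticDual.relation_apply D (φ ∘ₗ LinearMap.mulRight k a) β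
  have hβ : ∀ t b, β t b = t * envR k _ (MulOpposite.op b) := fun t b => rfl
  simp only [hβ, map_mul, MulOpposite.op_mul] at h
  rw [Finset.sum_comm]
  refine Eq.trans ?_ h
  refine Finset.sum_congr rfl fun s _ => Finset.sum_congr rfl fun t _ => ?_
  rw [LinearMap.comp_apply, LinearMap.mulRight_apply, mul_assoc, ← mul_assoc (D.elt s)]
  rfl

theorem leftDiff_rightDiff (φ : A →ₗ[k] DualEnv 𝒜) :
    leftDiff D (rightDiff D φ) = rightDiff D (leftDiff D φ) := by
  ext1 a
  simp only [leftDiff_apply, rightDiff_apply, Finset.sum_mul]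
  rw [Finset.sum_comm]
  refine Finset.sum_congr rfl fun s _ => Finset.sum_congr rfl fun t _ => ?_
  rw [mul_assoc, mul_assoc, lgen_comm_rgen, mul_assoc]

theorem LeftBalanced.leftDiff {φ : A →ₗ[k] DualEnv 𝒜} (hφ : LeftBalanced φ) :
    LeftBalanced (leftDiff D φ) := by
  intro c a
  rw [leftDiff_apply, leftDiff_apply, Finset.sum_mul]
  refine Finset.sum_congr rfl fun s _ => ?_
  rw [mul_assoc, hφ, mul_assoc, mul_assoc, lgen_comm_rcoeff]

theorem rightBalanced_leftDiff (φ : A →ₗ[k] DualEnv 𝒜) : RightBalanced (leftDiff D φ) := by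
  intro c a
  let β : DegreeOne 𝒜 →ₗ[k] DegreeOneDual 𝒜 →ₗ[k] DualEnv 𝒜 :=
    ((LinearMap.mul k (DualEnv 𝒜)).compl₂ lgen) ∘ₗ φ ∘ₗ LinearMap.mulLeft k a ∘ₗ DegreeOne.val 𝒜
  have h := D.transpose β (DegreeOne.lmul 𝒜 c) (fun g => MulOpposite.op c • g) (fun g x => rfl)
  have hβ : ∀ x g, β x g = φ (a * DegreeOne.val 𝒜 x) * lgen g := fun a g => rfl
  simp only [hβ, lgen_op_smul, ← mul_assoc] at h
  rw [leftDiff_apply, leftDiff_apply, Finset.sum_mul]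
  refine Eq.trans (Finset.sum_congr rfl fun s _ => ?_) h
  rw [mul_assoc]
  rfl

theorem RightBalanced.rightDiff {φ : A →ₗ[k] DualEnv 𝒜} (hφ : RightBalanced φ) :
    RightBalanced (rightDiff D φ) := by
  intro c a
  rw [rightDiff_apply, rightDiff_apply, Finset.sum_mul]
  refine Finset.sum_congr rfl fun s _ => ?_
  rw [← mul_assoc, hφ, mul_assoc, mul_assoc, lcoeff_comm_rgen]

theorem leftBalanced_rightDiff (φ : A →ₗ[k] DualEnv 𝒜) : LeftBalanced (rightDiff D φ) := by
  intro c a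
  let β : DegreeOne 𝒜 →ₗ[k] DegreeOneDual 𝒜 →ₗ[k] DualEnv 𝒜 :=
    ((LinearMap.mul k (DualEnv 𝒜)).compl₂ rgen) ∘ₗ φ ∘ₗ LinearMap.mulRight k a ∘ₗ DegreeOne.val 𝒜
  have h := D.transpose β (DegreeOne.rmul 𝒜 c) (fun g => c • g) (fun g x => rfl)
  have hβ : ∀ x g, β x g = φ (DegreeOne.val 𝒜 x * a) * rgen g := fun a g => rfl
  simp only [hβ, rgen_smul, ← mul_assoc] at h
  rw [rightDiff_apply, rightDiff_apply, Finset.sum_mul]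
  refine Eq.trans (Finset.sum_congr rfl fun s _ => ?_) h
  rw [← mul_assoc]
  rfl

theorem SupportedAt.leftDiff {i : ℕ} {φ : A →ₗ[k] DualEnv 𝒜} (hφ : SupportedAt 𝒜 (i + 1) φ) :
    SupportedAt 𝒜 i (leftDiff D φ) := by
  intro l hl a ha
  rw [leftDiff_apply]
  refine Finset.sum_eq_zero fun s _ => ?_
  rw [hφ (l + 1) (by omega) _ (SetLike.mul_mem_graded ha (D.elt_mem s)), zero_mul]

theorem SupportedAt.rightDiff {i : ℕ} {φ : A →ₗ[k] DualEnv 𝒜} (hφ : SupportedAt 𝒜 (i + 1) φ) :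
    SupportedAt 𝒜 i (rightDiff D φ) := by
  intro l hl a ha
  rw [rightDiff_apply]
  refine Finset.sum_eq_zero fun s _ => ?_
  rw [hφ (1 + l) (by omega) _ (SetLike.mul_mem_graded (D.elt_mem s) ha), zero_mul]

theorem SupportedAt.leftDiff_eq_zero [DirectSum.Decomposition 𝒜] {φ : A →ₗ[k] DualEnv 𝒜}
    (hφ : SupportedAt 𝒜 0 φ) : _root_.leftDiff D φ = 0 := by
  ext1 a
  induction a using homogeneous_induction 𝒜 with
  | hadd a b ha hb => rw [map_add, ha, hb, map_add]
  | h l a ha =>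
    rw [leftDiff_apply]
    refine Finset.sum_eq_zero fun s _ => ?_
    rw [hφ (l + 1) (by omega) _ (SetLike.mul_mem_graded ha (D.elt_mem s)), zero_mul]

variable (𝒜) in
/-- The term `B ⊗ (A_i)^∨ ⊗ B` (with tensor products over the degree zero component) of the Koszul
bimodule resolution of the quadratic dual `B`, as the module of balanced maps from `A` to `B ⊗ Bᵐᵒᵖ`
with support in degree `i`. -/
def koszulTerm (i : ℕ) : Submodule (DualEnv 𝒜) (A →ₗ[k] DualEnv 𝒜) where
  carrier := {φ | SupportedAt 𝒜 i φ ∧ RightBalanced φ ∧ LeftBalanced φ}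
  zero_mem' := ⟨fun _ _ _ _ => rfl, fun _ _ => (zero_mul _).symm, fun _ _ => (zero_mul _).symm⟩
  add_mem' {φ ψ} hφ hψ := ⟨fun l hl a ha => by
      rw [LinearMap.add_apply, hφ.1 l hl a ha, hψ.1 l hl a ha, add_zero],
    fun c a => by rw [LinearMap.add_apply, LinearMap.add_apply, hφ.2.1, hψ.2.1, add_mul],
    fun c a => by rw [LinearMap.add_apply, LinearMap.add_apply, hφ.2.2, hψ.2.2, add_mul]⟩
  smul_mem' t φ hφ := ⟨fun l hl a ha => by
      rw [LinearMap.smul_apply, hφ.1 l hl a ha, smul_zero],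
    fun c a => by rw [LinearMap.smul_apply, LinearMap.smul_apply, hφ.2.1, smul_mul_assoc],
    fun c a => by rw [LinearMap.smul_apply, LinearMap.smul_apply, hφ.2.2, smul_mul_assoc]⟩

noncomputable instance (i : ℕ) : AddCommGroup (koszulTerm 𝒜 i) :=
  Submodule.addCommGroup (R := DualEnv 𝒜) (M := A →ₗ[k] DualEnv 𝒜) (koszulTerm 𝒜 i)

/-- The Koszul differential, on maps that need not be balanced. -/
noncomputable def koszulMap (i : ℕ) :
    (A →ₗ[k] DualEnv 𝒜) →ₗ[DualEnv 𝒜] (A →ₗ[k] DualEnv 𝒜) :=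
  leftDiff D + (-1 : k) ^ (i + 1) • rightDiff D

theorem koszulMap_apply (i : ℕ) (φ : A →ₗ[k] DualEnv 𝒜) (a : A) :
    koszulMap D i φ a = leftDiff D φ a + (-1 : k) ^ (i + 1) • rightDiff D φ a := rfl

theorem koszulMap_mem (i : ℕ) {φ : A →ₗ[k] DualEnv 𝒜} (hφ : φ ∈ koszulTerm 𝒜 (i + 1)) :
    koszulMap D i φ ∈ koszulTerm 𝒜 i := by
  have h1 : leftDiff D φ ∈ koszulTerm 𝒜 i :=
    ⟨hφ.1.leftDiff D, rightBalanced_leftDiff D φ, hφ.2.2.leftDiff D⟩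
  have h2 : rightDiff D φ ∈ koszulTerm 𝒜 i :=
    ⟨hφ.1.rightDiff D, hφ.2.1.rightDiff D, leftBalanced_rightDiff D φ⟩
  rw [show koszulMap D i φ = leftDiff D φ + (-1 : k) ^ (i + 1) • rightDiff D φ from rfl]
  exact add_mem h1 ((koszulTerm 𝒜 i).smul_of_tower_mem _ h2)

theorem koszulMap_koszulMap [Module.Finite k A] (i : ℕ) (φ : A →ₗ[k] DualEnv 𝒜) :
    koszulMap D i (koszulMap D (i + 1) φ) = 0 := by
  have h : koszulMap D (i + 1) φ = leftDiff D φ + (-1 : k) ^ (i + 1 + 1) • rightDiff D φ := rfl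
  have h' : ∀ χ, koszulMap D i χ = leftDiff D χ + (-1 : k) ^ (i + 1) • rightDiff D χ := fun _ => rfl
  rw [h, h', map_add, map_add, LinearMap.map_smul_of_tower, LinearMap.map_smul_of_tower,
    leftDiff_leftDiff, rightDiff_rightDiff, leftDiff_rightDiff, smul_zero, zero_add, add_zero,
    ← add_smul, pow_succ _ (i + 1)]
  simp

/-- The differential of the Koszul bimodule complex. -/
noncomputable def koszulD (i : ℕ) :
    koszulTerm 𝒜 (i + 1) →ₗ[DualEnv 𝒜] koszulTerm 𝒜 i :=
  (koszulMap D i).restrict fun _ hφ => koszulMap_mem D i hφ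

theorem coe_koszulD (i : ℕ) (φ : koszulTerm 𝒜 (i + 1)) :
    (koszulD D i φ : A →ₗ[k] DualEnv 𝒜) = koszulMap D i φ := rfl

attribute [local instance] instModuleTensorProductMop

variable (𝒜) in
/-- The augmentation `φ ↦ φ(1) • 1` of the Koszul bimodule complex. -/
noncomputable def koszulε : koszulTerm 𝒜 0 →ₗ[DualEnv 𝒜] QuadraticDual 𝒜 :=
  LinearMap.toSpanSingleton (DualEnv 𝒜) (QuadraticDual 𝒜) 1 ∘ₗ
    LinearMap.applyₗ' (DualEnv 𝒜) (1 : A) ∘ₗ (koszulTerm 𝒜 0).subtype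

theorem koszulε_apply (φ : koszulTerm 𝒜 0) :
    koszulε 𝒜 φ = (φ : A →ₗ[k] DualEnv 𝒜) 1 • (1 : QuadraticDual 𝒜) := rfl

theorem lgen_smul_one (g : DegreeOneDual 𝒜) :
    lgen g • (1 : QuadraticDual 𝒜) = QuadraticDual.gen g := by
  change (QuadraticDual.gen g ⊗ₜ[k] (1 : (QuadraticDual 𝒜)ᵐᵒᵖ)) • (1 : QuadraticDual 𝒜) = _
  rw [TensorProduct.Algebra.smul_def, one_smul, smul_eq_mul, mul_one]

theorem rgen_smul_one (g : DegreeOneDual 𝒜) :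
    rgen g • (1 : QuadraticDual 𝒜) = QuadraticDual.gen g := by
  change ((1 : QuadraticDual 𝒜) ⊗ₜ[k] MulOpposite.op (QuadraticDual.gen g)) •
    (1 : QuadraticDual 𝒜) = _
  rw [TensorProduct.Algebra.smul_def, one_smul, MulOpposite.smul_eq_mul_unop, one_mul,
    MulOpposite.unop_op]

theorem smul_smul_one (r : k) (t : DualEnv 𝒜) :
    (r • t) • (1 : QuadraticDual 𝒜) = r • t • (1 : QuadraticDual 𝒜) := by
  have h : r • t = envL k _ (algebraMap k _ r) * t := by
    rw [AlgHom.commutes]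
    exact Algebra.smul_def r t
  rw [h, mul_smul]
  change (algebraMap k (QuadraticDual 𝒜) r ⊗ₜ[k] (1 : (QuadraticDual 𝒜)ᵐᵒᵖ)) • _ = _
  rw [TensorProduct.Algebra.smul_def, one_smul, smul_eq_mul]
  exact (Algebra.smul_def r _).symm

theorem koszulε_koszulD (φ : koszulTerm 𝒜 1) : koszulε 𝒜 (koszulD D 0 φ) = 0 := by
  rw [koszulε_apply, coe_koszulD, koszulMap_apply, leftDiff_apply, rightDiff_apply, add_smul,
    smul_smul_one]
  simp only [one_mul, mul_one, Finset.sum_smul, mul_smul, lgen_smul_one, zero_add,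
    pow_one, neg_smul, one_smul, rgen_smul_one, add_neg_cancel]

end Terms

section LeftFiltration

variable {k : Type u} [Field k] {A : Type v} [Ring A] [Algebra k A]
  {𝒜 : ℕ → Submodule k A} [SetLike.GradedMonoid 𝒜]

variable (𝒜) in
/-- The elements of left degree less than `m`. -/
noncomputable def leftFiltration : ℕ → Submodule k (DualEnv 𝒜)
  | 0 => ⊥
  | m + 1 => leftFiltration m ⊔ leftDegree 𝒜 m

theorem leftFiltration_mono : Monotone (leftFiltration 𝒜) :=
  monotone_nat_of_le_succ fun _ => le_sup_left

theorem leftDegree_le (m : ℕ) : leftDegree 𝒜 m ≤ leftFiltration 𝒜 (m + 1) := le_sup_right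

theorem mul_rgen_mem_leftFiltration {m : ℕ} {t : DualEnv 𝒜} (ht : t ∈ leftFiltration 𝒜 m)
    (g : DegreeOneDual 𝒜) : t * rgen g ∈ leftFiltration 𝒜 m := by
  induction m generalizing t with
  | zero => rw [(Submodule.mem_bot k).mp ht, zero_mul]; exact zero_mem _
  | succ m ih =>
    obtain ⟨s, hs, t, ht', rfl⟩ := Submodule.mem_sup.mp ht
    rw [add_mul]
    exact add_mem (leftFiltration_mono (Nat.le_succ m) (ih hs))
      (leftDegree_le m (mul_rgen_mem ht' g))

theorem mul_rcoeff_mem_leftFiltration {m : ℕ} {t : DualEnv 𝒜} (ht : t ∈ leftFiltration 𝒜 m)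
    (c : 𝒜 0) : t * rcoeff c ∈ leftFiltration 𝒜 m := by
  induction m generalizing t with
  | zero => rw [(Submodule.mem_bot k).mp ht, zero_mul]; exact zero_mem _
  | succ m ih =>
    obtain ⟨s, hs, t, ht', rfl⟩ := Submodule.mem_sup.mp ht
    rw [add_mul]
    exact add_mem (leftFiltration_mono (Nat.le_succ m) (ih hs))
      (leftDegree_le m (mul_envR_mem ht' _))

theorem exists_mem_leftFiltration (t : DualEnv 𝒜) : ∃ m, t ∈ leftFiltration 𝒜 m := by
  have ht : t ∈ ⨆ j, leftDegree 𝒜 j := by rw [iSup_leftDegree]; exact Submodule.mem_top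
  induction ht using Submodule.iSup_induction' with
  | mem j t ht => exact ⟨j + 1, leftDegree_le j ht⟩
  | zero => exact ⟨0, zero_mem _⟩
  | add s t _ _ hs ht =>
    obtain ⟨m, hm⟩ := hs
    obtain ⟨m', hm'⟩ := ht
    exact ⟨max m m', add_mem (leftFiltration_mono (le_max_left m m') hm)
      (leftFiltration_mono (le_max_right m m') hm')⟩

theorem exists_forall_mem_leftFiltration [Module.Finite k A] (φ : A →ₗ[k] DualEnv 𝒜) :
    ∃ m, ∀ a, φ a ∈ leftFiltration 𝒜 m := by
  let b := Module.finBasis k A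
  choose m hm using fun s => exists_mem_leftFiltration (φ (b s))
  refine ⟨Finset.univ.sup m, fun a => ?_⟩
  rw [← b.sum_repr a, map_sum]
  refine Submodule.sum_mem _ fun s _ => ?_
  rw [map_smul]
  exact Submodule.smul_mem _ _ (leftFiltration_mono (Finset.le_sup (Finset.mem_univ s)) (hm s))

end LeftFiltration

section Symmetrize

variable {k : Type u} [Field k] {A : Type v} [Ring A] [Algebra k A]
  {𝒜 : ℕ → Submodule k A} [SetLike.GradedMonoid 𝒜] {V : Type*} [Fintype V] (S : SplitGrading 𝒜 V)
  {ι : Type*} [Fintype ι] (D : DualFamily 𝒜 ι)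

/-- The projection `φ ↦ (a ↦ ∑ φ(e_v a) (1 ⊗ e_v))` to the maps that are left balanced. -/
noncomputable def balanceLeft :
    (A →ₗ[k] DualEnv 𝒜) →ₗ[DualEnv 𝒜] (A →ₗ[k] DualEnv 𝒜) where
  toFun φ := ∑ v, LinearMap.mulRight k (rcoeff (S.idem v)) ∘ₗ φ ∘ₗ
    LinearMap.mulLeft k (S.idem v : A)
  map_add' φ ψ := by
    simp only [LinearMap.add_comp, LinearMap.comp_add, Finset.sum_add_distrib]
  map_smul' t φ := by
    ext a
    simp [Finset.mul_sum, mul_assoc]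

theorem balanceLeft_apply (φ : A →ₗ[k] DualEnv 𝒜) (a : A) :
    balanceLeft S φ a = ∑ v, φ (S.idem v * a) * rcoeff (S.idem v) := by
  simp [balanceLeft]

theorem leftBalanced_balanceLeft (φ : A →ₗ[k] DualEnv 𝒜) : LeftBalanced (balanceLeft S φ) := by
  intro c a
  rw [balanceLeft_apply, balanceLeft_apply, Finset.sum_mul]
  refine Finset.sum_congr rfl fun v _ => ?_
  obtain ⟨r, h1, h2⟩ := S.exists_algebraMap_mul_idem c v
  have h3 : (S.idem v : A) * c = r • (S.idem v : A) := by
    rw [Algebra.smul_def]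
    exact congrArg Subtype.val h2
  rw [← mul_assoc, h3, smul_mul_assoc, map_smul, mul_assoc, ← rcoeff_mul, h1,
    rcoeff_algebraMap_mul, smul_mul_assoc, mul_smul_comm]

theorem RightBalanced.balanceLeft {φ : A →ₗ[k] DualEnv 𝒜} (hφ : RightBalanced φ) :
    RightBalanced (balanceLeft S φ) := by
  intro c a
  rw [balanceLeft_apply, balanceLeft_apply, Finset.sum_mul]
  refine Finset.sum_congr rfl fun v _ => ?_
  rw [← mul_assoc, hφ, mul_assoc, mul_assoc, lcoeff_comm_rcoeff]

theorem SupportedAt.balanceLeft {i : ℕ} {φ : A →ₗ[k] DualEnv 𝒜} (hφ : SupportedAt 𝒜 i φ) :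
    SupportedAt 𝒜 i (balanceLeft S φ) := by
  intro l hl a ha
  rw [balanceLeft_apply]
  refine Finset.sum_eq_zero fun v _ => ?_
  rw [hφ (0 + l) (by omega) _ (SetLike.mul_mem_graded (S.idem v).2 ha), zero_mul]

theorem LeftBalanced.balanceLeft_eq {φ : A →ₗ[k] DualEnv 𝒜} (hφ : LeftBalanced φ) :
    balanceLeft S φ = φ := by
  ext1 a
  rw [balanceLeft_apply]
  simp only [hφ _ a, mul_assoc, ← rcoeff_mul, S.idem_mul_self]
  simp only [← hφ _ a]
  rw [← map_sum, ← Finset.sum_mul, S.coe_sum_idem, one_mul]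

theorem leftDiff_balanceLeft (φ : A →ₗ[k] DualEnv 𝒜) :
    leftDiff D (balanceLeft S φ) = balanceLeft S (leftDiff D φ) := by
  ext1 a
  simp only [leftDiff_apply, balanceLeft_apply, Finset.sum_mul]
  rw [Finset.sum_comm]
  refine Finset.sum_congr rfl fun s _ => Finset.sum_congr rfl fun t _ => ?_
  rw [mul_assoc, mul_assoc, lgen_comm_rcoeff, mul_assoc]

/-- The projection `φ ↦ (a ↦ ∑ φ(a e_v) (e_v ⊗ 1))` to the maps that are right balanced. -/
noncomputable def balanceRight :
    (A →ₗ[k] DualEnv 𝒜) →ₗ[DualEnv 𝒜] (A →ₗ[k] DualEnv 𝒜) where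
  toFun φ := ∑ v, LinearMap.mulRight k (lcoeff (S.idem v)) ∘ₗ φ ∘ₗ
    LinearMap.mulRight k (S.idem v : A)
  map_add' φ ψ := by
    simp only [LinearMap.add_comp, LinearMap.comp_add, Finset.sum_add_distrib]
  map_smul' t φ := by
    ext a
    simp [Finset.mul_sum, mul_assoc]

theorem balanceRight_apply (φ : A →ₗ[k] DualEnv 𝒜) (a : A) :
    balanceRight S φ a = ∑ v, φ (a * S.idem v) * lcoeff (S.idem v) := by
  simp [balanceRight]

theorem rightBalanced_balanceRight (φ : A →ₗ[k] DualEnv 𝒜) : RightBalanced (balanceRight S φ) := by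
  intro c a
  rw [balanceRight_apply, balanceRight_apply, Finset.sum_mul]
  refine Finset.sum_congr rfl fun v _ => ?_
  obtain ⟨r, h1, h2⟩ := S.exists_algebraMap_mul_idem c v
  have h3 : (c : A) * S.idem v = r • (S.idem v : A) := by
    rw [Algebra.smul_def]
    exact congrArg Subtype.val h1
  rw [mul_assoc, h3, mul_smul_comm, map_smul, mul_assoc, ← lcoeff_mul, h2,
    lcoeff_algebraMap_mul, smul_mul_assoc, mul_smul_comm]

theorem SupportedAt.balanceRight {i : ℕ} {φ : A →ₗ[k] DualEnv 𝒜} (hφ : SupportedAt 𝒜 i φ) :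
    SupportedAt 𝒜 i (balanceRight S φ) := by
  intro l hl a ha
  rw [balanceRight_apply]
  refine Finset.sum_eq_zero fun v _ => ?_
  rw [hφ (l + 0) (by omega) _ (SetLike.mul_mem_graded ha (S.idem v).2), zero_mul]

theorem RightBalanced.balanceRight_eq {φ : A →ₗ[k] DualEnv 𝒜} (hφ : RightBalanced φ) :
    balanceRight S φ = φ := by
  ext1 a
  rw [balanceRight_apply]
  simp only [hφ _ a, mul_assoc, ← lcoeff_mul, S.idem_mul_self]
  simp only [← hφ _ a]
  rw [← map_sum, ← Finset.mul_sum, S.coe_sum_idem, mul_one]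

variable [DirectSum.Decomposition 𝒜]

/-- The projection of the space of all linear maps to the `i`-th term of the Koszul bimodule
complex. -/
noncomputable def koszulProj (i : ℕ) : (A →ₗ[k] DualEnv 𝒜) →ₗ[DualEnv 𝒜] koszulTerm 𝒜 i :=
  (balanceLeft S ∘ₗ balanceRight S ∘ₗ LinearMap.lcomp (DualEnv 𝒜) _ (homPart 𝒜 i)).codRestrict _
    fun φ => by
      have h1 : SupportedAt 𝒜 i (φ ∘ₗ homPart 𝒜 i) := fun l hl a ha => by
        rw [LinearMap.comp_apply, homPart_ne ha hl, map_zero]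
      exact ⟨(h1.balanceRight S).balanceLeft S, (rightBalanced_balanceRight S _).balanceLeft S,
        leftBalanced_balanceLeft S _⟩

theorem koszulProj_apply (i : ℕ) (φ : A →ₗ[k] DualEnv 𝒜) (a : A) :
    (koszulProj S i φ : A →ₗ[k] DualEnv 𝒜) a =
      ∑ u, ∑ v, φ (homPart 𝒜 i (S.idem u * a * S.idem v)) * lcoeff (S.idem v) *
        rcoeff (S.idem u) := by
  change balanceLeft S (balanceRight S (φ ∘ₗ homPart 𝒜 i)) a = _
  rw [balanceLeft_apply]
  refine Finset.sum_congr rfl fun u _ => ?_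
  rw [balanceRight_apply, Finset.sum_mul]
  rfl

omit [SetLike.GradedMonoid 𝒜] in
theorem SupportedAt.comp_homPart {W : Type*} [AddCommGroup W] [Module k W] {i : ℕ}
    {φ : A →ₗ[k] W} (hφ : SupportedAt 𝒜 i φ) (a : A) : φ (homPart 𝒜 i a) = φ a := by
  induction a using homogeneous_induction 𝒜 with
  | hadd a b ha hb => rw [map_add, map_add, ha, hb, map_add]
  | h l a ha =>
    by_cases h : l = i
    · subst h; rw [homPart_same ha]
    · rw [homPart_ne ha h, hφ l h a ha, map_zero]

theorem koszulProj_coe (i : ℕ) (φ : koszulTerm 𝒜 i) : koszulProj S i φ = φ := by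
  apply Subtype.ext
  change balanceLeft S (balanceRight S ((φ : A →ₗ[k] DualEnv 𝒜) ∘ₗ homPart 𝒜 i)) = φ
  have h : (φ : A →ₗ[k] DualEnv 𝒜) ∘ₗ homPart 𝒜 i = φ := by
    ext1 a
    exact φ.2.1.comp_homPart a
  rw [h, φ.2.2.1.balanceRight_eq, φ.2.2.2.balanceLeft_eq]

include S in
/-- The terms of the Koszul bimodule complex are direct summands of the free module of all linear
maps from `A` to the enveloping algebra. -/
theorem projective_koszulTerm [Module.Finite k A] (i : ℕ) :
    Module.Projective (DualEnv 𝒜) (koszulTerm 𝒜 i) := by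
  let b := Module.finBasis k A
  have : Module.Projective (DualEnv 𝒜) (A →ₗ[k] DualEnv 𝒜) :=
    Module.Projective.of_equiv (b.constr (DualEnv 𝒜) (M' := DualEnv 𝒜))
  exact Module.Projective.of_split (koszulTerm 𝒜 i).subtype (koszulProj S i)
    (LinearMap.ext fun φ => koszulProj_coe S i φ)

end Symmetrize

/-! ### Exactness of the Koszul bimodule complex -/

namespace LinearResolution

variable {k : Type u} [Field k] {A : Type v} [Ring A] [Algebra k A]
  {𝒜 : ℕ → Submodule k A} [SetLike.GradedMonoid 𝒜] [DirectSum.Decomposition 𝒜]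
  (R : LinearResolution 𝒜) {V : Type*} [Fintype V] (S : SplitGrading 𝒜 V)
  {ι : Type*} [Fintype ι] (D : DualFamily 𝒜 ι)

theorem envPair_eq_zero_of_mem_leftFiltration {m l : ℕ} (h : m ≤ l) {t : DualEnv 𝒜}
    (ht : t ∈ leftFiltration 𝒜 m) : R.envPair S D l t = 0 := by
  induction m generalizing t with
  | zero => rw [(Submodule.mem_bot k).mp ht, map_zero]
  | succ m ih =>
    obtain ⟨s, hs, t, ht', rfl⟩ := Submodule.mem_sup.mp ht
    rw [map_add, ih (by omega) hs, R.envPair_eq_zero S D (by omega) ht', add_zero]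

variable [Module.Finite k A]

include R S D in
/-- The pairing in degree `m` detects the leading part of an element of left degree at most `m`. -/
theorem mem_leftFiltration_of_envPair_eq_zero {m : ℕ} {t : DualEnv 𝒜}
    (ht : t ∈ leftFiltration 𝒜 (m + 1)) (h : R.envPair S D m t = 0) :
    t ∈ leftFiltration 𝒜 m := by
  obtain ⟨s, hs, t, ht', rfl⟩ := Submodule.mem_sup.mp ht
  rw [map_add, R.envPair_eq_zero_of_mem_leftFiltration S D le_rfl hs, zero_add] at h
  rw [(R.envPair_bijective S D m).1 t ht' h, add_zero]
  exact hs

include R S in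
/-- An element of the Koszul bimodule complex whose leading part with respect to the left degree is
a cycle can be moved by a boundary to lower left degree. -/
theorem exists_reduction {i m : ℕ} (him : 0 < i ∨ 0 < m) (φ : koszulTerm 𝒜 i)
    (hφ : ∀ a, (φ : A →ₗ[k] DualEnv 𝒜) a ∈ leftFiltration 𝒜 (m + 1))
    (hd : ∀ a, leftDiff D (φ : A →ₗ[k] DualEnv 𝒜) a ∈ leftFiltration 𝒜 (m + 1)) :
    ∃ ψ : koszulTerm 𝒜 (i + 1),
      ∀ a, ((φ - koszulD D i ψ : koszulTerm 𝒜 i) : A →ₗ[k] DualEnv 𝒜) a ∈ leftFiltration 𝒜 m := by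
  have hcyc : ∀ a x, ∑ s, (R.envPair S D m ∘ₗ (φ : A →ₗ[k] DualEnv 𝒜)) (a * D.elt s)
      (R.contract S D m (D.covec s) x) = 0 := by
    intro a x
    rw [← envPair_leftDiff, R.envPair_eq_zero_of_mem_leftFiltration S D le_rfl (hd a)]
    rfl
  have hsupp : ∀ l, l ≠ i → ∀ a ∈ 𝒜 l, (R.envPair S D m ∘ₗ (φ : A →ₗ[k] DualEnv 𝒜)) a = 0 :=
    fun l hl a ha => by rw [LinearMap.comp_apply, φ.2.1 l hl a ha, map_zero]
  have hbal := R.envPair_comp_balanced S D m φ.2.2.1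
  cases m with
  | zero =>
    have h1 := R.cocycle_eq_zero S D (by omega) _ hsupp hbal hcyc
    refine ⟨0, fun a => ?_⟩
    rw [map_zero, sub_zero]
    exact R.mem_leftFiltration_of_envPair_eq_zero S D (hφ a) (LinearMap.congr_fun h1 a)
  | succ m =>
    obtain ⟨ψ, hψ1, hψ2, hψ3⟩ := R.exists_coboundary S D _ hsupp hbal hcyc
    obtain ⟨hinj, hsurj⟩ := R.envPair_bijective S D m
    obtain ⟨χ, hχ1, hχ2, hχ3, rfl⟩ := R.exists_lift S D hinj hsurj ψ hψ1 hψ2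
    have h1 : ∀ a, (φ : A →ₗ[k] DualEnv 𝒜) a - leftDiff D χ a ∈ leftFiltration 𝒜 (m + 1) := by
      intro a
      apply R.mem_leftFiltration_of_envPair_eq_zero S D
      · refine sub_mem (hφ a) (leftDegree_le _ ?_)
        rw [leftDiff_apply]
        exact Submodule.sum_mem _ fun s _ => mul_lgen_mem (hχ1 _) _
      · ext1 x
        rw [map_sub, LinearMap.sub_apply, envPair_leftDiff, hψ3]
        exact sub_self _
    -- The lift `χ` is right balanced only; its left balanced projection still works, because `φ` is
    -- left balanced.
    refine ⟨⟨balanceLeft S χ, hχ2.balanceLeft S, hχ3.balanceLeft S,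
      leftBalanced_balanceLeft S χ⟩, fun a => ?_⟩
    have h2 : ((φ - koszulD D i ⟨balanceLeft S χ, hχ2.balanceLeft S, hχ3.balanceLeft S,
        leftBalanced_balanceLeft S χ⟩ : koszulTerm 𝒜 i) : A →ₗ[k] DualEnv 𝒜) a =
        (φ : A →ₗ[k] DualEnv 𝒜) a - leftDiff D (balanceLeft S χ) a -
          (-1 : k) ^ (i + 1) • rightDiff D (balanceLeft S χ) a := by
      rw [sub_sub]
      rfl
    rw [h2, leftDiff_balanceLeft]
    refine sub_mem ?_ (Submodule.smul_mem _ _ ?_)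
    · have h3 := LinearMap.congr_fun (φ.2.2.2.balanceLeft_eq S) a
      rw [← h3, balanceLeft_apply, balanceLeft_apply, ← Finset.sum_sub_distrib]
      refine Submodule.sum_mem _ fun v _ => ?_
      rw [← sub_mul]
      exact mul_rcoeff_mem_leftFiltration (h1 _) _
    · rw [rightDiff_apply]
      refine Submodule.sum_mem _ fun s _ => mul_rgen_mem_leftFiltration ?_ _
      rw [balanceLeft_apply]
      exact Submodule.sum_mem _ fun v _ => mul_rcoeff_mem_leftFiltration (leftDegree_le m (hχ1 _)) _

include R S in
/-- A cycle is moved by boundaries to lower and lower left degree: the right part of the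
differential preserves the left degree, so that the leading part of a cycle is a cycle for the left
part. -/
theorem exact_koszulD (i : ℕ) : Function.Exact (koszulD (𝒜 := 𝒜) D (i + 1)) (koszulD D i) := by
  have hdd : ∀ ψ, koszulD (𝒜 := 𝒜) D i (koszulD D (i + 1) ψ) = 0 := fun ψ =>
    Subtype.ext (koszulMap_koszulMap D i ψ)
  intro φ
  refine ⟨fun h0 => ?_, ?_⟩
  · have main : ∀ m (φ : koszulTerm 𝒜 (i + 1)), koszulD D i φ = 0 →
        (∀ a, (φ : A →ₗ[k] DualEnv 𝒜) a ∈ leftFiltration 𝒜 m) →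
        φ ∈ Set.range (koszulD (𝒜 := 𝒜) D (i + 1)) := by
      intro m
      induction m with
      | zero =>
        intro φ _ h
        refine ⟨0, ?_⟩
        rw [map_zero]
        apply Subtype.ext
        ext1 a
        exact ((Submodule.mem_bot k).mp (h a)).symm
      | succ m ih =>
        intro φ h0 h
        obtain ⟨ψ, hψ⟩ := R.exists_reduction S D (Or.inl i.succ_pos) φ h (fun a => by
          have h1 : leftDiff D (φ : A →ₗ[k] DualEnv 𝒜) a +
              (-1 : k) ^ (i + 1) • rightDiff D (φ : A →ₗ[k] DualEnv 𝒜) a = 0 :=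
            LinearMap.congr_fun (congrArg Subtype.val h0) a
          rw [eq_neg_of_add_eq_zero_left h1, rightDiff_apply]
          exact neg_mem (Submodule.smul_mem _ _ (Submodule.sum_mem _ fun s _ =>
            mul_rgen_mem_leftFiltration (h _) _)))
        obtain ⟨χ, hχ⟩ := ih (φ - koszulD D (i + 1) ψ) (by rw [map_sub, h0, hdd, sub_zero]) hψ
        exact ⟨χ + ψ, by rw [map_add, hχ, sub_add_cancel]⟩
    obtain ⟨m, hm⟩ := exists_forall_mem_leftFiltration (φ : A →ₗ[k] DualEnv 𝒜)
    exact main m φ h0 hm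
  · rintro ⟨ψ, rfl⟩
    exact hdd ψ

attribute [local instance] instModuleTensorProductMop

omit [DirectSum.Decomposition 𝒜] [Module.Finite k A] in
theorem lcoeff_mul_envR_smul_one (c : 𝒜 0) (w : (QuadraticDual 𝒜)ᵐᵒᵖ) :
    (lcoeff c * envR k _ w) • (1 : QuadraticDual 𝒜) = QuadraticDual.coeff 𝒜 c * w.unop := by
  rw [lcoeff, envL_mul_envR, TensorProduct.Algebra.smul_def, MulOpposite.smul_eq_mul_unop, one_mul,
    smul_eq_mul]

omit [Module.Finite k A] in
include S in
/-- In left degree zero, the augmentation of the Koszul bimodule complex is injective. -/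
theorem eq_zero_of_koszulε_eq_zero (φ : koszulTerm 𝒜 0) (h0 : koszulε 𝒜 φ = 0)
    (h : ∀ a, (φ : A →ₗ[k] DualEnv 𝒜) a ∈ leftDegree 𝒜 0) : φ = 0 := by
  classical
  obtain ⟨w, hw⟩ := exists_eq_sum_idem S (h 1)
  have hmid : ∀ u, (φ : A →ₗ[k] DualEnv 𝒜) (S.idem u) = lcoeff (S.idem u) * envR k _ (w u) := by
    intro u
    have h1 := φ.2.2.1 (S.idem u) 1
    rw [one_mul] at h1
    rw [h1, hw, Finset.sum_mul, Finset.sum_eq_single u]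
    · have : envR k (QuadraticDual 𝒜) (w u) * lcoeff (S.idem u) =
        lcoeff (S.idem u) * envR k (QuadraticDual 𝒜) (w u) := (envL_comm_envR ..).symm
      rw [mul_assoc, this, ← mul_assoc, ← lcoeff_mul, S.idem_mul_self]
    · intro v _ hv
      have : envR k (QuadraticDual 𝒜) (w v) * lcoeff (S.idem u) =
        lcoeff (S.idem u) * envR k (QuadraticDual 𝒜) (w v) := (envL_comm_envR ..).symm
      rw [mul_assoc, this, ← mul_assoc, ← lcoeff_mul, S.idem_mul_ne _ _ hv, lcoeff, map_zero,
        map_zero, zero_mul]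
    · simp
  have hmid' : ∀ u, (φ : A →ₗ[k] DualEnv 𝒜) (S.idem u) =
      lcoeff (S.idem u) * envR k _ (w u * MulOpposite.op (QuadraticDual.coeff 𝒜 (S.idem u))) := by
    intro u
    have h1 := φ.2.2.2 (S.idem u) (S.idem u)
    rw [S.coe_idem_mul_self, hmid] at h1
    rw [hmid, map_mul, ← mul_assoc]
    exact h1
  have hsum : ∑ v, QuadraticDual.coeff 𝒜 (S.idem v) * (w v).unop = 0 := by
    rw [koszulε_apply, hw, Finset.sum_smul] at h0
    simpa only [lcoeff_mul_envR_smul_one] using h0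
  have hzero : ∀ u, (φ : A →ₗ[k] DualEnv 𝒜) (S.idem u) = 0 := by
    intro u
    have h1 := congrArg (QuadraticDual.coeff 𝒜 (S.idem u) * ·) hsum
    simp only [Finset.mul_sum, mul_zero, ← mul_assoc, ← map_mul] at h1
    rw [Finset.sum_eq_single u (fun v _ hv => by
      rw [S.idem_mul_ne _ _ hv.symm, map_zero, zero_mul]) (by simp), S.idem_mul_self] at h1
    have h2 : w u * MulOpposite.op (QuadraticDual.coeff 𝒜 (S.idem u)) = 0 :=
      MulOpposite.unop_injective h1
    rw [hmid', h2, map_zero, mul_zero]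
  apply Subtype.ext
  ext1 a
  rw [← φ.2.1.comp_homPart]
  have h3 := φ.2.2.2 ⟨homPart 𝒜 0 a, homPart_mem 𝒜 0 a⟩ 1
  rw [mul_one] at h3
  rw [h3]
  have h4 : (φ : A →ₗ[k] DualEnv 𝒜) 1 = 0 := by
    rw [← S.coe_sum_idem, map_sum]
    exact Finset.sum_eq_zero fun v _ => hzero v
  rw [h4, zero_mul]
  rfl

include R S in
/-- Elements in homological degree zero are moved by boundaries to left degree zero, where the
augmentation is injective. -/
theorem exact_koszulε : Function.Exact (koszulD (𝒜 := 𝒜) D 0) (koszulε 𝒜) := by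
  intro φ
  refine ⟨fun h0 => ?_, ?_⟩
  · have main : ∀ m (φ : koszulTerm 𝒜 0), koszulε 𝒜 φ = 0 →
        (∀ a, (φ : A →ₗ[k] DualEnv 𝒜) a ∈ leftFiltration 𝒜 (m + 1)) →
        φ ∈ Set.range (koszulD (𝒜 := 𝒜) D 0) := by
      intro m
      induction m with
      | zero =>
        intro φ h0 h
        refine ⟨0, ?_⟩
        rw [map_zero, eq_zero_of_koszulε_eq_zero S φ h0 (fun a => ?_)]
        have := h a
        rwa [leftFiltration, leftFiltration, bot_sup_eq] at this
      | succ m ih =>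
        intro φ h0 h
        obtain ⟨ψ, hψ⟩ := R.exists_reduction S D (Or.inr m.succ_pos) φ h (fun a => by
          rw [φ.2.1.leftDiff_eq_zero D]
          exact zero_mem _)
        obtain ⟨χ, hχ⟩ := ih (φ - koszulD D 0 ψ)
          (by rw [map_sub, h0, koszulε_koszulD, sub_zero]) hψ
        exact ⟨χ + ψ, by rw [map_add, hχ, sub_add_cancel]⟩
    obtain ⟨m, hm⟩ := exists_forall_mem_leftFiltration (φ : A →ₗ[k] DualEnv 𝒜)
    exact main m φ h0 fun a => leftFiltration_mono (Nat.le_succ m) (hm a)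
  · rintro ⟨ψ, rfl⟩
    exact koszulε_koszulD D ψ

end LinearResolution

section

variable {k : Type u} [Field k] {A : Type v} [Ring A] [Algebra k A]
  {𝒜 : ℕ → Submodule k A} [SetLike.GradedMonoid 𝒜] [DirectSum.Decomposition 𝒜]
  {V : Type*} [Fintype V] (S : SplitGrading 𝒜 V)

attribute [local instance] instModuleTensorProductMop

include S in
theorem koszulε_surjective : Function.Surjective (koszulε 𝒜) := by
  classical
  intro b
  let ψ : A →ₗ[k] DualEnv 𝒜 := LinearMap.toSpanSingleton k _ (envL k _ b) ∘ₗ S.aug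
  have hψ : ∀ a, ψ a = S.aug a • envL k _ b := fun a => rfl
  refine ⟨koszulProj S 0 ψ, ?_⟩
  have h : ∀ u v, ψ (homPart 𝒜 0 (S.idem u * 1 * S.idem v)) * lcoeff (S.idem v) *
        rcoeff (S.idem u) = if u = v then envL k _ b * lcoeff (S.idem u) * rcoeff (S.idem u)
          else 0 := by
    intro u v
    rw [hψ, mul_one]
    split_ifs with huv
    · subst huv
      rw [S.coe_idem_mul_self, homPart_same (S.idem u).2, S.aug_idem, one_smul]
    · rw [S.coe_idem_mul_ne huv, map_zero, map_zero, zero_smul, zero_mul, zero_mul]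
  rw [koszulε_apply, koszulProj_apply]
  simp only [h, Finset.sum_ite_eq, Finset.mem_univ, if_true, Finset.sum_smul]
  have h1 : ∀ u, (envL k _ b * lcoeff (S.idem u) * rcoeff (S.idem u)) • (1 : QuadraticDual 𝒜) =
      b * QuadraticDual.coeff 𝒜 (S.idem u) := by
    intro u
    rw [lcoeff, ← map_mul, rcoeff, envL_mul_envR, TensorProduct.Algebra.smul_def,
      MulOpposite.smul_eq_mul_unop, one_mul, MulOpposite.unop_op, smul_eq_mul, mul_assoc, ← map_mul,
      S.idem_mul_self]
  simp only [h1]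
  rw [← Finset.mul_sum, ← map_sum, S.sum_idem, map_one, mul_one]

end

/-! ### Extension groups in the top degree of a projective resolution -/

namespace ProjectiveResolution

open Abelian

variable {R : Type v} [Ring R]

theorem exists_ext_eq_mk₀ {X Y : ModuleCat.{v} R} (e : Ext.{v} X Y 0) :
    ∃ g : X →ₗ[R] Y, e = Ext.mk₀ (ModuleCat.ofHom g) := by
  obtain ⟨f, rfl⟩ := Ext.addEquiv₀.symm.surjective e
  exact ⟨f.hom, rfl⟩

theorem mk₀_injective {X Y : ModuleCat.{v} R} {f g : X →ₗ[R] Y}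
    (h : (Ext.mk₀ (ModuleCat.ofHom f) : Ext.{v} X Y 0) = Ext.mk₀ (ModuleCat.ofHom g)) : f = g :=
  congrArg ModuleCat.Hom.hom (Ext.addEquiv₀.symm.injective h)

variable {M : Type v} [AddCommGroup M] [Module R M]

/-- The kernel of the connecting map `Hom(K, Y) → Ext¹(M, Y)` of a short exact sequence
`0 → K → P → M → 0`. -/
theorem extClass_comp_eq_zero_iff {S : ShortComplex (ModuleCat.{v} R)} (hS : S.ShortExact)
    {Y : ModuleCat.{v} R} (g : S.X₁ →ₗ[R] Y) :
    hS.extClass.comp (Ext.mk₀ (ModuleCat.ofHom g)) (add_zero 1) = 0 ↔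
      ∃ h : S.X₂ →ₗ[R] Y, g = h ∘ₗ S.f.hom := by
  constructor
  · intro h0
    obtain ⟨x, hx⟩ := Ext.contravariant_sequence_exact₁ hS Y (Ext.mk₀ (ModuleCat.ofHom g))
      (add_zero 1) h0
    obtain ⟨h, rfl⟩ := exists_ext_eq_mk₀ x
    rw [Ext.mk₀_comp_mk₀] at hx
    exact ⟨h, (congrArg ModuleCat.Hom.hom (Ext.addEquiv₀.symm.injective hx)).symm⟩
  · rintro ⟨h, rfl⟩
    have : ModuleCat.ofHom (h ∘ₗ S.f.hom) = S.f ≫ ModuleCat.ofHom h := rfl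
    rw [this, ← Ext.mk₀_comp_mk₀]
    exact hS.extClass_comp_assoc _

/-- If `M` has a projective resolution `P` with `P_{m+2} → P_{m+1}` zero, then there is a class in
`Ext^{m+1}(M, P_{m+1})` that identifies `Ext^{m+1}(M, Y)` with the cokernel of
`Hom(P_m, Y) → Hom(P_{m+1}, Y)`. -/
theorem exists_ext_succ (m : ℕ) {M : Type v} [AddCommGroup M] [Module R M]
    (P : ℕ → Type v) [∀ i, AddCommGroup (P i)]
    [∀ i, Module R (P i)] [∀ i, Module.Projective R (P i)] (d : ∀ i, P (i + 1) →ₗ[R] P i)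
    (ε : P 0 →ₗ[R] M) (hε : Function.Surjective ε) (h0 : Function.Exact (d 0) ε)
    (hd : ∀ i, Function.Exact (d (i + 1)) (d i)) (hz : d (m + 1) = 0) :
    ∃ ξ : Ext.{v} (ModuleCat.of R M) (ModuleCat.of R (P (m + 1))) (m + 1),
      (∀ (Y : ModuleCat.{v} R) (e : Ext.{v} (ModuleCat.of R M) Y (m + 1)),
        ∃ g : P (m + 1) →ₗ[R] Y,
          e = ξ.comp (Ext.mk₀ (ModuleCat.ofHom g)) (add_zero (m + 1))) ∧
      ∀ (Y : ModuleCat.{v} R) (g : P (m + 1) →ₗ[R] Y),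
        ξ.comp (Ext.mk₀ (ModuleCat.ofHom g)) (add_zero (m + 1)) = 0 ↔
          ∃ h : P m →ₗ[R] Y, g = h ∘ₗ d m := by
  induction m generalizing M P with
  | zero =>
    have hinj : Function.Injective (d 0) := by
      rw [injective_iff_map_eq_zero]
      intro x hx
      obtain ⟨y, rfl⟩ := (hd 0 x).mp hx
      rw [hz, LinearMap.zero_apply]
    let S : ShortComplex (ModuleCat.{v} R) :=
      ModuleCat.shortComplexOfCompEqZero (d 0) ε (LinearMap.ext fun x => h0.apply_apply_eq_zero x)
    have hS : S.ShortExact :=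
      { exact := (ShortComplex.ShortExact.moduleCat_exact_iff_function_exact _).mpr h0
        mono_f := (ModuleCat.mono_iff_injective _).mpr hinj
        epi_g := (ModuleCat.epi_iff_surjective _).mpr hε }
    have hP : Projective S.X₂ := (IsProjective.iff_projective (P 0)).mp inferInstance
    refine ⟨hS.extClass, fun Y e => ?_, fun Y g => extClass_comp_eq_zero_iff hS g⟩
    obtain ⟨x, hx⟩ := Ext.contravariant_sequence_exact₃ hS Y e (Ext.eq_zero_of_projective _)
      (add_zero 1)
    obtain ⟨g, rfl⟩ := exists_ext_eq_mk₀ x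
    exact ⟨g, hx.symm⟩
  | succ m ih =>
    have hS := LinearMap.shortExact_shortComplexKer hε
    have hP : Projective ε.shortComplexKer.X₂ :=
      (IsProjective.iff_projective (P 0)).mp inferInstance
    obtain ⟨ξ, h1, h2⟩ := ih (M := LinearMap.ker ε) (fun i => P (i + 1)) (fun i => d (i + 1))
      ((d 0).codRestrict _ fun x => h0.apply_apply_eq_zero x)
      (fun x => by
        obtain ⟨y, hy⟩ := (h0 x).mp x.2
        exact ⟨y, Subtype.ext hy⟩)
      (fun x => by
        rw [← hd 0 x]
        exact Subtype.ext_iff)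
      (fun i => hd (i + 1)) hz
    have hcomp : ∀ {Y : ModuleCat.{v} R} (g : P (m + 2) →ₗ[R] Y),
        (hS.extClass.comp ξ (add_comm 1 (m + 1))).comp (Ext.mk₀ (ModuleCat.ofHom g))
          (add_zero (m + 1 + 1)) =
        hS.extClass.comp (ξ.comp (Ext.mk₀ (ModuleCat.ofHom g)) (add_zero (m + 1)))
          (add_comm 1 (m + 1)) := fun g => Ext.comp_assoc_of_third_deg_zero ..
    refine ⟨hS.extClass.comp ξ (add_comm 1 (m + 1)), fun Y e => ?_, fun Y g => ?_⟩
    · obtain ⟨x, hx⟩ := Ext.contravariant_sequence_exact₃ hS Y e (Ext.eq_zero_of_projective _)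
        (add_comm 1 (m + 1))
      obtain ⟨g, rfl⟩ := h1 Y x
      exact ⟨g, by rw [hcomp]; exact hx.symm⟩
    · rw [hcomp, ← h2 Y g]
      constructor
      · intro h
        obtain ⟨x, hx⟩ := Ext.contravariant_sequence_exact₁ hS Y _ (add_comm 1 (m + 1)) h
        rw [← hx, Ext.eq_zero_of_projective x, Ext.comp_zero]
      · intro h
        rw [h, Ext.comp_zero]

/-- An isomorphism `P → M` identifies `Ext⁰(M, Y)` with `Hom(P, Y)`. -/
theorem exists_ext_zero {P : Type v} [AddCommGroup P] [Module R P] (ε : P ≃ₗ[R] M) :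
    ∃ ξ : Ext.{v} (ModuleCat.of R M) (ModuleCat.of R P) 0,
      (∀ (Y : ModuleCat.{v} R) (e : Ext.{v} (ModuleCat.of R M) Y 0),
        ∃ g : P →ₗ[R] Y, e = ξ.comp (Ext.mk₀ (ModuleCat.ofHom g)) (add_zero 0)) ∧
      ∀ (Y : ModuleCat.{v} R) (g : P →ₗ[R] Y),
        ξ.comp (Ext.mk₀ (ModuleCat.ofHom g)) (add_zero 0) = 0 → g = 0 := by
  refine ⟨Ext.mk₀ (ModuleCat.ofHom ε.symm.toLinearMap), fun Y e => ?_, fun Y g hg => ?_⟩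
  · obtain ⟨g, rfl⟩ := exists_ext_eq_mk₀ e
    refine ⟨g ∘ₗ ε.toLinearMap, ?_⟩
    rw [Ext.mk₀_comp_mk₀, ← ModuleCat.ofHom_comp, LinearMap.comp_assoc]
    simp
  · rw [Ext.mk₀_comp_mk₀, ← ModuleCat.ofHom_comp, ← Ext.mk₀_zero] at hg
    have h := mk₀_injective (g := 0) hg
    ext x
    have := LinearMap.congr_fun h (ε x)
    simpa using this

section

variable {R : Type v} [Ring R] {M : Type v} [AddCommGroup M] [Module R M]
  (Y : Type v) [AddCommGroup Y] [Module R Y]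

/-- The composition with a fixed class, as a homomorphism of groups. -/
noncomputable def compHom {n : ℕ} {P : Type v} [AddCommGroup P] [Module R P]
    (ξ : Ext.{v} (ModuleCat.of R M) (ModuleCat.of R P) n) :
    (P →ₗ[R] Y) →+ Ext.{v} (ModuleCat.of R M) (ModuleCat.of R Y) n :=
  AddMonoidHom.mk' (fun g => ξ.comp (Ext.mk₀ (ModuleCat.ofHom g)) (add_zero n)) fun g g' => by
    rw [ModuleCat.ofHom_add, Ext.mk₀_add, Ext.comp_add]

theorem compHom_apply {n : ℕ} {P : Type v} [AddCommGroup P] [Module R P]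
    (ξ : Ext.{v} (ModuleCat.of R M) (ModuleCat.of R P) n) (γ : P →ₗ[R] Y) :
    compHom Y ξ γ = ξ.comp (Ext.mk₀ (ModuleCat.ofHom γ)) (add_zero n) := rfl

theorem compHom_comp {n : ℕ} {P : Type v} [AddCommGroup P] [Module R P]
    (ξ : Ext.{v} (ModuleCat.of R M) (ModuleCat.of R P) n) (f : Y →ₗ[R] Y) (γ : P →ₗ[R] Y) :
    (compHom Y ξ γ).comp (Ext.mk₀ (ModuleCat.ofHom f)) (add_zero n) = compHom Y ξ (f ∘ₗ γ) := by
  have h : ModuleCat.ofHom (f ∘ₗ γ) = ModuleCat.ofHom γ ≫ ModuleCat.ofHom f := rfl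
  rw [compHom_apply, compHom_apply, h, ← Ext.mk₀_comp_mk₀, ← Ext.comp_assoc_of_third_deg_zero]

/-- The case of a resolution with a single term. -/
theorem exists_hom_zero {P : Type v} [AddCommGroup P] [Module R P]
    (ε : P →ₗ[R] M) (hε : Function.Bijective ε) :
    ∃ π : (P →ₗ[R] Y) →+ Ext.{v} (ModuleCat.of R M) (ModuleCat.of R Y) 0,
      Function.Surjective π ∧ (∀ γ, π γ = 0 ↔ γ = 0) ∧ ∀ (f : Y →ₗ[R] Y) γ,
        (π γ).comp (Ext.mk₀ (ModuleCat.ofHom f)) (add_zero 0) = π (f ∘ₗ γ) := by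
  obtain ⟨ξ, h1, h2⟩ := ProjectiveResolution.exists_ext_zero (LinearEquiv.ofBijective ε hε)
  refine ⟨compHom Y ξ, fun e => ?_, fun γ => ⟨fun h => ?_, ?_⟩, compHom_comp Y ξ⟩
  · obtain ⟨g, rfl⟩ := h1 (ModuleCat.of R Y) e
    exact ⟨g, compHom_apply Y ξ g⟩
  · exact h2 (ModuleCat.of R Y) γ ((compHom_apply Y ξ γ).symm.trans h)
  · rintro rfl
    exact map_zero _

/-- The presentation of `exists_ext_succ` for a fixed module `Y`, with the action of endomorphisms
of `Y`. -/
theorem exists_hom_succ {P : ℕ → Type v} [∀ i, AddCommGroup (P i)]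
    [∀ i, Module R (P i)] [∀ i, Module.Projective R (P i)]
    (d : ∀ i, P (i + 1) →ₗ[R] P i) (ε : P 0 →ₗ[R] M)
    (hε : Function.Surjective ε) (h0 : Function.Exact (d 0) ε)
    (hd : ∀ i, Function.Exact (d (i + 1)) (d i)) (m : ℕ) (hz : d (m + 1) = 0) :
    ∃ π : (P (m + 1) →ₗ[R] Y) →+ Ext.{v} (ModuleCat.of R M) (ModuleCat.of R Y) (m + 1),
      Function.Surjective π ∧
      (∀ γ, π γ = 0 ↔ ∃ g : P m →ₗ[R] Y, γ = g ∘ₗ d m) ∧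
      ∀ (f : Y →ₗ[R] Y) γ,
        (π γ).comp (Ext.mk₀ (ModuleCat.ofHom f)) (add_zero (m + 1)) = π (f ∘ₗ γ) := by
  obtain ⟨ξ, h1, h2⟩ := ProjectiveResolution.exists_ext_succ m P d ε hε h0 hd hz
  refine ⟨compHom Y ξ, fun e => ?_, fun γ => ?_, compHom_comp Y ξ⟩
  · obtain ⟨g, rfl⟩ := h1 (ModuleCat.of R Y) e
    exact ⟨g, compHom_apply Y ξ g⟩
  · rw [compHom_apply]
    exact h2 (ModuleCat.of R Y) γ

end

end ProjectiveResolution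

/-! ### The extension group of the quadratic dual as a bimodule -/

section KoszulCoboundary

variable {k : Type u} [Field k] {A : Type v} [Ring A] [Algebra k A]
  {𝒜 : ℕ → Submodule k A} [SetLike.GradedMonoid 𝒜]
  {ι : Type*} [Fintype ι] (D : DualFamily 𝒜 ι)

/-- The coboundaries of degree `n` of the complex of homomorphisms from the Koszul bimodule complex
to the enveloping algebra. -/
def IsKoszulCoboundary : ∀ n : ℕ, (koszulTerm 𝒜 n →ₗ[DualEnv 𝒜] DualEnv 𝒜) → Prop
  | 0, γ => γ = 0
  | m + 1, γ => ∃ g : koszulTerm 𝒜 m →ₗ[DualEnv 𝒜] DualEnv 𝒜, γ = g ∘ₗ koszulD D m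

variable (𝒜) in
/-- The evaluation of elements of the Koszul bimodule complex at an element of the algebra. -/
noncomputable def koszulEval (n : ℕ) : A →+ (koszulTerm 𝒜 n →ₗ[DualEnv 𝒜] DualEnv 𝒜) where
  toFun x := LinearMap.applyₗ' (DualEnv 𝒜) x ∘ₗ (koszulTerm 𝒜 n).subtype
  map_zero' := LinearMap.ext fun φ => map_zero (φ : A →ₗ[k] DualEnv 𝒜)
  map_add' x y := LinearMap.ext fun φ => map_add (φ : A →ₗ[k] DualEnv 𝒜) x y

theorem koszulEval_apply (n : ℕ) (x : A) (φ : koszulTerm 𝒜 n) :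
    koszulEval 𝒜 n x φ = (φ : A →ₗ[k] DualEnv 𝒜) x := rfl

variable (𝒜) in
/-- Right multiplication on homomorphisms from the Koszul bimodule complex to the enveloping
algebra. -/
noncomputable def koszulRMul (n : ℕ) (t : DualEnv 𝒜) :
    (koszulTerm 𝒜 n →ₗ[DualEnv 𝒜] DualEnv 𝒜) →+ (koszulTerm 𝒜 n →ₗ[DualEnv 𝒜] DualEnv 𝒜) where
  toFun γ := LinearMap.toSpanSingleton (DualEnv 𝒜) (DualEnv 𝒜) t ∘ₗ γ
  map_zero' := LinearMap.comp_zero _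
  map_add' _ _ := LinearMap.comp_add _ _ _

theorem koszulRMul_apply (n : ℕ) (t : DualEnv 𝒜) (γ : koszulTerm 𝒜 n →ₗ[DualEnv 𝒜] DualEnv 𝒜)
    (φ : koszulTerm 𝒜 n) : koszulRMul 𝒜 n t γ φ = γ φ * t := rfl

theorem koszulEval_mul_coe (n : ℕ) (x : A) (c : 𝒜 0) :
    koszulEval 𝒜 n (x * c) = koszulRMul 𝒜 n (lcoeff c) (koszulEval 𝒜 n x) :=
  LinearMap.ext fun φ => φ.2.2.1 c x

theorem koszulEval_coe_mul (n : ℕ) (x : A) (c : 𝒜 0) :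
    koszulEval 𝒜 n (c * x) = koszulRMul 𝒜 n (rcoeff c) (koszulEval 𝒜 n x) :=
  LinearMap.ext fun φ => φ.2.2.2 c x

theorem koszulEval_eq_zero {n l : ℕ} (h : l ≠ n) {x : A} (hx : x ∈ 𝒜 l) :
    koszulEval 𝒜 n x = 0 :=
  LinearMap.ext fun φ => φ.2.1 l h x hx

/-- The dual of the Koszul differential on the evaluations. -/
theorem koszulEval_comp_koszulD (m : ℕ) (x : A) :
    koszulEval 𝒜 m x ∘ₗ koszulD D m =
      ∑ s, koszulRMul 𝒜 (m + 1) (lgen (D.covec s)) (koszulEval 𝒜 (m + 1) (x * D.elt s)) +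
      ∑ s, koszulRMul 𝒜 (m + 1) (rgen (D.covec s))
          (koszulEval 𝒜 (m + 1) ((-1 : k) ^ (m + 1) • (D.elt s * x))) := by
  refine LinearMap.ext fun φ => ?_
  have h1 : (∑ s, koszulRMul 𝒜 (m + 1) (lgen (D.covec s))
      (koszulEval 𝒜 (m + 1) (x * D.elt s))) φ = leftDiff D (φ : A →ₗ[k] DualEnv 𝒜) x := by
    rw [LinearMap.sum_apply, leftDiff_apply]
    rfl
  have h2 : (∑ s, koszulRMul 𝒜 (m + 1) (rgen (D.covec s))
      (koszulEval 𝒜 (m + 1) ((-1 : k) ^ (m + 1) • (D.elt s * x)))) φ =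
        (-1 : k) ^ (m + 1) • rightDiff D (φ : A →ₗ[k] DualEnv 𝒜) x := by
    rw [LinearMap.sum_apply, ← (rightDiff D (φ : A →ₗ[k] DualEnv 𝒜)).map_smul, rightDiff_apply]
    simp only [mul_smul_comm]
    rfl
  rw [LinearMap.add_apply, h1, h2]
  exact koszulMap_apply D m φ x

variable [DirectSum.Decomposition 𝒜]

theorem koszulEval_zero_mul (x : A) {y : A} (hy : y ∈ 𝒜 1) : koszulEval 𝒜 0 (x * y) = 0 := by
  induction x using homogeneous_induction 𝒜 with
  | hadd x x' hx hx' => rw [add_mul, map_add, hx, hx', add_zero]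
  | h l x hx => exact koszulEval_eq_zero l.succ_ne_zero (SetLike.mul_mem_graded hx hy)

theorem koszulEval_mul_zero (x : A) {y : A} (hy : y ∈ 𝒜 1) : koszulEval 𝒜 0 (y * x) = 0 := by
  induction x using homogeneous_induction 𝒜 with
  | hadd x x' hx hx' => rw [mul_add, map_add, hx, hx', add_zero]
  | h l x hx => exact koszulEval_eq_zero (by omega) (SetLike.mul_mem_graded hy hx)

theorem isKoszulCoboundary_relation (n : ℕ) (x : A) :
    IsKoszulCoboundary D n
      (∑ s, koszulRMul 𝒜 n (lgen (D.covec s)) (koszulEval 𝒜 n (x * D.elt s)) +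
        ∑ s, koszulRMul 𝒜 n (rgen (D.covec s))
          (koszulEval 𝒜 n ((-1 : k) ^ n • (D.elt s * x)))) := by
  cases n with
  | zero =>
    change _ = 0
    rw [← Finset.sum_add_distrib]
    refine Finset.sum_eq_zero fun s _ => ?_
    rw [← mul_smul_comm, koszulEval_zero_mul x (D.elt_mem s), koszulEval_mul_zero _ (D.elt_mem s)]
    exact (congrArg₂ _ (AddMonoidHom.map_zero _) (AddMonoidHom.map_zero _)).trans (add_zero _)
  | succ m => exact ⟨koszulEval 𝒜 m x, (koszulEval_comp_koszulD D m x).symm⟩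

end KoszulCoboundary

section Coordinates

variable {k : Type u} [Field k] {A : Type v} [Ring A] [Algebra k A] [Module.Finite k A]
  {𝒜 : ℕ → Submodule k A} [SetLike.GradedMonoid 𝒜] [DirectSum.Decomposition 𝒜]
  {V : Type*} [Fintype V] (S : SplitGrading 𝒜 V)

/-- The elements of the Koszul bimodule complex that correspond to the dual of the basis of `A`. -/
noncomputable def koszulCoord (n : ℕ) (r : Fin (Module.finrank k A)) : koszulTerm 𝒜 n :=
  koszulProj S n
    (LinearMap.toSpanSingleton k (DualEnv 𝒜) 1 ∘ₗ (Module.finBasis k A).coord r)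

theorem sum_smul_koszulCoord (n : ℕ) (φ : koszulTerm 𝒜 n) :
    ∑ r, (φ : A →ₗ[k] DualEnv 𝒜) (Module.finBasis k A r) • koszulCoord S n r = φ := by
  have h : (φ : A →ₗ[k] DualEnv 𝒜) = ∑ r, (φ : A →ₗ[k] DualEnv 𝒜) (Module.finBasis k A r) •
      (LinearMap.toSpanSingleton k (DualEnv 𝒜) 1 ∘ₗ (Module.finBasis k A).coord r) := by
    ext1 a
    rw [LinearMap.sum_apply]
    conv_lhs => rw [← (Module.finBasis k A).sum_repr a, map_sum]
    refine Finset.sum_congr rfl fun r _ => ?_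
    rw [map_smul, LinearMap.smul_apply, LinearMap.comp_apply, LinearMap.toSpanSingleton_apply,
      smul_eq_mul, mul_smul_comm, mul_one]
    rfl
  conv_rhs => rw [← koszulProj_coe S n φ, h, map_sum]
  refine Finset.sum_congr rfl fun r _ => ?_
  exact ((koszulProj S n).map_smul _ _).symm

/-- The evaluations generate the module of homomorphisms from the Koszul bimodule complex. -/
theorem eq_sum_koszulRMul (n : ℕ) (γ : koszulTerm 𝒜 n →ₗ[DualEnv 𝒜] DualEnv 𝒜) :
    γ = ∑ r, koszulRMul 𝒜 n (γ (koszulCoord S n r))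
      (koszulEval 𝒜 n (Module.finBasis k A r)) := by
  refine LinearMap.ext fun φ => ?_
  conv_lhs => rw [← sum_smul_koszulCoord S n φ, map_sum]
  rw [LinearMap.sum_apply]
  refine Finset.sum_congr rfl fun r _ => ?_
  rw [γ.map_smul]
  rfl

theorem koszulCoord_apply (n : ℕ) (r : Fin (Module.finrank k A)) (a : A) :
    (koszulCoord S n r : A →ₗ[k] DualEnv 𝒜) a = ∑ u, ∑ v,
      (Module.finBasis k A).repr (homPart 𝒜 n (S.idem u * a * S.idem v)) r •
        (lcoeff (S.idem v) * rcoeff (S.idem u)) := by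
  rw [koszulCoord, koszulProj_apply]
  refine Finset.sum_congr rfl fun u _ => Finset.sum_congr rfl fun v _ => ?_
  rw [LinearMap.comp_apply, LinearMap.toSpanSingleton_apply, smul_mul_assoc, smul_mul_assoc,
    one_mul]
  rfl

end Coordinates

section Universal

variable {k : Type u} [Field k] {A : Type v} [Ring A] [Algebra k A] [Module.Finite k A]
  {𝒜 : ℕ → Submodule k A} [SetLike.GradedMonoid 𝒜] [DirectSum.Decomposition 𝒜]
  {V : Type*} [Fintype V] (S : SplitGrading 𝒜 V) {ι : Type*} [Fintype ι] (D : DualFamily 𝒜 ι)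
  {C : Type w} [Ring C] [Algebra k C] (f : QuadraticDual 𝒜 →ₐ[k] C)

/-- The action `(b ⊗ c) ⋆ z = f(c) z f(b)` of the enveloping algebra through a homomorphism `f` of
algebras. -/
noncomputable def sandwich : DualEnv 𝒜 →ₗ[k] C →ₗ[k] C :=
  TensorProduct.lift (LinearMap.mk₂ k
    (fun b c => LinearMap.mulLeft k (f c.unop) ∘ₗ LinearMap.mulRight k (f b))
    (fun b b' c => LinearMap.ext fun z => by simp [mul_add])
    (fun r b c => LinearMap.ext fun z => by simp)
    (fun b c c' => LinearMap.ext fun z => by simp [add_mul])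
    (fun r b c => LinearMap.ext fun z => by simp))

omit [Module.Finite k A] [DirectSum.Decomposition 𝒜] in
theorem sandwich_tmul (b : QuadraticDual 𝒜) (c : (QuadraticDual 𝒜)ᵐᵒᵖ) (z : C) :
    sandwich f (b ⊗ₜ c) z = f c.unop * (z * f b) := rfl

omit [Module.Finite k A] [DirectSum.Decomposition 𝒜] in
theorem sandwich_tmul_one (b : QuadraticDual 𝒜) (z : C) : sandwich f (b ⊗ₜ 1) z = z * f b := by
  rw [sandwich_tmul, MulOpposite.unop_one, map_one f, one_mul]

omit [Module.Finite k A] [DirectSum.Decomposition 𝒜] in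
theorem sandwich_one_tmul (b : QuadraticDual 𝒜) (z : C) :
    sandwich f (1 ⊗ₜ MulOpposite.op b) z = f b * z := by
  rw [sandwich_tmul, MulOpposite.unop_op, map_one f, mul_one]

omit [Module.Finite k A] [DirectSum.Decomposition 𝒜] in
theorem sandwich_mul (s t : DualEnv 𝒜) (z : C) :
    sandwich f (s * t) z = sandwich f t (sandwich f s z) := by
  induction s using TensorProduct.induction_on with
  | zero => simp
  | add s s' hs hs' =>
    rw [add_mul, map_add, map_add, LinearMap.add_apply, LinearMap.add_apply, hs, hs', map_add]
  | tmul b c =>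
    induction t using TensorProduct.induction_on with
    | zero => simp
    | add t t' ht ht' =>
      rw [mul_add, map_add, map_add, LinearMap.add_apply, LinearMap.add_apply, ht, ht']
    | tmul b' c' =>
      rw [Algebra.TensorProduct.tmul_mul_tmul]
      simp only [sandwich_tmul, MulOpposite.unop_mul, map_mul, mul_assoc]

variable (h : A →ₗ[k] C)

/-- The homomorphism from the module of Koszul cochains that is determined by the values at the
evaluations. -/
noncomputable def cochainLift (n : ℕ) :
    (koszulTerm 𝒜 n →ₗ[DualEnv 𝒜] DualEnv 𝒜) →+ C where
  toFun γ := ∑ r, sandwich f (γ (koszulCoord S n r)) (h (Module.finBasis k A r))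
  map_zero' := Finset.sum_eq_zero fun r _ => by
    rw [LinearMap.zero_apply, map_zero, LinearMap.zero_apply]
  map_add' γ γ' := by
    rw [← Finset.sum_add_distrib]
    refine Finset.sum_congr rfl fun r _ => ?_
    rw [LinearMap.add_apply, map_add, LinearMap.add_apply]

theorem cochainLift_apply (n : ℕ) (γ : koszulTerm 𝒜 n →ₗ[DualEnv 𝒜] DualEnv 𝒜) :
    cochainLift S f h n γ =
      ∑ r, sandwich f (γ (koszulCoord S n r)) (h (Module.finBasis k A r)) := rfl

theorem cochainLift_koszulRMul (n : ℕ) (t : DualEnv 𝒜)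
    (γ : koszulTerm 𝒜 n →ₗ[DualEnv 𝒜] DualEnv 𝒜) :
    cochainLift S f h n (koszulRMul 𝒜 n t γ) = sandwich f t (cochainLift S f h n γ) := by
  rw [cochainLift_apply, cochainLift_apply, map_sum]
  refine Finset.sum_congr rfl fun r _ => ?_
  rw [koszulRMul_apply, sandwich_mul]

/-- The map that is determined by `h` takes the value `h x` at the evaluation at `x`, provided that
`h` is supported in degree `n` and compatible with the degree zero component. -/
theorem cochainLift_koszulEval {n : ℕ} (hs : ∀ l, l ≠ n → ∀ a ∈ 𝒜 l, h a = 0)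
    (hl : ∀ (c : 𝒜 0) x, h (c * x) = f (QuadraticDual.coeff 𝒜 c) * h x)
    (hr : ∀ (c : 𝒜 0) x, h (x * c) = h x * f (QuadraticDual.coeff 𝒜 c)) (x : A) :
    cochainLift S f h n (koszulEval 𝒜 n x) = h x := by
  have hpart : ∀ a, h (homPart 𝒜 n a) = h a := fun a => by
    induction a using homogeneous_induction 𝒜 with
    | hadd a b ha hb => rw [map_add, map_add, ha, hb, map_add]
    | h l a ha =>
      by_cases hl : l = n
      · subst hl; rw [homPart_same ha]
      · rw [homPart_ne ha hl, hs l hl a ha, map_zero]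
  have key : ∀ u v, sandwich f (lcoeff (S.idem v) * rcoeff (S.idem u))
      (h (homPart 𝒜 n (S.idem u * x * S.idem v))) = h (S.idem u * x * S.idem v) := by
    intro u v
    rw [hpart, lcoeff, rcoeff, envL_mul_envR, sandwich_tmul, MulOpposite.unop_op, ← hr, ← hl,
      mul_assoc, mul_assoc, S.coe_idem_mul_self, ← mul_assoc, ← mul_assoc, S.coe_idem_mul_self]
  rw [cochainLift_apply]
  simp only [koszulEval_apply, koszulCoord_apply, map_sum, LinearMap.sum_apply, map_smul,
    LinearMap.smul_apply]
  have hsum : x = ∑ u, ∑ v, (S.idem u : A) * x * S.idem v := by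
    simp only [← Finset.mul_sum, S.coe_sum_idem, mul_one, ← Finset.sum_mul, one_mul]
  conv_rhs => rw [hsum, map_sum]
  rw [Finset.sum_comm]
  refine Finset.sum_congr rfl fun u _ => ?_
  rw [map_sum, Finset.sum_comm]
  refine Finset.sum_congr rfl fun v _ => ?_
  rw [← key u v]
  conv_rhs => rw [← (Module.finBasis k A).sum_repr (homPart 𝒜 n (S.idem u * x * S.idem v))]
  simp only [map_sum, map_smul]

/-- The map that is determined by `h` vanishes on coboundaries if `h` satisfies the relations of the
presentation: the coboundaries are generated by those of evaluations. -/
theorem cochainLift_eq_zero {n : ℕ} (hs : ∀ l, l ≠ n → ∀ a ∈ 𝒜 l, h a = 0)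
    (hl : ∀ (c : 𝒜 0) x, h (c * x) = f (QuadraticDual.coeff 𝒜 c) * h x)
    (hr : ∀ (c : 𝒜 0) x, h (x * c) = h x * f (QuadraticDual.coeff 𝒜 c))
    (hrel : ∀ x, ∑ s, h (x * D.elt s) * f (QuadraticDual.gen (D.covec s)) +
      ∑ s, f (QuadraticDual.gen (D.covec s)) * h ((-1 : k) ^ n • (D.elt s * x)) = 0)
    {γ : koszulTerm 𝒜 n →ₗ[DualEnv 𝒜] DualEnv 𝒜} (hγ : IsKoszulCoboundary D n γ) :
    cochainLift S f h n γ = 0 := by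
  cases n with
  | zero => rw [show γ = 0 from hγ, map_zero]
  | succ m =>
    obtain ⟨g, rfl⟩ := hγ
    have hlg : ∀ g z, sandwich f (lgen g) z = z * f (QuadraticDual.gen g) := fun g z =>
      sandwich_tmul_one f (QuadraticDual.gen g) z
    have hrg : ∀ g z, sandwich f (rgen g) z = f (QuadraticDual.gen g) * z := fun g z =>
      sandwich_one_tmul f (QuadraticDual.gen g) z
    have h1 : ∀ x, cochainLift S f h (m + 1) (koszulEval 𝒜 m x ∘ₗ koszulD D m) = 0 := by
      intro x
      rw [koszulEval_comp_koszulD, map_add, map_sum, map_sum, ← hrel x]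
      simp only [cochainLift_koszulRMul, cochainLift_koszulEval S f h hs hl hr, hlg, hrg]
    have h2 : g ∘ₗ koszulD D m = ∑ r, koszulRMul 𝒜 (m + 1) (g (koszulCoord S m r))
        (koszulEval 𝒜 m (Module.finBasis k A r) ∘ₗ koszulD D m) := by
      conv_lhs => rw [eq_sum_koszulRMul S m g]
      exact LinearMap.ext fun φ => by simp only [LinearMap.comp_apply, LinearMap.sum_apply]; rfl
    rw [h2, map_sum]
    refine Finset.sum_eq_zero fun r _ => ?_
    rw [cochainLift_koszulRMul, h1, map_zero]

end Universal

/-! ### A presentation of the extension group -/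

section EnvelopingExt

open Abelian

variable {k : Type u} [Field k] {B : Type v} [Ring B] [Algebra k B]

theorem EnvelopingExt.act_eq_comp {n : ℕ} (t : B ⊗[k] Bᵐᵒᵖ) (e : EnvelopingExt k B n) :
    EnvelopingExt.act t e = Ext.comp e (Ext.mk₀ (envelopingRMul k B t)) (add_zero n) := rfl

attribute [local instance] instModuleTensorProductMop

theorem EnvelopingExt.exists_hom_zero {P : Type v} [AddCommGroup P] [Module (B ⊗[k] Bᵐᵒᵖ) P]
    (ε : P →ₗ[B ⊗[k] Bᵐᵒᵖ] B) (hε : Function.Bijective ε) :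
    ∃ π : (P →ₗ[B ⊗[k] Bᵐᵒᵖ] B ⊗[k] Bᵐᵒᵖ) →+ EnvelopingExt k B 0,
      Function.Surjective π ∧ (∀ γ, π γ = 0 ↔ γ = 0) ∧ ∀ t γ, EnvelopingExt.act t (π γ) =
        π (LinearMap.toSpanSingleton (B ⊗[k] Bᵐᵒᵖ) (B ⊗[k] Bᵐᵒᵖ) t ∘ₗ γ) := by
  obtain ⟨π, h1, h2, h3⟩ := ProjectiveResolution.exists_hom_zero (R := B ⊗[k] Bᵐᵒᵖ) (M := B)
    (B ⊗[k] Bᵐᵒᵖ) ε hε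
  refine ⟨π, h1, h2, fun t γ => ?_⟩
  rw [act_eq_comp]
  exact h3 (LinearMap.toSpanSingleton (B ⊗[k] Bᵐᵒᵖ) (B ⊗[k] Bᵐᵒᵖ) t) γ

theorem EnvelopingExt.exists_hom_succ {P : ℕ → Type v} [∀ i, AddCommGroup (P i)]
    [∀ i, Module (B ⊗[k] Bᵐᵒᵖ) (P i)] [∀ i, Module.Projective (B ⊗[k] Bᵐᵒᵖ) (P i)]
    (d : ∀ i, P (i + 1) →ₗ[B ⊗[k] Bᵐᵒᵖ] P i) (ε : P 0 →ₗ[B ⊗[k] Bᵐᵒᵖ] B)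
    (hε : Function.Surjective ε) (h0 : Function.Exact (d 0) ε)
    (hd : ∀ i, Function.Exact (d (i + 1)) (d i)) (m : ℕ) (hz : d (m + 1) = 0) :
    ∃ π : (P (m + 1) →ₗ[B ⊗[k] Bᵐᵒᵖ] B ⊗[k] Bᵐᵒᵖ) →+ EnvelopingExt k B (m + 1),
      Function.Surjective π ∧
      (∀ γ, π γ = 0 ↔ ∃ g : P m →ₗ[B ⊗[k] Bᵐᵒᵖ] B ⊗[k] Bᵐᵒᵖ, γ = g ∘ₗ d m) ∧
      ∀ t γ, EnvelopingExt.act t (π γ) =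
        π (LinearMap.toSpanSingleton (B ⊗[k] Bᵐᵒᵖ) (B ⊗[k] Bᵐᵒᵖ) t ∘ₗ γ) := by
  obtain ⟨π, h1, h2, h3⟩ := ProjectiveResolution.exists_hom_succ (R := B ⊗[k] Bᵐᵒᵖ) (M := B)
    (B ⊗[k] Bᵐᵒᵖ) d ε hε h0 hd m hz
  refine ⟨π, h1, h2, fun t γ => ?_⟩
  rw [act_eq_comp]
  exact h3 (LinearMap.toSpanSingleton (B ⊗[k] Bᵐᵒᵖ) (B ⊗[k] Bᵐᵒᵖ) t) γ

end EnvelopingExt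

section ExtPresentation

variable {k : Type u} [Field k] {A : Type v} [Ring A] [Algebra k A]
  {𝒜 : ℕ → Submodule k A} [SetLike.GradedMonoid 𝒜] [DirectSum.Decomposition 𝒜]

omit [SetLike.GradedMonoid 𝒜] in
theorem SupportedAt.eq_zero {W : Type*} [AddCommGroup W] [Module k W] {i : ℕ} (h : 𝒜 i = ⊥)
    {φ : A →ₗ[k] W} (hφ : SupportedAt 𝒜 i φ) : φ = 0 := by
  ext1 a
  have h1 : homPart 𝒜 i a ∈ (⊥ : Submodule k A) := h ▸ homPart_mem 𝒜 i a
  rw [← hφ.comp_homPart, (Submodule.mem_bot k).mp h1, map_zero]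
  rfl

variable [Module.Finite k A] (R : LinearResolution 𝒜) {V : Type*} [Fintype V]
  (S : SplitGrading 𝒜 V) {ι : Type*} [Fintype ι] (D : DualFamily 𝒜 ι)

attribute [local instance] instModuleTensorProductMop

include R S in
/-- The Koszul bimodule complex computes the extension group in the top degree: as `A_{n+1} = 0`,
the complex is a projective resolution of length `n`. -/
theorem exists_koszulCochain_hom {n : ℕ} (hn : 𝒜 (n + 1) = ⊥) :
    ∃ π : (koszulTerm 𝒜 n →ₗ[DualEnv 𝒜] DualEnv 𝒜) →+ EnvelopingExt k (QuadraticDual 𝒜) n,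
      Function.Surjective π ∧ (∀ γ, π γ = 0 ↔ IsKoszulCoboundary D n γ) ∧
      ∀ t γ, EnvelopingExt.act t (π γ) = π (koszulRMul 𝒜 n t γ) := by
  have hproj : ∀ i, Module.Projective (DualEnv 𝒜) (koszulTerm 𝒜 i) := projective_koszulTerm S
  have hzero : ∀ φ : koszulTerm 𝒜 (n + 1), φ = 0 := fun φ => Subtype.ext (φ.2.1.eq_zero hn)
  cases n with
  | zero =>
    have hinj : Function.Injective (koszulε 𝒜) := by
      rw [injective_iff_map_eq_zero]
      intro φ hφ
      obtain ⟨ψ, rfl⟩ := (R.exact_koszulε S D φ).mp hφ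
      rw [hzero ψ]
      exact (koszulD D 0).map_zero
    exact EnvelopingExt.exists_hom_zero (koszulε 𝒜) ⟨hinj, koszulε_surjective S⟩
  | succ m =>
    exact EnvelopingExt.exists_hom_succ (P := fun i => koszulTerm 𝒜 i)
      (koszulD D) (koszulε 𝒜) (koszulε_surjective S) (R.exact_koszulε S D) (R.exact_koszulD S D) m
      (LinearMap.ext fun φ => (congrArg _ (hzero φ)).trans (koszulD D (m + 1)).map_zero)

/-- A presentation of the bimodule `Ext^n_{B^e}(B, B^e)`, where `B` is the quadratic dual of `A`, by
generators `η x` for `x ∈ A`: it is generated by `A`, as a bimodule over the degree zero component,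
in degree `n`, subject to the relations `∑ η(x a_s) a_s^* + (-1)^n a_s^* η(a_s x) = 0`. The last two
fields say that these elements generate the bimodule, and that maps to algebras over `B` can be
defined by their values on generators. -/
structure IsExtPresentation (n : ℕ) (η : A →+ EnvelopingExt k (QuadraticDual 𝒜) n) : Prop where
  supported : ∀ l, l ≠ n → ∀ x ∈ 𝒜 l, η x = 0
  coe_mul : ∀ (c : 𝒜 0) x, η (c * x) = QuadraticDual.coeff 𝒜 c • η x
  mul_coe : ∀ (c : 𝒜 0) x, η (x * c) = MulOpposite.op (QuadraticDual.coeff 𝒜 c) • η x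
  relation : ∀ x, ∑ s, MulOpposite.op (QuadraticDual.gen (D.covec s)) • η (x * D.elt s) +
    ∑ s, QuadraticDual.gen (D.covec s) • η ((-1 : k) ^ n • (D.elt s * x)) = 0
  induction : ∀ H : AddSubgroup (EnvelopingExt k (QuadraticDual 𝒜) n), (∀ x, η x ∈ H) →
    (∀ (b : QuadraticDual 𝒜), ∀ m ∈ H, b • m ∈ H) →
    (∀ (b : QuadraticDual 𝒜), ∀ m ∈ H, MulOpposite.op b • m ∈ H) → ∀ m, m ∈ H
  exists_lift : ∀ {C : Type max u v} [Ring C] [Algebra k C] (f : QuadraticDual 𝒜 →ₐ[k] C)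
    (h : A →ₗ[k] C), (∀ l, l ≠ n → ∀ a ∈ 𝒜 l, h a = 0) →
    (∀ (c : 𝒜 0) x, h (c * x) = f (QuadraticDual.coeff 𝒜 c) * h x) →
    (∀ (c : 𝒜 0) x, h (x * c) = h x * f (QuadraticDual.coeff 𝒜 c)) →
    (∀ x, ∑ s, h (x * D.elt s) * f (QuadraticDual.gen (D.covec s)) +
      ∑ s, f (QuadraticDual.gen (D.covec s)) * h ((-1 : k) ^ n • (D.elt s * x)) = 0) →
    ∃ Φ : EnvelopingExt k (QuadraticDual 𝒜) n →+ C, (∀ b m, Φ (b • m) = f b * Φ m) ∧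
      (∀ (b : QuadraticDual 𝒜) m, Φ (MulOpposite.op b • m) = Φ m * f b) ∧ ∀ x, Φ (η x) = h x

theorem exists_addMonoidHom_factor {G H C : Type*} [AddCommGroup G] [AddCommGroup H]
    [AddCommGroup C] (π : G →+ H) (hπ : Function.Surjective π) (g : G →+ C)
    (h : ∀ x, π x = 0 → g x = 0) : ∃ Φ : H →+ C, ∀ x, Φ (π x) = g x :=
  ⟨π.liftOfSurjective hπ ⟨g, fun x hx => h x hx⟩, fun _ =>
    AddMonoidHom.liftOfRightInverse_comp_apply ..⟩

section

variable {n : ℕ}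
  {π : (koszulTerm 𝒜 n →ₗ[DualEnv 𝒜] DualEnv 𝒜) →+ EnvelopingExt k (QuadraticDual 𝒜) n}
  (hsurj : Function.Surjective π) (hker : ∀ γ, π γ = 0 ↔ IsKoszulCoboundary D n γ)
  (hact : ∀ t γ, EnvelopingExt.act t (π γ) = π (koszulRMul 𝒜 n t γ))

omit [DirectSum.Decomposition 𝒜] [Module.Finite k A] in
include hact in
theorem smul_koszulCochain (b : QuadraticDual 𝒜) (γ : koszulTerm 𝒜 n →ₗ[DualEnv 𝒜] DualEnv 𝒜) :
    b • π γ = π (koszulRMul 𝒜 n (1 ⊗ₜ MulOpposite.op b) γ) :=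
  hact _ γ

omit [DirectSum.Decomposition 𝒜] [Module.Finite k A] in
include hact in
theorem op_smul_koszulCochain (b : QuadraticDual 𝒜)
    (γ : koszulTerm 𝒜 n →ₗ[DualEnv 𝒜] DualEnv 𝒜) :
    MulOpposite.op b • π γ = π (koszulRMul 𝒜 n (b ⊗ₜ 1) γ) :=
  hact _ γ

omit [Module.Finite k A] in
include hker hact in
theorem koszulCochain_relation (x : A) :
    ∑ s, MulOpposite.op (QuadraticDual.gen (D.covec s)) • π (koszulEval 𝒜 n (x * D.elt s)) +
      ∑ s, QuadraticDual.gen (D.covec s) • π (koszulEval 𝒜 n ((-1 : k) ^ n • (D.elt s * x))) =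
        0 := by
  have h1 : π (∑ s, koszulRMul 𝒜 n (lgen (D.covec s)) (koszulEval 𝒜 n (x * D.elt s))) =
      ∑ s, MulOpposite.op (QuadraticDual.gen (D.covec s)) • π (koszulEval 𝒜 n (x * D.elt s)) :=
    (map_sum π _ _).trans (Finset.sum_congr rfl fun s _ => (op_smul_koszulCochain hact _ _).symm)
  have h2 : π (∑ s, koszulRMul 𝒜 n (rgen (D.covec s))
        (koszulEval 𝒜 n ((-1 : k) ^ n • (D.elt s * x)))) =
      ∑ s, QuadraticDual.gen (D.covec s) • π (koszulEval 𝒜 n ((-1 : k) ^ n • (D.elt s * x))) :=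
    (map_sum π _ _).trans (Finset.sum_congr rfl fun s _ => (smul_koszulCochain hact _ _).symm)
  rw [← h1, ← h2, ← π.map_add]
  exact (hker _).mpr (isKoszulCoboundary_relation D n x)

include S hsurj hact in
theorem koszulCochain_induction (H : AddSubgroup (EnvelopingExt k (QuadraticDual 𝒜) n))
    (h0 : ∀ x, π (koszulEval 𝒜 n x) ∈ H) (h1 : ∀ (b : QuadraticDual 𝒜), ∀ m ∈ H, b • m ∈ H)
    (h2 : ∀ (b : QuadraticDual 𝒜), ∀ m ∈ H, MulOpposite.op b • m ∈ H)
    (m : EnvelopingExt k (QuadraticDual 𝒜) n) : m ∈ H := by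
  have h3 : ∀ (t : DualEnv 𝒜) x, EnvelopingExt.act t (π (koszulEval 𝒜 n x)) ∈ H := by
    intro t x
    induction t using TensorProduct.induction_on with
    | zero => rw [EnvelopingExt.act_zero]; exact zero_mem _
    | add s t hs ht => rw [EnvelopingExt.act_add]; exact add_mem hs ht
    | tmul b c =>
      have h3 : b ⊗ₜ[k] c = (1 ⊗ₜ[k] MulOpposite.op c.unop) * (b ⊗ₜ[k] 1) := by
        rw [Algebra.TensorProduct.tmul_mul_tmul, one_mul, mul_one, MulOpposite.op_unop]
      rw [h3, EnvelopingExt.act_mul]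
      exact h2 b _ (h1 c.unop _ (h0 _))
  obtain ⟨γ, rfl⟩ := hsurj m
  have h4 := (congrArg π (eq_sum_koszulRMul S n γ)).trans (map_sum π _ _)
  rw [h4]
  refine AddSubgroup.sum_mem _ fun r _ => ?_
  rw [← hact]
  exact h3 _ _

include S hsurj hker hact in
theorem exists_lift_koszulCochain {C : Type*} [Ring C] [Algebra k C] (f : QuadraticDual 𝒜 →ₐ[k] C)
    (h : A →ₗ[k] C) (hs : ∀ l, l ≠ n → ∀ a ∈ 𝒜 l, h a = 0)
    (hl : ∀ (c : 𝒜 0) x, h (c * x) = f (QuadraticDual.coeff 𝒜 c) * h x)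
    (hr : ∀ (c : 𝒜 0) x, h (x * c) = h x * f (QuadraticDual.coeff 𝒜 c))
    (hrel : ∀ x, ∑ s, h (x * D.elt s) * f (QuadraticDual.gen (D.covec s)) +
      ∑ s, f (QuadraticDual.gen (D.covec s)) * h ((-1 : k) ^ n • (D.elt s * x)) = 0) :
    ∃ Φ : EnvelopingExt k (QuadraticDual 𝒜) n →+ C, (∀ b m, Φ (b • m) = f b * Φ m) ∧
      (∀ (b : QuadraticDual 𝒜) m, Φ (MulOpposite.op b • m) = Φ m * f b) ∧
      ∀ x, Φ (π (koszulEval 𝒜 n x)) = h x := by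
  obtain ⟨Φ, hΦ⟩ := exists_addMonoidHom_factor
    (G := koszulTerm 𝒜 n →ₗ[DualEnv 𝒜] DualEnv 𝒜) π hsurj (cochainLift S f h n)
    fun γ hγ => cochainLift_eq_zero S D f h hs hl hr hrel ((hker γ).mp hγ)
  refine ⟨Φ, fun b m => ?_, fun b m => ?_, fun x => ?_⟩
  · obtain ⟨γ, rfl⟩ := hsurj m
    rw [smul_koszulCochain hact, hΦ, hΦ, cochainLift_koszulRMul]
    exact sandwich_one_tmul f b _
  · obtain ⟨γ, rfl⟩ := hsurj m
    rw [op_smul_koszulCochain hact, hΦ, hΦ, cochainLift_koszulRMul]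
    exact sandwich_tmul_one f b _
  · exact (hΦ _).trans (cochainLift_koszulEval S f h hs hl hr x)

end

include R S in
/-- The generators of the presentation are the classes of the evaluations. -/
theorem exists_isExtPresentation {n : ℕ} (hn : 𝒜 (n + 1) = ⊥) :
    ∃ η, IsExtPresentation D n η := by
  obtain ⟨π, hsurj, hker, hact⟩ := exists_koszulCochain_hom R S D hn
  refine ⟨π.comp (koszulEval 𝒜 n),
    { supported := fun l hl x hx => ?_
      coe_mul := fun c x => ?_
      mul_coe := fun c x => ?_
      relation := koszulCochain_relation D hker hact
      induction := koszulCochain_induction S hsurj hact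
      exists_lift := exists_lift_koszulCochain S D hsurj hker hact }⟩
  · rw [AddMonoidHom.comp_apply, koszulEval_eq_zero hl hx]
    exact π.map_zero
  · rw [AddMonoidHom.comp_apply, AddMonoidHom.comp_apply, smul_koszulCochain hact,
      koszulEval_coe_mul]
    rfl
  · rw [AddMonoidHom.comp_apply, AddMonoidHom.comp_apply, op_smul_koszulCochain hact,
      koszulEval_mul_coe]
    rfl

end ExtPresentation

/-! ### Bound quiver algebras -/

section PathAlgebraLift

variable {k : Type u} [Field k] {V : Type v} [Fintype V] [Quiver.{w} V]

namespace PathAlgebra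

variable {C : Type*} [Ring C] [Algebra k C]

/-- The universal property of the path algebra. -/
noncomputable def lift (f : V → C) (g : (Σ i j : V, i ⟶ j) → C) (h1 : ∀ i, f i * f i = f i)
    (h2 : ∀ i j, i ≠ j → f i * f j = 0) (h3 : ∑ i, f i = 1)
    (h4 : ∀ a : Σ i j : V, i ⟶ j, f a.1 * g a = g a)
    (h5 : ∀ a : Σ i j : V, i ⟶ j, g a * f a.2.1 = g a) : PathAlgebra k V →ₐ[k] C :=
  RingQuot.liftAlgHom k ⟨FreeAlgebra.lift k (Sum.elim f g), by
    rintro _ _ (i | ⟨i, j, h⟩ | _ | a | a)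
    · simp [h1]
    · simp [h2 i j h]
    · simp [h3]
    · simpa using h4 ⟨_, _, a⟩
    · simpa using h5 ⟨_, _, a⟩⟩

section

variable (f : V → C) (g : (Σ i j : V, i ⟶ j) → C) (h1 : ∀ i, f i * f i = f i)
    (h2 : ∀ i j, i ≠ j → f i * f j = 0) (h3 : ∑ i, f i = 1)
    (h4 : ∀ a : Σ i j : V, i ⟶ j, f a.1 * g a = g a)
    (h5 : ∀ a : Σ i j : V, i ⟶ j, g a * f a.2.1 = g a)

theorem lift_vertex (i : V) : lift (k := k) f g h1 h2 h3 h4 h5 (vertex k i) = f i := by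
  refine (RingQuot.liftAlgHom_mkAlgHom_apply _ _ _ _).trans ?_
  simp

theorem lift_arrow {i j : V} (a : i ⟶ j) :
    lift (k := k) f g h1 h2 h3 h4 h5 (arrow k a) = g ⟨i, j, a⟩ := by
  refine (RingQuot.liftAlgHom_mkAlgHom_apply _ _ _ _).trans ?_
  simp

end

variable (k V) in
theorem iSup_grading : ⨆ d, grading k V d = ⊤ := by
  have hmul : ∀ x ∈ ⨆ d, grading k V d, ∀ y ∈ ⨆ d, grading k V d, x * y ∈ ⨆ d, grading k V d := by
    intro x hx y hy
    induction hx using Submodule.iSup_induction' with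
    | zero => rw [zero_mul]; exact zero_mem _
    | add x x' _ _ h h' => rw [add_mul]; exact add_mem h h'
    | mem d x hx =>
      induction hy using Submodule.iSup_induction' with
      | zero => rw [mul_zero]; exact zero_mem _
      | add y y' _ _ h h' => rw [mul_add]; exact add_mem h h'
      | mem e y hy =>
        exact Submodule.mem_iSup_of_mem (d + e) (SetLike.mul_mem_graded hx hy)
  rw [eq_top_iff]
  rintro x -
  obtain ⟨y, rfl⟩ := RingQuot.mkAlgHom_surjective k (PathAlgebra.Rel k V) x
  induction y using FreeAlgebra.induction with
  | grade0 r =>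
    rw [AlgHom.commutes]
    exact Submodule.mem_iSup_of_mem 0 (SetLike.algebraMap_mem_graded (grading k V) r)
  | grade1 x =>
    rcases x with i | ⟨i, j, a⟩
    · exact Submodule.mem_iSup_of_mem 0 (Submodule.subset_span ⟨i, i, .nil, rfl, rfl⟩)
    · refine Submodule.mem_iSup_of_mem 1 (Submodule.subset_span ⟨i, j, a.toPath, rfl, ?_⟩)
      exact (vertex_mul_arrow k a).symm
  | mul x y hx hy => rw [map_mul]; exact hmul _ hx _ hy
  | add x y hx hy => rw [map_add]; exact add_mem hx hy

end PathAlgebra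

end PathAlgebraLift

namespace BoundQuiverAlgebra

variable {k : Type u} [Field k] {V : Type v} [Fintype V] [Quiver.{w} V]
  {I : Ideal (PathAlgebra k V)} [I.IsTwoSided]

theorem ofPath_mem {i j : V} (p : Quiver.Path i j) : ofPath I p ∈ grading I p.length :=
  ⟨_, Submodule.subset_span ⟨i, j, p, rfl, rfl⟩, rfl⟩

variable (I) in
theorem grading_eq_span (d : ℕ) : grading I d =
    Submodule.span k {x | ∃ (i j : V) (p : Quiver.Path i j), p.length = d ∧ x = ofPath I p} := by
  rw [grading, PathAlgebra.grading, Submodule.map_span]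
  congr 1
  ext x
  constructor
  · rintro ⟨_, ⟨i, j, p, hp, rfl⟩, rfl⟩
    exact ⟨i, j, p, hp, rfl⟩
  · rintro ⟨i, j, p, hp, rfl⟩
    exact ⟨_, ⟨i, j, p, hp, rfl⟩, rfl⟩

variable (I) in
theorem iSup_grading : ⨆ d, grading I d = ⊤ := by
  unfold grading
  rw [← Submodule.map_iSup, PathAlgebra.iSup_grading, Submodule.map_top, LinearMap.range_eq_top]
  exact Ideal.Quotient.mkₐ_surjective k I

/-- The homomorphism of algebras `x ↦ x t^d`, for `x` of degree `d`, that defines the grading, on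
the path algebra. -/
noncomputable def gradingHomAux :
    PathAlgebra k V →ₐ[k] Polynomial (BoundQuiverAlgebra I) :=
  PathAlgebra.lift
    (fun i => Polynomial.monomial 0 (Ideal.Quotient.mkₐ k I (PathAlgebra.vertex k i)))
    (fun a => Polynomial.monomial 1 (Ideal.Quotient.mkₐ k I (PathAlgebra.arrow k a.2.2)))
    (fun i => by rw [Polynomial.monomial_mul_monomial, ← map_mul, PathAlgebra.vertex_mul_self])
    (fun i j h => by
      rw [Polynomial.monomial_mul_monomial, ← map_mul, PathAlgebra.vertex_mul_of_ne k h, map_zero,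
        map_zero])
    (by rw [← map_sum, ← map_sum, PathAlgebra.sum_vertex, map_one, Polynomial.monomial_zero_one])
    (fun a => by rw [Polynomial.monomial_mul_monomial, ← map_mul, PathAlgebra.vertex_mul_arrow])
    (fun a => by rw [Polynomial.monomial_mul_monomial, ← map_mul, PathAlgebra.arrow_mul_vertex])

theorem gradingHomAux_ofPath {i j : V} (p : Quiver.Path i j) :
    gradingHomAux (I := I) (PathAlgebra.ofPath k p) =
      Polynomial.monomial p.length (ofPath I p) := by
  induction p with
  | nil => exact PathAlgebra.lift_vertex ..
  | cons p a ih =>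
    rw [PathAlgebra.ofPath, map_mul, ih, gradingHomAux, PathAlgebra.lift_arrow,
      Polynomial.monomial_mul_monomial]
    rfl

theorem gradingHomAux_of_mem {d : ℕ} {x : PathAlgebra k V} (hx : x ∈ PathAlgebra.grading k V d) :
    gradingHomAux (I := I) x = Polynomial.monomial d (Ideal.Quotient.mkₐ k I x) := by
  induction hx using Submodule.span_induction with
  | zero => simp only [map_zero]
  | add x y _ _ hx hy => simp only [map_add, hx, hy]
  | smul r x _ hx => rw [map_smul, hx, map_smul, Polynomial.smul_monomial]
  | mem x hx =>
    obtain ⟨i, j, p, rfl, rfl⟩ := hx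
    exact gradingHomAux_ofPath p

theorem gradingHomAux_eq_zero (hI : IsBoundIdeal k V I) {x : PathAlgebra k V} (hx : x ∈ I) :
    gradingHomAux (I := I) x = 0 := by
  have hspan := hI.homogeneous x hx
  clear hx
  induction hspan using Submodule.span_induction with
  | zero => exact map_zero _
  | add x y _ _ hx hy => rw [map_add, hx, hy, add_zero]
  | smul r x _ hx => rw [map_smul, hx, smul_zero]
  | mem x hx =>
    obtain ⟨hx, d, hd⟩ := hx
    have h : Ideal.Quotient.mkₐ k I x = 0 := Ideal.Quotient.eq_zero_iff_mem.mpr hx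
    rw [gradingHomAux_of_mem hd, h, map_zero]

/-- The homomorphism of algebras `x ↦ x t^d`, for `x` of degree `d`, that defines the grading. -/
noncomputable def gradingHom (hI : IsBoundIdeal k V I) :
    BoundQuiverAlgebra I →ₐ[k] Polynomial (BoundQuiverAlgebra I) :=
  Ideal.Quotient.liftₐ I gradingHomAux fun _ hx => gradingHomAux_eq_zero hI hx

theorem gradingHom_of_mem (hI : IsBoundIdeal k V I) {d : ℕ} {x : BoundQuiverAlgebra I}
    (hx : x ∈ grading I d) : gradingHom hI x = Polynomial.monomial d x := by
  obtain ⟨y, hy, rfl⟩ := hx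
  exact gradingHomAux_of_mem hy

/-- The coefficients of `gradingHom` recover the homogeneous components. -/
theorem isInternal_grading (hI : IsBoundIdeal k V I) : DirectSum.IsInternal (grading I) := by
  constructor
  · rw [injective_iff_map_eq_zero]
    intro f hf
    have key : ∀ (f : DirectSum ℕ fun d => grading I d) (d : ℕ),
        (gradingHom hI (DirectSum.coeAddMonoidHom (grading I) f)).coeff d = f d := by
      intro f d
      induction f using DirectSum.induction_on with
      | zero => simp
      | add f g hf hg => rw [map_add, map_add, Polynomial.coeff_add, hf, hg]; rfl
      | of e x =>
        rw [DirectSum.coeAddMonoidHom_of, gradingHom_of_mem hI x.2, Polynomial.coeff_monomial]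
        split_ifs with h
        · subst h; rw [DirectSum.of_eq_same]
        · rw [DirectSum.of_eq_of_ne _ _ _ (Ne.symm h)]; rfl
    refine DFinsupp.ext fun d => Subtype.ext ?_
    rw [← key f d, hf, map_zero]
    rfl
  · intro x
    have hx : x ∈ ⨆ d, grading I d := by rw [iSup_grading]; exact Submodule.mem_top
    induction hx using Submodule.iSup_induction' with
    | zero => exact ⟨0, map_zero _⟩
    | add x y _ _ hx hy =>
      obtain ⟨f, rfl⟩ := hx
      obtain ⟨g, rfl⟩ := hy
      exact ⟨f + g, map_add _ _ _⟩
    | mem d x hx => exact ⟨DirectSum.of _ d ⟨x, hx⟩, DirectSum.coeAddMonoidHom_of _ _ _⟩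

section Finite

variable [∀ i j : V, Finite (i ⟶ j)]

variable (I) in
theorem finite_setOf_ofPath (d : ℕ) :
    {x | ∃ (i j : V) (p : Quiver.Path i j), p.length = d ∧ x = ofPath I p}.Finite := by
  induction d with
  | zero =>
    refine (Set.finite_range fun i : V => ofPath I (Quiver.Path.nil (a := i))).subset ?_
    rintro _ ⟨i, j, p, hp, rfl⟩
    cases p with
    | nil => exact ⟨i, rfl⟩
    | cons p a => simp at hp
  | succ d ih =>
    refine (ih.image2 (· * ·) (Set.finite_range fun a : Σ i j : V, i ⟶ j =>
      Ideal.Quotient.mkₐ k I (PathAlgebra.arrow k a.2.2))).subset ?_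
    rintro _ ⟨i, j, p, hp, rfl⟩
    cases p with
    | nil => simp at hp
    | cons p a =>
      rw [Quiver.Path.length_cons, Nat.add_right_cancel_iff] at hp
      exact ⟨_, ⟨_, _, p, hp, rfl⟩, _, ⟨⟨_, _, a⟩, rfl⟩, (map_mul _ _ _).symm⟩

theorem module_finite (hI : IsBoundIdeal k V I) : Module.Finite k (BoundQuiverAlgebra I) := by
  obtain ⟨N, hN⟩ := hI.ge
  have hfin : (⋃ d ∈ Set.Iio N,
      {x | ∃ (i j : V) (p : Quiver.Path i j), p.length = d ∧ x = ofPath I p}).Finite :=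
    (Set.finite_Iio N).biUnion fun d _ => finite_setOf_ofPath I d
  refine ⟨Submodule.fg_def.mpr ⟨_, hfin, eq_top_iff.mpr ?_⟩⟩
  rw [← iSup_grading I]
  refine iSup_le fun d => ?_
  rw [grading_eq_span, Submodule.span_le]
  rintro _ ⟨i, j, p, rfl, rfl⟩
  by_cases h : p.length < N
  · exact Submodule.subset_span (Set.mem_biUnion h ⟨i, j, p, rfl, rfl⟩)
  · have h0 : ofPath I p = 0 := Ideal.Quotient.eq_zero_iff_mem.mpr (hN i j p (not_lt.mp h))
    rw [h0]
    exact zero_mem _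

end Finite

/-- A nonzero path can be extended to a maximal bound path, so that its length is at most `n` if the
algebra is `n`-homogeneous. -/
theorem IsHomogeneous.length_le {n : ℕ} (hn : IsHomogeneous I n) (hI : IsBoundIdeal k V I) {i j : V}
    {p : Quiver.Path i j} (hp : ofPath I p ≠ 0) : p.length ≤ n := by
  obtain ⟨N, hN⟩ := hI.ge
  have main : ∀ m (i j : V) (p : Quiver.Path i j), N - p.length = m → ofPath I p ≠ 0 →
      p.length ≤ n := by
    intro m
    induction m with
    | zero =>
      intro i j p hm hp
      exact absurd (Ideal.Quotient.eq_zero_iff_mem.mpr (hN i j p (by omega))) hp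
    | succ m ih =>
      intro i j p hm hp
      by_cases hmax : IsMaximalBoundPath I p
      · exact (hn i j p hmax).le
      · have h : (∃ (l : V) (a : j ⟶ l), ofPath I (p.cons a) ≠ 0) ∨
            ∃ (l : V) (a : l ⟶ i), ofPath I (a.toPath.comp p) ≠ 0 := by
          by_contra! h
          exact hmax ⟨hp, h.1, h.2⟩
        rcases h with ⟨l, a, h⟩ | ⟨l, a, h⟩
        · have h1 : (p.cons a).length = p.length + 1 := rfl
          have h2 := ih i l (p.cons a) (by omega) h
          omega
        · have h1 : (a.toPath.comp p).length = 1 + p.length := Quiver.Path.length_comp _ _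
          have h2 := ih l j (a.toPath.comp p) (by omega) h
          omega
  exact main _ i j p rfl hp

theorem IsHomogeneous.grading_succ {n : ℕ} (hn : IsHomogeneous I n) (hI : IsBoundIdeal k V I) :
    grading I (n + 1) = ⊥ := by
  rw [grading_eq_span, Submodule.span_eq_bot]
  rintro _ ⟨i, j, p, hp, rfl⟩
  by_contra h
  have := hn.length_le hI h
  omega

/-- The homomorphism from the path algebra to the algebra of functions on the vertices. -/
noncomputable def vertexHom [DecidableEq V] : PathAlgebra k V →ₐ[k] (V → k) :=
  PathAlgebra.lift (fun i => Pi.single i 1) 0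
    (fun i => by rw [← Pi.single_mul, one_mul])
    (fun i j h => by
      ext l
      by_cases hl : l = i
      · subst hl; simp [h]
      · simp [hl])
    (Finset.univ_sum_single 1) (fun _ => mul_zero _) (fun _ => zero_mul _)

theorem vertexHom_of_mem [DecidableEq V] {d : ℕ} {x : PathAlgebra k V}
    (hx : x ∈ PathAlgebra.grading k V (d + 1)) : vertexHom x = 0 := by
  induction hx using Submodule.span_induction with
  | zero => exact map_zero _
  | add x y _ _ hx hy => rw [map_add, hx, hy, add_zero]
  | smul r x _ hx => rw [map_smul, hx, smul_zero]
  | mem x hx =>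
    obtain ⟨i, j, p, hp, rfl⟩ := hx
    cases p with
    | nil => simp at hp
    | cons p a =>
      rw [PathAlgebra.ofPath, map_mul, vertexHom, PathAlgebra.lift_arrow]
      exact mul_zero _

omit [I.IsTwoSided] in
theorem vertexHom_eq_zero [DecidableEq V] (hI : IsBoundIdeal k V I) {x : PathAlgebra k V}
    (hx : x ∈ I) : vertexHom x = 0 := by
  have hx' := hI.le x hx
  clear hx
  induction hx' using Submodule.iSup_induction' with
  | zero => exact map_zero vertexHom
  | add x y _ _ hx hy => rw [map_add, hx, hy, add_zero]
  | mem d x hx => exact vertexHom_of_mem hx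

/-- The sum of the coefficients of the vertices. -/
noncomputable def augmentation [DecidableEq V] (hI : IsBoundIdeal k V I) :
    BoundQuiverAlgebra I →ₗ[k] k :=
  (∑ i : V, LinearMap.proj i) ∘ₗ
    (Ideal.Quotient.liftₐ I vertexHom fun _ hx => vertexHom_eq_zero hI hx).toLinearMap

theorem augmentation_mk [DecidableEq V] (hI : IsBoundIdeal k V I) (x : PathAlgebra k V) :
    augmentation hI (Ideal.Quotient.mkₐ k I x) = ∑ i : V, vertexHom x i :=
  LinearMap.sum_apply _ _ _

theorem augmentation_vertex [DecidableEq V] (hI : IsBoundIdeal k V I) (i : V) :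
    augmentation hI (ofPath I (Quiver.Path.nil (a := i))) = 1 := by
  rw [ofPath, PathAlgebra.ofPath, augmentation_mk, vertexHom, PathAlgebra.lift_vertex]
  simp

theorem augmentation_of_mem [DecidableEq V] (hI : IsBoundIdeal k V I) {d : ℕ} (hd : 0 < d)
    {a : BoundQuiverAlgebra I} (ha : a ∈ grading I d) : augmentation hI a = 0 := by
  obtain ⟨d, rfl⟩ := Nat.exists_eq_succ_of_ne_zero hd.ne'
  obtain ⟨x, hx, rfl⟩ := ha
  refine (augmentation_mk hI x).trans ?_
  rw [vertexHom_of_mem hx]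
  exact Finset.sum_const_zero

theorem ofPath_nil_mem (i : V) : ofPath I (Quiver.Path.nil (a := i)) ∈ grading I 0 := by
  have h := ofPath_mem (I := I) (Quiver.Path.nil (a := i))
  rwa [Quiver.Path.length_nil] at h

theorem ofPath_nil_mul_self (i : V) :
    ofPath I (Quiver.Path.nil (a := i)) * ofPath I (Quiver.Path.nil (a := i)) =
      ofPath I (Quiver.Path.nil (a := i)) := by
  unfold ofPath PathAlgebra.ofPath
  rw [← map_mul, PathAlgebra.vertex_mul_self]

theorem ofPath_nil_mul_of_ne {i j : V} (h : i ≠ j) :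
    ofPath I (Quiver.Path.nil (a := i)) * ofPath I (Quiver.Path.nil (a := j)) = 0 := by
  unfold ofPath PathAlgebra.ofPath
  rw [← map_mul, PathAlgebra.vertex_mul_of_ne k h]
  exact map_zero (Ideal.Quotient.mkₐ k I)

variable (I) in
theorem sum_ofPath_nil : ∑ i : V, ofPath I (Quiver.Path.nil (a := i)) = 1 := by
  unfold ofPath PathAlgebra.ofPath
  rw [← map_sum (Ideal.Quotient.mkₐ k I), PathAlgebra.sum_vertex]
  exact map_one (Ideal.Quotient.mkₐ k I)

theorem exists_eq_sum_ofPath_nil {c : BoundQuiverAlgebra I} (hc : c ∈ grading I 0) :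
    ∃ r : V → k, c = ∑ i, r i • ofPath I (Quiver.Path.nil (a := i)) := by
  classical
  rw [grading_eq_span] at hc
  induction hc using Submodule.span_induction with
  | zero => exact ⟨0, by simp only [Pi.zero_apply, zero_smul, Finset.sum_const_zero]⟩
  | add x y _ _ hx hy =>
    obtain ⟨r, rfl⟩ := hx
    obtain ⟨s, rfl⟩ := hy
    exact ⟨r + s, by simp only [Pi.add_apply, add_smul, Finset.sum_add_distrib]⟩
  | smul t x _ hx =>
    obtain ⟨r, rfl⟩ := hx
    exact ⟨t • r, by simp only [Pi.smul_apply, smul_assoc, Finset.smul_sum]⟩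
  | mem x hx =>
    obtain ⟨i, j, p, hp, rfl⟩ := hx
    cases p with
    | nil =>
      refine ⟨Pi.single i 1, ?_⟩
      rw [Finset.sum_eq_single i, Pi.single_eq_same, one_smul]
      · intro j _ h
        rw [Pi.single_eq_of_ne h, zero_smul]
      · exact fun h => absurd (Finset.mem_univ i) h
    | cons p a => simp at hp

open scoped Classical in
/-- The vertices as a complete set of orthogonal idempotents that span the component of degree
zero. -/
noncomputable def splitGrading (hI : IsBoundIdeal k V I) : SplitGrading (grading I) V where
  idem i := ⟨ofPath I (Quiver.Path.nil (a := i)), ofPath_nil_mem i⟩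
  idem_mul_self i := by
    apply Subtype.ext
    rw [SetLike.GradeZero.coe_mul]
    exact ofPath_nil_mul_self i
  idem_mul_ne _ _ h := by
    apply Subtype.ext
    rw [SetLike.GradeZero.coe_mul, ZeroMemClass.coe_zero]
    exact ofPath_nil_mul_of_ne h
  sum_idem := by
    apply Subtype.ext
    rw [AddSubmonoidClass.coe_finsetSum, SetLike.GradeZero.coe_one]
    exact sum_ofPath_nil I
  exists_coeff c := exists_eq_sum_ofPath_nil c.2
  aug := augmentation hI
  aug_idem := augmentation_vertex hI
  aug_pos _ h _ ha := augmentation_of_mem hI h ha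

theorem signAut_of_mem (hI : IsBoundIdeal k V I) (n : ℕ) {d : ℕ} {x : BoundQuiverAlgebra I}
    (hx : x ∈ grading I d) : signAut hI n x = ((-1 : k) ^ n) ^ d • x := by
  obtain ⟨y, hy, rfl⟩ := hx
  change Ideal.Quotient.mkₐ k I (PathAlgebra.signHom k V n y) = _
  rw [PathAlgebra.signHom_of_mem k n hy, map_smul]
  rfl

end BoundQuiverAlgebra

/-! ### The quadratic dual of a twisted trivial extension -/

/-- The grading of the trivial extension `A ⋉ (_νA)^∨` with component of degree `d` equal to
`A_d ⊕ (A_{n+1-d})^∨`, where `ν` is multiplication by `(-1)^{nd}` in degree `d`. -/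
structure IsTrivialExtensionGrading {k : Type u} [Field k] {A : Type v} [Ring A] [Algebra k A]
    (𝒜 : ℕ → Submodule k A) (ν : A ≃ₐ[k] A) (n : ℕ)
    (𝒯 : ℕ → Submodule k (TrivSqZeroExt A (TwistedDual ν))) : Prop where
  aut_apply : ∀ d, ∀ x ∈ 𝒜 d, ν x = ((-1 : k) ^ n) ^ d • x
  mem_iff : ∀ d x, x ∈ 𝒯 d ↔ x.fst ∈ 𝒜 d ∧
    ∀ i, i + d ≠ n + 1 → ∀ a ∈ 𝒜 i, TwistedDual.toDual ν x.snd a = 0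

namespace IsTrivialExtensionGrading

variable {k : Type u} [Field k] {A : Type v} [Ring A] [Algebra k A]
  {𝒜 : ℕ → Submodule k A} {ν : A ≃ₐ[k] A} {n : ℕ}
  {𝒯 : ℕ → Submodule k (TrivSqZeroExt A (TwistedDual ν))}
  (H : IsTrivialExtensionGrading 𝒜 ν n 𝒯)

include H in
theorem inl_mem {d : ℕ} {a : A} (ha : a ∈ 𝒜 d) :
    (TrivSqZeroExt.inl a : TrivSqZeroExt A (TwistedDual ν)) ∈ 𝒯 d :=
  (H.mem_iff d _).mpr ⟨ha, fun _ _ _ _ => rfl⟩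

/-- The projection `A₁ ⊕ (A_n)^∨ → A₁`. -/
def fstOne : DegreeOne 𝒯 →ₗ[k] DegreeOne 𝒜 where
  toFun τ := ⟨(DegreeOne.val 𝒯 τ).fst, ((H.mem_iff 1 _).mp τ.2).1⟩
  map_add' _ _ := rfl
  map_smul' _ _ := rfl

/-- The inclusion `A₁ → A₁ ⊕ (A_n)^∨`. -/
def inlOne : DegreeOne 𝒜 →ₗ[k] DegreeOne 𝒯 where
  toFun a := ⟨TrivSqZeroExt.inl (DegreeOne.val 𝒜 a), H.inl_mem a.2⟩
  map_add' _ _ := DegreeOne.val_injective (TrivSqZeroExt.inl_add _ _ _)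
  map_smul' _ _ := DegreeOne.val_injective (TrivSqZeroExt.inl_smul _ _ _)

/-- The projection `A₁ ⊕ (A_n)^∨ → A^∨`. -/
def sndOne (𝒯 : ℕ → Submodule k (TrivSqZeroExt A (TwistedDual ν))) :
    DegreeOne 𝒯 →ₗ[k] Module.Dual k A where
  toFun τ := TwistedDual.toDual ν (DegreeOne.val 𝒯 τ).snd
  map_add' _ _ := rfl
  map_smul' _ _ := rfl

/-- The map `g ↦ g ⊕ 0` on dual spaces. -/
def fstDual : DegreeOneDual 𝒜 →ₗ[k] DegreeOneDual 𝒯 :=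
  (DegreeOneDual.toDual 𝒯).symm.toLinearMap ∘ₗ H.fstOne.dualMap ∘ₗ
    (DegreeOneDual.toDual 𝒜).toLinearMap

/-- The restriction to `A₁` of a functional on `A₁ ⊕ (A_n)^∨`. -/
def inlDual : DegreeOneDual 𝒯 →ₗ[k] DegreeOneDual 𝒜 :=
  (DegreeOneDual.toDual 𝒜).symm.toLinearMap ∘ₗ H.inlOne.dualMap ∘ₗ
    (DegreeOneDual.toDual 𝒯).toLinearMap

/-- The evaluation at `x` as a functional on `A₁ ⊕ (A_n)^∨`. -/
def evalSnd (𝒯 : ℕ → Submodule k (TrivSqZeroExt A (TwistedDual ν))) :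
    A →ₗ[k] DegreeOneDual 𝒯 :=
  (DegreeOneDual.toDual 𝒯).symm.toLinearMap ∘ₗ (sndOne 𝒯).flip

theorem toDual_fstDual (g : DegreeOneDual 𝒜) (τ : DegreeOne 𝒯) :
    DegreeOneDual.toDual 𝒯 (H.fstDual g) τ = DegreeOneDual.toDual 𝒜 g (H.fstOne τ) := rfl

theorem toDual_inlDual (G : DegreeOneDual 𝒯) (a : DegreeOne 𝒜) :
    DegreeOneDual.toDual 𝒜 (H.inlDual G) a = DegreeOneDual.toDual 𝒯 G (H.inlOne a) := rfl

theorem toDual_evalSnd (x : A) (τ : DegreeOne 𝒯) :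
    DegreeOneDual.toDual 𝒯 (evalSnd 𝒯 x) τ = sndOne 𝒯 τ x := rfl

include H in
theorem sndOne_apply_of_mem (τ : DegreeOne 𝒯) {i : ℕ} (hi : i ≠ n) {x : A} (hx : x ∈ 𝒜 i) :
    sndOne 𝒯 τ x = 0 :=
  ((H.mem_iff 1 _).mp τ.2).2 i (by omega) x hx

include H in
theorem evalSnd_of_mem {i : ℕ} (hi : i ≠ n) {x : A} (hx : x ∈ 𝒜 i) : evalSnd 𝒯 x = 0 :=
  DegreeOneDual.ext fun τ => H.sndOne_apply_of_mem τ hi hx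

theorem inlDual_fstDual (g : DegreeOneDual 𝒜) : H.inlDual (H.fstDual g) = g := rfl

theorem inlDual_evalSnd (x : A) : H.inlDual (evalSnd 𝒯 x) = 0 := rfl

section Coefficients

variable [SetLike.GradedMonoid 𝒜] [SetLike.GradedMonoid 𝒯]

/-- The inclusion of the component of degree zero of `A`. -/
def inlZero : 𝒜 0 →ₐ[k] 𝒯 0 where
  toFun c := ⟨TrivSqZeroExt.inl (c : A), H.inl_mem c.2⟩
  map_one' := Subtype.ext (TrivSqZeroExt.inl_one _)
  map_mul' _ _ := Subtype.ext (TrivSqZeroExt.inl_mul _ _ _)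
  map_zero' := Subtype.ext (TrivSqZeroExt.inl_zero _)
  map_add' _ _ := Subtype.ext (TrivSqZeroExt.inl_add _ _ _)
  commutes' _ := rfl

/-- The projection to the component of degree zero of `A`. -/
def fstZero : 𝒯 0 →ₐ[k] 𝒜 0 where
  toFun c := ⟨(c : TrivSqZeroExt A (TwistedDual ν)).fst, ((H.mem_iff 0 _).mp c.2).1⟩
  map_one' := rfl
  map_mul' _ _ := rfl
  map_zero' := rfl
  map_add' _ _ := rfl
  commutes' _ := rfl

theorem coe_inlZero (c : 𝒜 0) : (H.inlZero c : TrivSqZeroExt A (TwistedDual ν)) =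
    TrivSqZeroExt.inl (c : A) := rfl

theorem fstZero_inlZero (c : 𝒜 0) : H.fstZero (H.inlZero c) = c := rfl

omit [SetLike.GradedMonoid 𝒜] [SetLike.GradedMonoid 𝒯] in
include H in
theorem aut_coe (c : 𝒜 0) : ν c = c := by
  rw [H.aut_apply 0 c c.2, pow_zero, one_smul]

theorem fstDual_smul (c : 𝒜 0) (g : DegreeOneDual 𝒜) :
    H.fstDual (c • g) = H.inlZero c • H.fstDual g := rfl

theorem fstDual_op_smul (c : 𝒜 0) (g : DegreeOneDual 𝒜) :
    H.fstDual (MulOpposite.op c • g) = MulOpposite.op (H.inlZero c) • H.fstDual g := rfl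

theorem evalSnd_coe_mul (c : 𝒜 0) (x : A) :
    evalSnd 𝒯 (c * x) = H.inlZero c • evalSnd 𝒯 x := by
  apply DegreeOneDual.ext
  intro τ
  rw [DegreeOneDual.toDual_smul, toDual_evalSnd, toDual_evalSnd]
  change TwistedDual.toDual ν (DegreeOne.val 𝒯 τ).snd (c * x) =
    TwistedDual.toDual ν (DegreeOne.val 𝒯 τ * TrivSqZeroExt.inl (c : A)).snd x
  rw [TrivSqZeroExt.snd_mul, TrivSqZeroExt.snd_inl, smul_zero, zero_add, TrivSqZeroExt.fst_inl,
    TwistedDual.toDual_op_smul, H.aut_coe]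

theorem evalSnd_mul_coe (c : 𝒜 0) (x : A) :
    evalSnd 𝒯 (x * c) = MulOpposite.op (H.inlZero c) • evalSnd 𝒯 x := by
  apply DegreeOneDual.ext
  intro τ
  rw [DegreeOneDual.toDual_op_smul, toDual_evalSnd, toDual_evalSnd]
  change TwistedDual.toDual ν (DegreeOne.val 𝒯 τ).snd (x * c) =
    TwistedDual.toDual ν (TrivSqZeroExt.inl (c : A) * DegreeOne.val 𝒯 τ).snd x
  rw [TrivSqZeroExt.snd_mul, TrivSqZeroExt.snd_inl, smul_zero, add_zero, TrivSqZeroExt.fst_inl,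
    TwistedDual.toDual_smul]

end Coefficients

section Decomposition

variable [DirectSum.Decomposition 𝒜]

/-- The map `A^∨ → A₁ ⊕ (A_n)^∨` that restricts a functional to degree `n`. -/
noncomputable def inrOne : Module.Dual k A →ₗ[k] DegreeOne 𝒯 where
  toFun φ := ⟨TrivSqZeroExt.inr ((TwistedDual.toDual ν).symm (φ ∘ₗ homPart 𝒜 n)),
    (H.mem_iff 1 _).mpr ⟨zero_mem _, fun i hi a ha => by
      change φ (homPart 𝒜 n a) = 0
      rw [homPart_ne ha (by omega), map_zero]⟩⟩
  map_add' _ _ := DegreeOne.val_injective (TrivSqZeroExt.ext (add_zero _).symm rfl)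
  map_smul' _ _ := DegreeOne.val_injective (TrivSqZeroExt.ext (smul_zero _).symm rfl)

theorem val_inrOne (φ : Module.Dual k A) : DegreeOne.val 𝒯 (H.inrOne φ) =
    TrivSqZeroExt.inr ((TwistedDual.toDual ν).symm (φ ∘ₗ homPart 𝒜 n)) := rfl

theorem sndOne_inrOne (φ : Module.Dual k A) : sndOne 𝒯 (H.inrOne φ) = φ ∘ₗ homPart 𝒜 n := rfl

theorem fstOne_inrOne (φ : Module.Dual k A) : H.fstOne (H.inrOne φ) = 0 := rfl

include H in
theorem sndOne_comp_homPart (τ : DegreeOne 𝒯) (x : A) :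
    sndOne 𝒯 τ (homPart 𝒜 n x) = sndOne 𝒯 τ x := by
  induction x using homogeneous_induction 𝒜 with
  | hadd x y hx hy => rw [map_add, map_add, map_add, hx, hy]
  | h i x hx =>
    by_cases hi : i = n
    · subst hi; rw [homPart_same hx]
    · rw [homPart_ne hx hi, map_zero, H.sndOne_apply_of_mem τ hi hx]

include H in
theorem evalSnd_homPart (x : A) : evalSnd 𝒯 (homPart 𝒜 n x) = evalSnd 𝒯 x :=
  DegreeOneDual.ext fun τ => H.sndOne_comp_homPart τ x

theorem inlOne_add_inrOne (τ : DegreeOne 𝒯) :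
    H.inlOne (H.fstOne τ) + H.inrOne (sndOne 𝒯 τ) = τ := by
  apply DegreeOne.val_injective
  apply TrivSqZeroExt.ext
  · exact add_zero _
  · apply TwistedDual.ext
    intro x
    exact (zero_add _).trans (H.sndOne_comp_homPart τ x)

variable [Module.Finite k A]

/-- The element of `A_n` that represents the restriction to `(A_n)^∨` of a functional on
`A₁ ⊕ (A_n)^∨`. -/
noncomputable def rep : DegreeOneDual 𝒯 →ₗ[k] A :=
  (Module.evalEquiv k A).symm.toLinearMap ∘ₗ H.inrOne.dualMap ∘ₗ
    (DegreeOneDual.toDual 𝒯).toLinearMap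

theorem apply_rep (φ : Module.Dual k A) (G : DegreeOneDual 𝒯) :
    φ (H.rep G) = DegreeOneDual.toDual 𝒯 G (H.inrOne φ) :=
  Module.apply_evalEquiv_symm_apply _ _ _ _

theorem rep_fstDual (g : DegreeOneDual 𝒜) : H.rep (H.fstDual g) = 0 := by
  refine Module.forall_dual_apply_eq_zero_iff k _ |>.mp fun φ => ?_
  rw [H.apply_rep, toDual_fstDual, fstOne_inrOne, map_zero]

theorem rep_evalSnd (x : A) : H.rep (evalSnd 𝒯 x) = homPart 𝒜 n x := by
  rw [← sub_eq_zero]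
  refine Module.forall_dual_apply_eq_zero_iff k _ |>.mp fun φ => ?_
  rw [map_sub, H.apply_rep, toDual_evalSnd, sndOne_inrOne]
  exact sub_self _

/-- The dual of `A₁ ⊕ (A_n)^∨` is the sum of the dual of `A₁` and of `A_n`. -/
theorem fstDual_add_evalSnd (G : DegreeOneDual 𝒯) :
    H.fstDual (H.inlDual G) + evalSnd 𝒯 (H.rep G) = G := by
  apply DegreeOneDual.ext
  intro τ
  rw [map_add, LinearMap.add_apply, toDual_fstDual, toDual_inlDual, toDual_evalSnd, H.apply_rep,
    ← map_add, H.inlOne_add_inrOne]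

end Decomposition

section Coefficients

variable [SetLike.GradedMonoid 𝒜] [SetLike.GradedMonoid 𝒯] [DirectSum.Decomposition 𝒜]

/-- The component of degree zero of the trivial extension is that of `A`, as `(A_{n+1})^∨` is zero.
-/
theorem inlZero_fstZero (hn : 𝒜 (n + 1) = ⊥) (c : 𝒯 0) : H.inlZero (H.fstZero c) = c := by
  apply Subtype.ext
  apply TrivSqZeroExt.ext
  · rfl
  · apply TwistedDual.ext
    intro x
    change 0 = _
    induction x using homogeneous_induction 𝒜 with
    | hadd x y hx hy => rw [map_add, ← hx, ← hy, add_zero]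
    | h i x hx =>
      by_cases hi : i = n + 1
      · subst hi
        rw [hn, Submodule.mem_bot] at hx
        rw [hx, map_zero]
      · exact (((H.mem_iff 0 _).mp c.2).2 i hi x hx).symm

theorem inlDual_smul (hn : 𝒜 (n + 1) = ⊥) (c : 𝒯 0) (G : DegreeOneDual 𝒯) :
    H.inlDual (c • G) = H.fstZero c • H.inlDual G := by
  conv_lhs => rw [← H.inlZero_fstZero hn c]
  apply DegreeOneDual.ext
  intro a
  rw [DegreeOneDual.toDual_smul, toDual_inlDual, toDual_inlDual, DegreeOneDual.toDual_smul]
  congr 1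
  exact DegreeOne.val_injective (TrivSqZeroExt.inl_mul _ _ _).symm

theorem inlDual_op_smul (hn : 𝒜 (n + 1) = ⊥) (c : 𝒯 0) (G : DegreeOneDual 𝒯) :
    H.inlDual (MulOpposite.op c • G) = MulOpposite.op (H.fstZero c) • H.inlDual G := by
  conv_lhs => rw [← H.inlZero_fstZero hn c]
  apply DegreeOneDual.ext
  intro a
  rw [DegreeOneDual.toDual_op_smul, toDual_inlDual, toDual_inlDual, DegreeOneDual.toDual_op_smul]
  congr 1
  exact DegreeOne.val_injective (TrivSqZeroExt.inl_mul _ _ _).symm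

theorem op_smul_inrOne (c : 𝒜 0) (φ : Module.Dual k A) :
    MulOpposite.op (H.inlZero c) • H.inrOne φ = H.inrOne (φ ∘ₗ LinearMap.mulLeft k (c : A)) := by
  apply DegreeOne.val_injective
  rw [DegreeOne.val_op_smul, coe_inlZero, val_inrOne, val_inrOne, TrivSqZeroExt.inr_mul_inl]
  congr 1
  apply TwistedDual.ext
  intro x
  rw [TwistedDual.toDual_op_smul, H.aut_coe]
  exact congrArg φ (homPart_mul_left 𝒜 c.2 n x)

theorem smul_inrOne (c : 𝒜 0) (φ : Module.Dual k A) :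
    H.inlZero c • H.inrOne φ = H.inrOne (φ ∘ₗ LinearMap.mulRight k (c : A)) := by
  apply DegreeOne.val_injective
  rw [DegreeOne.val_smul, coe_inlZero, val_inrOne, val_inrOne, TrivSqZeroExt.inl_mul_inr]
  congr 1
  apply TwistedDual.ext
  intro x
  rw [TwistedDual.toDual_smul]
  exact congrArg φ (homPart_mul_right 𝒜 c.2 n x)

variable [Module.Finite k A]

theorem rep_smul (hn : 𝒜 (n + 1) = ⊥) (c : 𝒯 0) (G : DegreeOneDual 𝒯) :
    H.rep (c • G) = H.fstZero c * H.rep G := by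
  rw [← sub_eq_zero]
  refine Module.forall_dual_apply_eq_zero_iff k _ |>.mp fun φ => ?_
  rw [map_sub, H.apply_rep, DegreeOneDual.toDual_smul]
  conv_lhs => enter [1]; rw [← H.inlZero_fstZero hn c, H.op_smul_inrOne, ← H.apply_rep]
  exact sub_self _

theorem rep_op_smul (hn : 𝒜 (n + 1) = ⊥) (c : 𝒯 0) (G : DegreeOneDual 𝒯) :
    H.rep (MulOpposite.op c • G) = H.rep G * H.fstZero c := by
  rw [← sub_eq_zero]
  refine Module.forall_dual_apply_eq_zero_iff k _ |>.mp fun φ => ?_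
  rw [map_sub, H.apply_rep, DegreeOneDual.toDual_op_smul]
  conv_lhs => enter [1]; rw [← H.inlZero_fstZero hn c, H.smul_inrOne, ← H.apply_rep]
  exact sub_self _

end Coefficients

section DualFamily

variable [DirectSum.Decomposition 𝒜] {ι ρ : Type*} [Fintype ι] [Fintype ρ] (D : DualFamily 𝒜 ι)
  (b : Module.Basis ρ k A)

include H in
theorem sum_coord_smul_evalSnd (x : A) :
    ∑ r, b.coord r (homPart 𝒜 n x) • evalSnd 𝒯 (b r) = evalSnd 𝒯 x := by
  conv_rhs => rw [← H.evalSnd_homPart x, ← b.sum_repr (homPart 𝒜 n x)]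
  rw [map_sum]
  exact Finset.sum_congr rfl fun r _ => ((evalSnd 𝒯).map_smul _ _).symm

/-- A dual family of `A₁ ⊕ (A_n)^∨`, from one of `A₁` and a basis of `A`. -/
noncomputable def dualFamily : DualFamily 𝒯 (ι ⊕ ρ) where
  vec := Sum.elim (fun s => H.inlOne (D.vec s)) (fun r => H.inrOne (b.coord r))
  covec := Sum.elim (fun s => H.fstDual (D.covec s)) (fun r => evalSnd 𝒯 (b r))
  complete τ := by
    rw [Fintype.sum_sum_type]
    simp only [Sum.elim_inl, Sum.elim_inr, toDual_fstDual, toDual_evalSnd]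
    conv_rhs => rw [← H.inlOne_add_inrOne τ, ← D.complete (H.fstOne τ)]
    have h : ∑ r, sndOne 𝒯 τ (b r) • b.coord r = sndOne 𝒯 τ := b.sum_dual_apply_smul_coord _
    conv_rhs => rw [← h]
    simp only [map_sum, map_smul]

theorem elt_dualFamily_inl (s : ι) :
    (H.dualFamily D b).elt (Sum.inl s) = TrivSqZeroExt.inl (D.elt s) := rfl

theorem elt_dualFamily_inr (r : ρ) : (H.dualFamily D b).elt (Sum.inr r) =
    TrivSqZeroExt.inr ((TwistedDual.toDual ν).symm (b.coord r ∘ₗ homPart 𝒜 n)) := rfl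

theorem covec_dualFamily_inl (s : ι) :
    (H.dualFamily D b).covec (Sum.inl s) = H.fstDual (D.covec s) := rfl

theorem covec_dualFamily_inr (r : ρ) :
    (H.dualFamily D b).covec (Sum.inr r) = evalSnd 𝒯 (b r) := rfl

variable {C : Type*} [Ring C] [Algebra k C] (g : DegreeOneDual 𝒯 →ₗ[k] C)
  (F : TrivSqZeroExt A (TwistedDual ν) →ₗ[k] k) {y : A}

theorem sum_inl_mul_inr (hy : ∀ f, F (TrivSqZeroExt.inr f) = TwistedDual.toDual ν f y) (s : ι) :
    ∑ r, F ((H.dualFamily D b).elt (Sum.inl s) * (H.dualFamily D b).elt (Sum.inr r)) •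
      (g ((H.dualFamily D b).covec (Sum.inr r)) * g ((H.dualFamily D b).covec (Sum.inl s))) =
    g (evalSnd 𝒯 (y * D.elt s)) * g (H.fstDual (D.covec s)) := by
  rw [← H.sum_coord_smul_evalSnd b (y * D.elt s), map_sum, Finset.sum_mul]
  refine Finset.sum_congr rfl fun r _ => ?_
  rw [elt_dualFamily_inl, elt_dualFamily_inr, TrivSqZeroExt.inl_mul_inr, hy,
    TwistedDual.toDual_smul, covec_dualFamily_inl, covec_dualFamily_inr, g.map_smul, smul_mul_assoc]
  rfl

theorem sum_inr_mul_inl (hy : ∀ f, F (TrivSqZeroExt.inr f) = TwistedDual.toDual ν f y) (s : ι) :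
    ∑ r, F ((H.dualFamily D b).elt (Sum.inr r) * (H.dualFamily D b).elt (Sum.inl s)) •
      (g ((H.dualFamily D b).covec (Sum.inl s)) * g ((H.dualFamily D b).covec (Sum.inr r))) =
    g (H.fstDual (D.covec s)) * g (evalSnd 𝒯 ((-1 : k) ^ n • (D.elt s * y))) := by
  rw [← H.sum_coord_smul_evalSnd b ((-1 : k) ^ n • (D.elt s * y)), map_sum, Finset.mul_sum]
  refine Finset.sum_congr rfl fun r _ => ?_
  rw [elt_dualFamily_inl, elt_dualFamily_inr, TrivSqZeroExt.inr_mul_inl, hy,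
    TwistedDual.toDual_op_smul, H.aut_apply 1 _ (D.elt_mem s), pow_one, smul_mul_assoc,
    covec_dualFamily_inl, covec_dualFamily_inr, g.map_smul, mul_smul_comm]
  rfl

/-- The relations of the quadratic dual of the trivial extension, for the functional that is given
by `F` on `A` and by the evaluation at `y` on `A^∨`. -/
theorem sum_dualFamily (hy : ∀ f, F (TrivSqZeroExt.inr f) = TwistedDual.toDual ν f y) :
    ∑ p, ∑ q, F ((H.dualFamily D b).elt p * (H.dualFamily D b).elt q) •
      (g ((H.dualFamily D b).covec q) * g ((H.dualFamily D b).covec p)) =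
    ∑ s, ∑ t, F (TrivSqZeroExt.inl (D.elt s * D.elt t)) •
        (g (H.fstDual (D.covec t)) * g (H.fstDual (D.covec s))) +
      (∑ s, g (evalSnd 𝒯 (y * D.elt s)) * g (H.fstDual (D.covec s)) +
        ∑ s, g (H.fstDual (D.covec s)) * g (evalSnd 𝒯 ((-1 : k) ^ n • (D.elt s * y)))) := by
  have hrr : ∀ r q : ρ,
      F ((H.dualFamily D b).elt (Sum.inr r) * (H.dualFamily D b).elt (Sum.inr q)) •
        (g ((H.dualFamily D b).covec (Sum.inr q)) * g ((H.dualFamily D b).covec (Sum.inr r))) =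
        0 := by
    intro r q
    rw [elt_dualFamily_inr, elt_dualFamily_inr, TrivSqZeroExt.inr_mul_inr, map_zero, zero_smul]
  simp only [Fintype.sum_sum_type, Finset.sum_add_distrib, hrr, Finset.sum_const_zero, add_zero]
  rw [Finset.sum_comm (s := (Finset.univ : Finset ρ))]
  simp only [H.sum_inl_mul_inr D b g F hy, H.sum_inr_mul_inl D b g F hy]
  rw [add_assoc, add_comm (∑ s, g (H.fstDual (D.covec s)) * _)]
  simp only [elt_dualFamily_inl, covec_dualFamily_inl, TrivSqZeroExt.inl_mul]

end DualFamily

end IsTrivialExtensionGrading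

/-! ### The comparison isomorphism -/

namespace IsTrivialExtensionGrading

variable {k : Type u} [Field k] {A : Type v} [Ring A] [Algebra k A]
  {𝒜 : ℕ → Submodule k A} [SetLike.GradedMonoid 𝒜] [DirectSum.Decomposition 𝒜]
  [Module.Finite k A] {ν : A ≃ₐ[k] A} {n : ℕ}
  {𝒯 : ℕ → Submodule k (TrivSqZeroExt A (TwistedDual ν))} [SetLike.GradedMonoid 𝒯]
  (H : IsTrivialExtensionGrading 𝒜 ν n 𝒯) {ι : Type*} [Fintype ι] (D : DualFamily 𝒜 ι)

/-- The homomorphism between the quadratic duals that is induced by the projection of the trivial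
extension onto `A`. -/
noncomputable def dualHom : QuadraticDual 𝒜 →ₐ[k] QuadraticDual 𝒯 :=
  QuadraticDual.lift D ((QuadraticDual.coeff 𝒯).comp H.inlZero) (QuadraticDual.gen ∘ₗ H.fstDual)
    (fun c g => (congrArg QuadraticDual.gen (H.fstDual_smul c g)).trans
      (QuadraticDual.gen_smul _ _))
    (fun c g => (congrArg QuadraticDual.gen (H.fstDual_op_smul c g)).trans
      (QuadraticDual.gen_op_smul _ _))
    (fun F => by
      have h := H.sum_dualFamily D (Module.finBasis k A) QuadraticDual.gen
        (F ∘ₗ (TrivSqZeroExt.fstHom k A (TwistedDual ν)).toLinearMap) (y := 0)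
        (fun f => (map_zero F).trans (map_zero (TwistedDual.toDual ν f)).symm)
      rw [QuadraticDual.relation] at h
      simp only [zero_mul, mul_zero, smul_zero, map_zero, Finset.sum_const_zero, add_zero] at h
      exact h.symm)

theorem dualHom_coeff (c : 𝒜 0) :
    H.dualHom D (QuadraticDual.coeff 𝒜 c) = QuadraticDual.coeff 𝒯 (H.inlZero c) :=
  QuadraticDual.lift_coeff ..

theorem dualHom_gen (g : DegreeOneDual 𝒜) :
    H.dualHom D (QuadraticDual.gen g) = QuadraticDual.gen (H.fstDual g) :=
  QuadraticDual.lift_gen ..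

/-- In the quadratic dual of the trivial extension, the elements of the dual of `(A_n)^∨` satisfy
the relations of the bimodule `Ext^n_{B^e}(B, B^e)`. -/
theorem gen_evalSnd_relation (x : A) :
    ∑ s, QuadraticDual.gen (evalSnd 𝒯 (x * D.elt s)) * H.dualHom D (QuadraticDual.gen (D.covec s)) +
      ∑ s, H.dualHom D (QuadraticDual.gen (D.covec s)) *
        QuadraticDual.gen (evalSnd 𝒯 ((-1 : k) ^ n • (D.elt s * x))) = 0 := by
  have h := H.sum_dualFamily D (Module.finBasis k A) QuadraticDual.gen (y := x)
    { toFun := fun τ => TwistedDual.toDual ν τ.snd x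
      map_add' := fun _ _ => rfl
      map_smul' := fun _ _ => rfl } (fun f => rfl)
  rw [QuadraticDual.relation] at h
  simp only [dualHom_gen]
  refine Eq.trans ?_ h.symm
  refine (zero_add _).symm.trans (congrArg (· + _) (Eq.symm ?_))
  exact Finset.sum_eq_zero fun s _ => Finset.sum_eq_zero fun t _ => zero_smul k _

variable {D} {η : A →+ EnvelopingExt k (QuadraticDual 𝒜) n} (E : IsExtPresentation D n η)

include E in
/-- The map of `Ext^n_{B^e}(B, B^e)` to the quadratic dual of the trivial extension that sends the
generator `η x` to the functional of evaluation at `x`. -/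
theorem exists_ext_hom : ∃ Φ : EnvelopingExt k (QuadraticDual 𝒜) n →+ QuadraticDual 𝒯,
    (∀ b m, Φ (b • m) = H.dualHom D b * Φ m) ∧
      (∀ (b : QuadraticDual 𝒜) m, Φ (MulOpposite.op b • m) = Φ m * H.dualHom D b) ∧
      ∀ x, Φ (η x) = QuadraticDual.gen (evalSnd 𝒯 x) := by
  refine E.exists_lift (H.dualHom D) (QuadraticDual.gen ∘ₗ evalSnd 𝒯) ?_ ?_ ?_ ?_
  · intro l hl a ha
    exact (congrArg QuadraticDual.gen (H.evalSnd_of_mem hl ha)).trans (map_zero _)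
  · intro c x
    rw [dualHom_coeff, LinearMap.comp_apply, H.evalSnd_coe_mul, QuadraticDual.gen_smul]
    rfl
  · intro c x
    rw [dualHom_coeff, LinearMap.comp_apply, H.evalSnd_mul_coe, QuadraticDual.gen_op_smul]
    rfl
  · exact H.gen_evalSnd_relation D

end IsTrivialExtensionGrading

namespace IsExtPresentation

variable {k : Type u} [Field k] {A : Type v} [Ring A] [Algebra k A]
  {𝒜 : ℕ → Submodule k A} [SetLike.GradedMonoid 𝒜] {n : ℕ} {ι : Type*} [Fintype ι]
  {D : DualFamily 𝒜 ι} {η : A →+ EnvelopingExt k (QuadraticDual 𝒜) n} (E : IsExtPresentation D n η)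

/-- The generators of the bimodule as elements of the higher preprojective algebra. -/
noncomputable def gen : A →ₗ[k] HigherPreprojectiveAlgebra k (QuadraticDual 𝒜) n where
  toFun x := TensorRing.ι k _ _ (η x)
  map_add' x y := by rw [map_add, map_add]
  map_smul' r x := by
    have h := E.coe_mul (algebraMap k (𝒜 0) r) x
    rw [SetLike.GradeZero.coe_algebraMap, ← Algebra.smul_def] at h
    rw [h, TensorRing.ι_smul, AlgHom.commutes, AlgHom.commutes, RingHom.id_apply, Algebra.smul_def]

theorem gen_apply (x : A) : E.gen x = TensorRing.ι k _ _ (η x) := rfl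

theorem gen_coe_mul (c : 𝒜 0) (x : A) :
    E.gen (c * x) = TensorRing.coeff k _ _ (QuadraticDual.coeff 𝒜 c) * E.gen x := by
  rw [gen_apply, E.coe_mul, TensorRing.ι_smul, gen_apply]

theorem gen_mul_coe (c : 𝒜 0) (x : A) :
    E.gen (x * c) = E.gen x * TensorRing.coeff k _ _ (QuadraticDual.coeff 𝒜 c) := by
  rw [gen_apply, E.mul_coe, TensorRing.ι_op_smul, gen_apply]

theorem gen_relation (x : A) :
    ∑ s, E.gen (x * D.elt s) * TensorRing.coeff k _ _ (QuadraticDual.gen (D.covec s)) +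
      ∑ s, TensorRing.coeff k _ _ (QuadraticDual.gen (D.covec s)) *
        E.gen ((-1 : k) ^ n • (D.elt s * x)) = 0 := by
  have h := congrArg (TensorRing.ι k (QuadraticDual 𝒜) (EnvelopingExt k (QuadraticDual 𝒜) n))
    (E.relation x)
  rw [map_add, map_sum, map_sum, map_zero] at h
  simp only [TensorRing.ι_smul, TensorRing.ι_op_smul] at h
  exact h

variable [DirectSum.Decomposition 𝒜]

theorem gen_homPart (x : A) : E.gen (homPart 𝒜 n x) = E.gen x := by
  induction x using homogeneous_induction 𝒜 with
  | hadd x y hx hy => rw [map_add, map_add, map_add, hx, hy]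
  | h i x hx =>
    by_cases hi : i = n
    · subst hi; rw [homPart_same hx]
    · rw [homPart_ne hx hi, map_zero, gen_apply, E.supported i hi x hx, map_zero]

variable [Module.Finite k A] {ν : A ≃ₐ[k] A}
  {𝒯 : ℕ → Submodule k (TrivSqZeroExt A (TwistedDual ν))}
  (H : IsTrivialExtensionGrading 𝒜 ν n 𝒯)

/-- The images in the higher preprojective algebra of the generators of the quadratic dual of the
trivial extension. -/
noncomputable def genDual :
    DegreeOneDual 𝒯 →ₗ[k] HigherPreprojectiveAlgebra k (QuadraticDual 𝒜) n :=
  (TensorRing.coeff k _ _).toLinearMap ∘ₗ QuadraticDual.gen ∘ₗ H.inlDual + E.gen ∘ₗ H.rep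

theorem genDual_apply (G : DegreeOneDual 𝒯) : E.genDual H G =
    TensorRing.coeff k _ _ (QuadraticDual.gen (H.inlDual G)) + E.gen (H.rep G) := rfl

theorem genDual_fstDual (g : DegreeOneDual 𝒜) :
    E.genDual H (H.fstDual g) = TensorRing.coeff k _ _ (QuadraticDual.gen g) := by
  rw [genDual_apply, H.inlDual_fstDual, H.rep_fstDual, map_zero, add_zero]

theorem genDual_evalSnd (x : A) :
    E.genDual H (IsTrivialExtensionGrading.evalSnd 𝒯 x) = E.gen x := by
  rw [genDual_apply, H.inlDual_evalSnd, H.rep_evalSnd, map_zero, map_zero, zero_add, gen_homPart]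

theorem genDual_relation {ρ : Type*} [Fintype ρ] (b : Module.Basis ρ k A)
    (F : TrivSqZeroExt A (TwistedDual ν) →ₗ[k] k) :
    ∑ p, ∑ q, F ((H.dualFamily D b).elt p * (H.dualFamily D b).elt q) •
      (E.genDual H ((H.dualFamily D b).covec q) * E.genDual H ((H.dualFamily D b).covec p)) =
        0 := by
  -- The restriction of `F` to `A^∨` is the evaluation at an element `y` of `A`.
  let F₂ : Module.Dual k (Module.Dual k A) :=
    { toFun := fun φ => F (TrivSqZeroExt.inr ((TwistedDual.toDual ν).symm φ))
      map_add' := fun φ ψ => by rw [map_add, TrivSqZeroExt.inr_add, map_add]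
      map_smul' := fun r φ => by
        rw [map_smul, TrivSqZeroExt.inr_smul, map_smul, RingHom.id_apply] }
  have hy : ∀ f, F (TrivSqZeroExt.inr f) =
      TwistedDual.toDual ν f ((Module.evalEquiv k A).symm F₂) :=
    fun f => (Module.apply_evalEquiv_symm_apply k A (TwistedDual.toDual ν f) F₂).symm
  rw [H.sum_dualFamily D b (E.genDual H) F hy]
  simp only [genDual_fstDual, genDual_evalSnd]
  rw [E.gen_relation, add_zero]
  have h := congrArg (TensorRing.coeff k (QuadraticDual 𝒜) (EnvelopingExt k (QuadraticDual 𝒜) n))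
    (QuadraticDual.relation D (F ∘ₗ (TrivSqZeroExt.inlAlgHom k A (TwistedDual ν)).toLinearMap))
  rw [map_zero, map_sum] at h
  simp only [map_sum, map_smul, map_mul] at h
  exact h

variable [SetLike.GradedMonoid 𝒯] (hn : 𝒜 (n + 1) = ⊥)

include hn in
theorem genDual_smul (c : 𝒯 0) (G : DegreeOneDual 𝒯) : E.genDual H (c • G) =
    TensorRing.coeff k _ _ (QuadraticDual.coeff 𝒜 (H.fstZero c)) * E.genDual H G := by
  rw [genDual_apply, H.inlDual_smul hn, H.rep_smul hn, QuadraticDual.gen_smul, map_mul,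
    gen_coe_mul, ← mul_add, genDual_apply]

include hn in
theorem genDual_op_smul (c : 𝒯 0) (G : DegreeOneDual 𝒯) : E.genDual H (MulOpposite.op c • G) =
    E.genDual H G * TensorRing.coeff k _ _ (QuadraticDual.coeff 𝒜 (H.fstZero c)) := by
  rw [genDual_apply, H.inlDual_op_smul hn, H.rep_op_smul hn, QuadraticDual.gen_op_smul, map_mul,
    gen_mul_coe, ← add_mul, genDual_apply]

/-- The homomorphism from the quadratic dual of the trivial extension to the higher preprojective
algebra. -/
noncomputable def ofDual :
    QuadraticDual 𝒯 →ₐ[k] HigherPreprojectiveAlgebra k (QuadraticDual 𝒜) n :=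
  QuadraticDual.lift (H.dualFamily D (Module.finBasis k A))
    ((TensorRing.coeff k _ _).comp ((QuadraticDual.coeff 𝒜).comp H.fstZero)) (E.genDual H)
    (E.genDual_smul H hn) (E.genDual_op_smul H hn) (E.genDual_relation H (Module.finBasis k A))

theorem ofDual_coeff (c : 𝒯 0) : E.ofDual H hn (QuadraticDual.coeff 𝒯 c) =
    TensorRing.coeff k _ _ (QuadraticDual.coeff 𝒜 (H.fstZero c)) :=
  QuadraticDual.lift_coeff ..

theorem ofDual_gen (G : DegreeOneDual 𝒯) :
    E.ofDual H hn (QuadraticDual.gen G) = E.genDual H G :=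
  QuadraticDual.lift_gen ..

theorem ofDual_dualHom (b : QuadraticDual 𝒜) :
    E.ofDual H hn (H.dualHom D b) = TensorRing.coeff k _ _ b := by
  have h : (E.ofDual H hn).comp (H.dualHom D) = TensorRing.coeff k _ _ := by
    apply QuadraticDual.hom_ext
    · intro c
      rw [AlgHom.comp_apply, H.dualHom_coeff, ofDual_coeff, H.fstZero_inlZero]
    · intro g
      rw [AlgHom.comp_apply, H.dualHom_gen, ofDual_gen, genDual_fstDual]
  exact AlgHom.congr_fun h b

include E hn in
/-- The two homomorphisms are inverse to each other on generators. -/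
theorem exists_preprojective_algEquiv :
    ∃ φ : HigherPreprojectiveAlgebra k (QuadraticDual 𝒜) n ≃ₐ[k] QuadraticDual 𝒯,
      ∀ c : 𝒜 0, φ (TensorRing.coeff k _ _ (QuadraticDual.coeff 𝒜 c)) =
        QuadraticDual.coeff 𝒯 (H.inlZero c) := by
  obtain ⟨Φ, hl, hr, hη⟩ := H.exists_ext_hom E
  have hι : ∀ m, E.ofDual H hn (Φ m) = TensorRing.ι k _ _ m := by
    refine E.induction (AddMonoidHom.eqLocus (((E.ofDual H hn).toLinearMap.toAddMonoidHom).comp Φ)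
      (TensorRing.ι k _ _)) (fun x => ?_) (fun b m hm => ?_) (fun b m hm => ?_)
    · change E.ofDual H hn (Φ (η x)) = TensorRing.ι k _ _ (η x)
      rw [hη, ofDual_gen, genDual_evalSnd, gen_apply]
    · change E.ofDual H hn (Φ (b • m)) = TensorRing.ι k _ _ (b • m)
      change E.ofDual H hn (Φ m) = TensorRing.ι k _ _ m at hm
      rw [hl, map_mul, ofDual_dualHom, hm, TensorRing.ι_smul]
    · change E.ofDual H hn (Φ (MulOpposite.op b • m)) = TensorRing.ι k _ _ (MulOpposite.op b • m)
      change E.ofDual H hn (Φ m) = TensorRing.ι k _ _ m at hm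
      rw [hr, map_mul, ofDual_dualHom, hm, TensorRing.ι_op_smul]
  refine ⟨AlgEquiv.ofAlgHom (TensorRing.lift (H.dualHom D) Φ hl hr) (E.ofDual H hn) ?_ ?_, ?_⟩
  · apply QuadraticDual.hom_ext
    · intro c
      rw [AlgHom.comp_apply, ofDual_coeff, TensorRing.lift_coeff, H.dualHom_coeff,
        H.inlZero_fstZero hn]
      rfl
    · intro G
      rw [AlgHom.comp_apply, ofDual_gen, genDual_apply, map_add, TensorRing.lift_coeff,
        H.dualHom_gen, gen_apply, TensorRing.lift_ι, hη, ← map_add, H.fstDual_add_evalSnd]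
      rfl
  · apply TensorRing.hom_ext
    · intro b
      rw [AlgHom.comp_apply, TensorRing.lift_coeff, ofDual_dualHom]
      rfl
    · intro m
      rw [AlgHom.comp_apply, TensorRing.lift_ι, hι]
      rfl
  · intro c
    exact (TensorRing.lift_coeff ..).trans (H.dualHom_coeff D c)

end IsExtPresentation

theorem isTrivialExtensionGrading {k : Type u} [Field k] {V : Type v} [Fintype V] [Quiver.{w} V]
    {I : Ideal (PathAlgebra k V)} [I.IsTwoSided] (hI : IsBoundIdeal k V I) (n : ℕ) :
    IsTrivialExtensionGrading (BoundQuiverAlgebra.grading I) (BoundQuiverAlgebra.signAut hI n) n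
      (TwistedTrivialExtension.grading hI n) where
  aut_apply _ _ hx := BoundQuiverAlgebra.signAut_of_mem hI n hx
  mem_iff _ _ := Iff.rfl

theorem corollary1 {k : Type u} [Field k] {V : Type v} [Fintype V] [Quiver.{w} V]
    [∀ i j : V, Finite (i ⟶ j)] (I : Ideal (PathAlgebra k V)) [I.IsTwoSided]
    (hI : IsBoundIdeal k V I) (n : ℕ) (hn : BoundQuiverAlgebra.IsHomogeneous I n)
    (hK : IsKoszulAlgebra (BoundQuiverAlgebra.grading I))
    (hq : IsQuadraticAlgebra (TwistedTrivialExtension.grading hI n)) :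
    ∃ φ : HigherPreprojectiveAlgebra k (QuadraticDual (BoundQuiverAlgebra.grading I)) n ≃ₐ[k]
        QuadraticDual (TwistedTrivialExtension.grading hI n),
      ∀ c : BoundQuiverAlgebra.grading I 0,
        φ (TensorRing.coeff k _ _ (QuadraticDual.coeff (BoundQuiverAlgebra.grading I) c)) =
          QuadraticDual.coeff (TwistedTrivialExtension.grading hI n)
            (TwistedTrivialExtension.inlZero hI n c) := by
  let _ := (BoundQuiverAlgebra.isInternal_grading hI).chooseDecomposition
  have := BoundQuiverAlgebra.module_finite hI
  obtain ⟨R⟩ := hK.nonempty_linearResolution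
  have : Module.Finite k (DegreeOne (BoundQuiverAlgebra.grading I)) :=
    Module.Finite.of_injective (DegreeOne.val (BoundQuiverAlgebra.grading I))
      DegreeOne.val_injective
  have h0 := hn.grading_succ hI
  obtain ⟨η, E⟩ := exists_isExtPresentation R (BoundQuiverAlgebra.splitGrading hI)
    (DualFamily.ofBasis (Module.finBasis k (DegreeOne (BoundQuiverAlgebra.grading I)))) h0
  exact E.exists_preprojective_algEquiv (isTrivialExtensionGrading hI n) h0
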